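/- **Conventions.** An arithmetic circuit over $\mathbb Z$ in variables $x_1,\dots,x_v$ is a list of nodes, each a variable, an integer constant, or the sum or product of two earlier nodes; the last node is the output. Its *bit size* is the number of nodes plus the total bit length of its constants. $f=(f_n)$ is one of the following families of integer polynomials: $f_n=\mathrm{perm}(X)$ for an $n\times n$ variable matrix $X$; or, for a fixed integer $k\ge 3$, $f_n=E(X)=\prod_{\sigma:\{1,\dots,n\}\to\{1,\dots,k\}}\det(X_\sigma)$, where $X$ consists of $kn$ variable vectors $X^j_i$ ($1\le j\le k$, $1\le i\le n$) of dimension $n$ and $X_\sigma$ is the $n\times n$ matrix with $i$-th column $X^{\sigma(i)}_i$. (Here $n$ is the matrix dimension; $E(X)$ has $kn^2$ variables, so "polynomial in $n$" means the same as "polynomial in the number of variables".) A *uniform circuit of polynomial bit size* is a family $(C_n)$ of such circuits, $C_n$ in the variables of $f_n$, for which some algorithm writes down $C_n$ from $n$ in time $\mathrm{poly}(n)$. Time is that of a standard deterministic machine; $n$ and $m$ are given in unary. **Hypothesis 1 (uniform hardness).** $f$ has no uniform circuit of polynomial bit size: for every uniform circuit $(C_n)$ of polynomial bit size, $C_n$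 does not compute $f_n$ for all sufficiently large $n$. (The theorem also holds if "for all sufficiently large $n$" is replaced by "for infinitely many $n$" throughout.) **Hypothesis 2 (black-box polynomial identity testing over $\mathbb Z$ can be derandomized).** There is a deterministic algorithm that decides whether a given arithmetic circuit over $\mathbb Z$ in $n$ variables computes the zero polynomial, in time polynomial in $n$ and the bit size of the circuit; and there are families $H_{n,m}$ of finite sets $h\subset\mathbb Z^n$ such that 1. (short) every $h\in H_{n,m}$ has $\mathrm{poly}(m)$ points, of total bit length $\mathrm{poly}(n,m)$, and every circuit in $n$ variables of bit size $\le m$ that computes a nonzero polynomial is nonzero at some point of $h$; 2. (rich) for $n\ge1$, $H_{n,m}$ contains $2^{\Omega(m)}$ pairwise disjoint sets; 3. (easy to verify) whether $h\in H_{n,m}$ is decided in time polynomial in $n$, $m$ and the bit length of $h$; 4. (easy to construct) some $h\in H_{n,m}$ is computed from $n,m$ in time $\mathrm{poly}(n,m)$. **Theorem.** Under Hypotheses 1 and 2, the uniform hardness of $f$ has an explicit proof. That is, there are sets $\mathcal O_{n,m}$ of bit strings (obstructions), and for each $s\in\mathcal O_{n,m}$ a finite set $S_{n,m}(s)$ of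 integer inputs of $f_n$, such that the following hold, where $|s|$ is the length of $s$, and all implied constants are independent of $n,m,s$ and the circuits. * **UF0 (short).** $\mathcal O_{n,m}$ contains a string of length $\mathrm{poly}(n,m)$. * **UF1 (easy to decode).** $|S_{n,m}(s)|=\mathrm{poly}(n,m,|s|)$, and for every uniform circuit $(C_n)$ of polynomial bit size and all sufficiently large $n$ the following holds: for every $m$ that is at least the bit size of $C_n$ and every $s\in\mathcal O_{n,m}$ there is $X\in S_{n,m}(s)$ with $C_n(X)\ne f_n(X)$. Moreover: (a) $S_{n,m}(s)$ is computed from $n,m,s$ in time $\mathrm{poly}(n,m,|s|)$; (b) from $n,m,s$ and a circuit $C$ of bit size $\le m$ in the variables of $f_n$, one can compute in time $\mathrm{poly}(n,m,|s|)$ a set $S_{n,m,C}(s)\subseteq S_{n,m}(s)$ of size $O(1)$, such that for every uniform circuit $(C_n)$ of polynomial bit size, all sufficiently large $n$, all $m$ that are at least the bit size of $C_n$ and all $s\in\mathcal O_{n,m}$, the set $S_{n,m,C_n}(s)$ contains $X$ with $C_n(X)\ne f_n(X)$. * **UF2 (rich).** For all large $n$ and $m$, $\mathcal O_{n,m}$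 contains $2^{\Omega(m)}$ strings of length $\mathrm{poly}(n,m)$ whose sets $S_{n,m}(s)$ are pairwise disjoint. * **UF3 (easy to verify).** Whether $s\in\mathcal O_{n,m}$ is decided in time $\mathrm{poly}(n,m,|s|)$. * **UF4 (easy to construct).** Some $s\in\mathcal O_{n,m}$ is computed from $n,m$ in time $\mathrm{poly}(n,m)$. In particular there is efficient diagonalization within an $O(1)$ factor: from $n$, $m$ and an algorithm $q$ that on input $n$ outputs a circuit in the variables of $f_n$ within time $m$, one can compute in time polynomial in $n$, $m$ and the length of $q$ a set of $O(1)$ inputs of $f_n$, such that whenever $q$ generates a uniform circuit $(C_n)$ in polynomial time, then for all sufficiently large $n$ and all $m$ at least the running time of $q$ on $n$, this set contains $X$ with $C_n(X)\ne f_n(X)$. -/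

import Mathlib

/-! ## Data and programs: a machine model with a step count -/

/-- The data of the machine model: binary trees (S-expressions over a single atom). -/
inductive Data : Type
  | nil : Data
  | node : Data → Data → Data

namespace Data

/-- The number of nodes and leaves of a tree: the bit length of the datum up to a constant. -/
def size : Data → ℕ
  | nil => 1
  | node a b => a.size + b.size + 1

/-- First component (of an atom: the atom). -/
def fst : Data → Data
  | nil => nil
  | node a _ => a

/-- Second component (of an atom: the atom). -/
def snd : Data → Data
  | nil => nil
  | node _ b => b

/-- Bits: `false` is the atom, `true` is the pair of two atoms. -/
def ofBool : Bool → Data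
  | false => nil
  | true => node nil nil

/-- The bit that says whether a proposition holds. -/
noncomputable def ofProp (P : Prop) : Data :=
  open Classical in if P then node nil nil else nil

/-- Natural numbers in unary. It is used for parameters `n`, `m` (running times are polynomial
in `n` and `m` themselves) and for the positions of nodes and variables in a circuit. -/
def ofNat : ℕ → Data
  | 0 => nil
  | k + 1 => node nil (ofNat k)

/-- Lists. -/
def ofList {α : Type} (enc : α → Data) : List α → Data
  | [] => nil
  | a :: l => node (enc a) (ofList enc l)

/-- Integers in binary: a sign and the bits of the absolute value, least significant first. -/
def ofInt (z : ℤ) : Data :=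
  node (ofBool (decide (z < 0))) (ofList ofBool z.natAbs.bits)

/-- Bit strings. -/
def ofBits (s : List Bool) : Data := ofList ofBool s

/-- Integer points, entries in binary. -/
def ofPoint {n : ℕ} (X : Fin n → ℤ) : Data := ofList ofInt (List.ofFn X)

/-- Finite lists of integer points. -/
def ofPoints {n : ℕ} (h : List (Fin n → ℤ)) : Data := ofList ofPoint h

end Data

/-- Programs: projections, pairing, composition, branching and `while`, on trees. -/
inductive Prog : Type
  | id : Prog
  | nil : Prog
  | fst : Prog
  | snd : Prog
  | pair : Prog → Prog → Prog
  | comp : Prog → Prog → Prog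
  | cond : Prog → Prog → Prog → Prog
  | loop : Prog → Prog → Prog

namespace Prog

/-- `Runs p x y t`: on input `x` the program `p` halts with output `y` after time `t`. A basic
operation costs the size of the datum that it handles (logarithmic cost; in particular no datum
produced in the course of a computation is larger than the time used). This measure and the time
of a Turing machine are polynomially related. -/
inductive Runs : Prog → Data → Data → ℕ → Prop
  | id (x : Data) : Runs Prog.id x x x.size
  | nil (x : Data) : Runs Prog.nil x Data.nil 1
  | fst (x : Data) : Runs Prog.fst x x.fst x.size
  | snd (x : Data) : Runs Prog.snd x x.snd x.size
  /- `pair f g` maps `x` to the pair of `f x` and `g x` -/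
  | pair {f g : Prog} {x y z : Data} {s t : ℕ} :
      Runs f x y s → Runs g x z t → Runs (Prog.pair f g) x (Data.node y z) (s + t + 1)
  /- `comp g f` first runs `f`, then `g` on its output -/
  | comp {f g : Prog} {x y z : Data} {s t : ℕ} :
      Runs f x y s → Runs g y z t → Runs (Prog.comp g f) x z (s + t + 1)
  /- `cond c f g` runs `f` if `c x` is a pair, and `g` if `c x` is the atom -/
  | cond_true {c f g : Prog} {x a b y : Data} {s t : ℕ} :
      Runs c x (Data.node a b) s → Runs f x y t → Runs (Prog.cond c f g) x y (s + t + 1)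
  | cond_false {c f g : Prog} {x y : Data} {s t : ℕ} :
      Runs c x Data.nil s → Runs g x y t → Runs (Prog.cond c f g) x y (s + t + 1)
  /- `loop c f` repeats `f` as long as the value of `c` is a pair -/
  | loop_done {c f : Prog} {x : Data} {s : ℕ} :
      Runs c x Data.nil s → Runs (Prog.loop c f) x x (s + x.size + 1)
  | loop_step {c f : Prog} {x a b y z : Data} {s t u : ℕ} :
      Runs c x (Data.node a b) s → Runs f x y t → Runs (Prog.loop c f) y z u →
        Runs (Prog.loop c f) x z (s + t + u + 1)

/-- The text of a program, as a datum (so that programs can be inputs of programs). -/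
def code : Prog → Data
  | id => .node (.ofNat 0) .nil
  | nil => .node (.ofNat 1) .nil
  | fst => .node (.ofNat 2) .nil
  | snd => .node (.ofNat 3) .nil
  | pair f g => .node (.ofNat 4) (.node f.code g.code)
  | comp g f => .node (.ofNat 5) (.node g.code f.code)
  | cond c f g => .node (.ofNat 6) (.node c.code (.node f.code g.code))
  | loop c f => .node (.ofNat 7) (.node c.code f.code)

/-- `p` halts on `x` with output `y` within time `b`. -/
def RunsWithin (p : Prog) (x y : Data) (b : ℕ) : Prop := ∃ t ≤ b, Runs p x y t

end Prog

/-- The problem with instances `a : α` satisfying the promise `dom a`, where instance `a` is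
presented as `inp a` and the answer is `out a`, is solved by a program in time polynomial in
`len a`. -/
def PolyTime {α : Type} (dom : α → Prop) (inp out : α → Data) (len : α → ℕ) : Prop :=
  ∃ (p : Prog) (c : ℕ), ∀ a, dom a → p.RunsWithin (inp a) (out a) ((len a + 2) ^ c)

/-! ## Arithmetic circuits over the integers -/

/-- A node of an arithmetic circuit over `ℤ` in `n` variables: a variable, a constant, or the sum
or product of two nodes, which are given by their positions. -/
inductive Gate (n : ℕ) : Type
  | var : Fin n → Gate n
  | const : ℤ → Gate n
  | add : ℕ → ℕ → Gate n
  | mul : ℕ → ℕ → Gate n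

namespace Gate

variable {n : ℕ}

/-- The node only refers to positions before `p`. -/
def Below (p : ℕ) : Gate n → Prop
  | var _ => True
  | const _ => True
  | add a b => a < p ∧ b < p
  | mul a b => a < p ∧ b < p

/-- The contribution of a node to the total bit size: one for the node, plus the bit length of the
constant (with its sign). -/
def bitSize : Gate n → ℕ
  | const z => 1 + (z.natAbs.size + 1)
  | _ => 1

/-- The value of a node at the point `x`, given the values of the nodes before it. -/
def value {R : Type} [CommRing R] (x : Fin n → R) (vals : List R) : Gate n → R
  | var i => x i
  | const z => (z : R)
  | add a b => vals.getD a 0 + vals.getD b 0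
  | mul a b => vals.getD a 0 * vals.getD b 0

/-- A node as a datum. -/
def toData : Gate n → Data
  | var i => .node (.ofNat 0) (.ofNat i)
  | const z => .node (.ofNat 1) (.ofInt z)
  | add a b => .node (.ofNat 2) (.node (.ofNat a) (.ofNat b))
  | mul a b => .node (.ofNat 3) (.node (.ofNat a) (.ofNat b))

end Gate

/-- An arithmetic circuit over `ℤ` in `n` variables: a list of nodes, each of which refers to
earlier nodes only. The last node is the output. -/
structure Circuit (n : ℕ) where
  gates : List (Gate n)
  wf : ∀ (p : ℕ) (h : p < gates.length), gates[p].Below p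

namespace Circuit

variable {n : ℕ}

/-- Total bit size: the number of nodes plus the total bit size of the constants. -/
def bitSize (C : Circuit n) : ℕ := (C.gates.map Gate.bitSize).sum

/-- The value of the circuit at the point `x` (zero for the circuit without nodes). -/
def eval {R : Type} [CommRing R] (C : Circuit n) (x : Fin n → R) : R :=
  (C.gates.foldl (fun vals g => vals ++ [g.value x vals]) []).getLastD 0

/-- The polynomial that the circuit computes. -/
noncomputable def poly (C : Circuit n) : MvPolynomial (Fin n) ℤ := C.eval MvPolynomial.X

/-- A circuit as a datum. -/
def toData (C : Circuit n) : Data := .ofList Gate.toData C.gates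

end Circuit

/-! ## The permanent and the function `E(X)` -/

/-- A family of integer polynomials, one for each matrix size `n`. -/
structure PolyFamily where
  vars : ℕ → ℕ
  poly : ∀ n, MvPolynomial (Fin (vars n)) ℤ

namespace PolyFamily

/-- Inputs at size `n`: integer values for all variables. -/
abbrev Point (f : PolyFamily) (n : ℕ) : Type := Fin (f.vars n) → ℤ

/-- The value of the `n`-th polynomial at an input. -/
noncomputable def value (f : PolyFamily) (n : ℕ) (X : f.Point n) : ℤ :=
  MvPolynomial.eval X (f.poly n)

end PolyFamily

/-- The permanent of the `n × n` variable matrix. -/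
noncomputable def permFamily : PolyFamily where
  vars n := n * n
  poly n := Matrix.permanent
    (Matrix.of fun i j : Fin n => MvPolynomial.X (finProdFinEquiv (i, j)))

/-- The function `E(X)`: there are `k * n` vector variables `X^j_i` (`j < k`, `i < n`) of dimension
`n`, and `E(X)` is the product over all `σ : {1, …, n} → {1, …, k}` of the determinant of the
`n × n` matrix whose `i`-th column is `X^{σ i}_i`. -/
noncomputable def eFamily (k : ℕ) : PolyFamily where
  vars n := k * n * n
  poly n := ∏ σ : Fin n → Fin k, Matrix.det
    (Matrix.of fun r i : Fin n =>
      MvPolynomial.X (finProdFinEquiv (finProdFinEquiv (σ i, i), r)))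

/-! ## Uniform hardness -/

/-- The program `q` generates the circuit family `C`: on input `n` it writes down the circuit
`C n`, in time polynomial in `n`. -/
def Generates {v : ℕ → ℕ} (q : Prog) (C : ∀ n, Circuit (v n)) : Prop :=
  ∃ a : ℕ, ∀ n, q.RunsWithin (.ofNat n) (C n).toData ((n + 2) ^ a)

/-- Uniform circuits of polynomial bit size (the bit size is at most the generating time). -/
def IsUniform {v : ℕ → ℕ} (C : ∀ n, Circuit (v n)) : Prop := ∃ q : Prog, Generates q C

/-- The two senses in which an asymptotic lower bound may hold: for all sufficiently large `n`, or
for infinitely many `n`. -/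
inductive Sense
  | almostAll
  | infinitelyMany

/-- `P n` holds for all sufficiently large `n`, respectively for infinitely many `n`. -/
def Sense.Holds : Sense → (ℕ → Prop) → Prop
  | almostAll, P => ∀ᶠ n in Filter.atTop, P n
  | infinitelyMany, P => ∃ᶠ n in Filter.atTop, P n

/-- No uniform circuit of polynomial bit size computes `f`. -/
def UniformlyHard (κ : Sense) (f : PolyFamily) : Prop :=
  ∀ C : ∀ n, Circuit (f.vars n), IsUniform C → κ.Holds fun n => (C n).poly ≠ f.poly n

/-! ## Derandomization of black box polynomial identity testing -/

/-- `h` is a hitting set against all circuits in `n` variables of bit size at most `m`. -/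
def IsHittingSet (n m : ℕ) (h : List (Fin n → ℤ)) : Prop :=
  ∀ C : Circuit n, C.bitSize ≤ m → C.poly ≠ 0 → ∃ X ∈ h, C.eval X ≠ 0

/-- A family `H n m` of hitting sets that is short, rich, easy to verify and easy to construct. -/
structure IsHittingFamily (H : ∀ n : ℕ, ℕ → Set (List (Fin n → ℤ))) : Prop where
  hits : ∀ n m, ∀ h ∈ H n m, IsHittingSet n m h
  /- every member has `poly(m)` points, of total bit size `poly(n, m)` -/
  short : ∃ c : ℕ, ∀ n m, ∀ h ∈ H n m,
    h.length ≤ (m + 2) ^ c ∧ (Data.ofPoints h).size ≤ (n + m + 2) ^ c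
  /- `2 ^ Ω(m)` pairwise disjoint members, if there is at least one variable -/
  rich : ∃ ε : ℝ, 0 < ε ∧ ∃ N : ℕ, ∀ n m, 1 ≤ n → N ≤ m →
    ∃ F : Finset (List (Fin n → ℤ)), (∀ h ∈ F, h ∈ H n m) ∧
      (2 : ℝ) ^ (ε * m) ≤ (F.card : ℝ) ∧
      (∀ h ∈ F, ∀ h' ∈ F, h ≠ h' → List.Disjoint h h')
  verify : PolyTime (α := Σ n : ℕ, ℕ × List (Fin n → ℤ)) (fun _ => True)
    (fun a => .node (.ofNat a.1) (.node (.ofNat a.2.1) (.ofPoints a.2.2)))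
    (fun a => .ofProp (a.2.2 ∈ H a.1 a.2.1))
    (fun a => a.1 + a.2.1 + (Data.ofPoints a.2.2).size)
  construct : ∃ h : ∀ n : ℕ, ℕ → List (Fin n → ℤ), (∀ n m, h n m ∈ H n m) ∧
    PolyTime (α := ℕ × ℕ) (fun _ => True)
      (fun a => .node (.ofNat a.1) (.ofNat a.2))
      (fun a => .ofPoints (h a.1 a.2))
      (fun a => a.1 + a.2)

/-- Black box polynomial identity testing over `ℤ` is derandomized: identity testing is decided in
deterministic polynomial time, and there is a short, rich, easy to verify and easy to construct
family of hitting sets. (Over `ℤ` the first part is not a formal consequence of the second one: the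
value of a circuit at a point of a hitting set may have exponentially many bits, and it still has
to be compared with zero.) -/
def BlackBoxPITDerandomized : Prop :=
  PolyTime (α := Σ n : ℕ, Circuit n) (fun _ => True)
    (fun a => .node (.ofNat a.1) a.2.toData)
    (fun a => .ofProp (a.2.poly = 0))
    (fun a => a.1 + a.2.bitSize) ∧
  ∃ H : ∀ n : ℕ, ℕ → Set (List (Fin n → ℤ)), IsHittingFamily H

/-! ## The uniform flip -/

/-- The uniform flip properties UF0 to UF4 of a family `O n m` of obstructions (bit strings)
against uniform circuits of bit size at most `m` for `f`. Here `S n m s` is the global obstruction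
set that the obstruction `s` denotes, and `T n m s C` is its subset selected for the circuit `C`;
`m` is arbitrary, in particular it may be any polynomially bounded function of `n`. -/
structure IsUniformFlip (κ : Sense) (f : PolyFamily) (O : ℕ → ℕ → Set (List Bool))
    (S : ∀ n : ℕ, ℕ → List Bool → List (f.Point n))
    (T : ∀ n : ℕ, ℕ → List Bool → Circuit (f.vars n) → List (f.Point n)) : Prop where
  /- UF0, short: there is an obstruction of length `poly(n, m)` -/
  short : ∃ c : ℕ, ∀ n m, ∃ s ∈ O n m, s.length ≤ (n + m + 2) ^ c
  /- UF1: the sets `S n m s` are small ... -/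
  small : ∃ c : ℕ, ∀ n m, ∀ s ∈ O n m, (S n m s).length ≤ (n + m + s.length + 2) ^ c
  /- ... they contain a counterexample against every uniform circuit of bit size `≤ m` ... -/
  obstructs : ∀ C : ∀ n, Circuit (f.vars n), IsUniform C →
    κ.Holds fun n => ∀ m, (C n).bitSize ≤ m → ∀ s ∈ O n m,
      ∃ X ∈ S n m s, (C n).eval X ≠ f.value n X
  /- ... (a) and are computed from `n`, `m`, `s` in polynomial time -/
  decode : PolyTime (α := ℕ × ℕ × List Bool)
    (fun a => a.2.2 ∈ O a.1 a.2.1)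
    (fun a => .node (.ofNat a.1) (.node (.ofNat a.2.1) (.ofBits a.2.2)))
    (fun a => .ofPoints (S a.1 a.2.1 a.2.2))
    (fun a => a.1 + a.2.1 + a.2.2.length)
  /- UF1 (b): from `n`, `m`, `s` and a circuit of bit size `≤ m` one computes in polynomial time
  a subset of `S n m s` of size `O(1)` ... -/
  select_subset : ∀ n m, ∀ s ∈ O n m, ∀ C : Circuit (f.vars n), C.bitSize ≤ m →
    T n m s C ⊆ S n m s
  select_small : ∃ K : ℕ, ∀ n m, ∀ s ∈ O n m, ∀ C : Circuit (f.vars n), C.bitSize ≤ m →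
    (T n m s C).length ≤ K
  select_time : PolyTime (α := Σ n : ℕ, ℕ × List Bool × Circuit (f.vars n))
    (fun a => a.2.2.1 ∈ O a.1 a.2.1 ∧ a.2.2.2.bitSize ≤ a.2.1)
    (fun a => .node (.ofNat a.1) (.node (.ofNat a.2.1)
      (.node (.ofBits a.2.2.1) a.2.2.2.toData)))
    (fun a => .ofPoints (T a.1 a.2.1 a.2.2.1 a.2.2.2))
    (fun a => a.1 + a.2.1 + a.2.2.1.length)
  /- ... that contains a counterexample, if the circuit is a uniform one -/
  select_counterexample : ∀ C : ∀ n, Circuit (f.vars n), IsUniform C →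
    κ.Holds fun n => ∀ m, (C n).bitSize ≤ m → ∀ s ∈ O n m,
      ∃ X ∈ T n m s (C n), (C n).eval X ≠ f.value n X
  /- UF2, rich: `2 ^ Ω(m)` pairwise disjoint obstructions of length `poly(n, m)` -/
  rich : ∃ ε : ℝ, 0 < ε ∧ ∃ c N : ℕ, ∀ n m, N ≤ n → N ≤ m →
    ∃ F : Finset (List Bool), (∀ s ∈ F, s ∈ O n m ∧ s.length ≤ (n + m + 2) ^ c) ∧
      (2 : ℝ) ^ (ε * m) ≤ (F.card : ℝ) ∧
      (∀ s ∈ F, ∀ s' ∈ F, s ≠ s' → List.Disjoint (S n m s) (S n m s'))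
  /- UF3, easy to verify -/
  verify : PolyTime (α := ℕ × ℕ × List Bool) (fun _ => True)
    (fun a => .node (.ofNat a.1) (.node (.ofNat a.2.1) (.ofBits a.2.2)))
    (fun a => .ofProp (a.2.2 ∈ O a.1 a.2.1))
    (fun a => a.1 + a.2.1 + a.2.2.length)
  /- UF4, easy to construct -/
  construct : ∃ s : ℕ → ℕ → List Bool, (∀ n m, s n m ∈ O n m) ∧
    PolyTime (α := ℕ × ℕ) (fun _ => True)
      (fun a => .node (.ofNat a.1) (.ofNat a.2))
      (fun a => .ofBits (s a.1 a.2))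
      (fun a => a.1 + a.2)

/-- The uniform hardness of `f` has an explicit proof: there is an obstruction family with the
uniform flip properties. -/
def HasExplicitProof (κ : Sense) (f : PolyFamily) : Prop :=
  ∃ (O : ℕ → ℕ → Set (List Bool)) (S : ∀ n : ℕ, ℕ → List Bool → List (f.Point n))
    (T : ∀ n : ℕ, ℕ → List Bool → Circuit (f.vars n) → List (f.Point n)),
    IsUniformFlip κ f O S T

/-- Efficient diagonalization within a factor `O(1)`: from `n`, `m` and the text of an algorithm
`q` that works within time `m` at size `n` (and outputs a circuit), one computes in polynomial time
a set `D n m q` of `O(1)` inputs; it contains a counterexample against every uniform circuit family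
that is generated by `q`. -/
def EfficientDiagonalization (κ : Sense) (f : PolyFamily) : Prop :=
  ∃ D : ∀ n : ℕ, ℕ → Prog → List (f.Point n),
    (∃ K : ℕ, ∀ n m q, (D n m q).length ≤ K) ∧
    PolyTime (α := ℕ × ℕ × Prog)
      (fun a => ∃ C : Circuit (f.vars a.1),
        a.2.2.RunsWithin (.ofNat a.1) C.toData a.2.1)
      (fun a => .node (.ofNat a.1) (.node (.ofNat a.2.1) a.2.2.code))
      (fun a => .ofPoints (D a.1 a.2.1 a.2.2))
      (fun a => a.1 + a.2.1 + a.2.2.code.size) ∧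
    ∀ (q : Prog) (C : ∀ n, Circuit (f.vars n)), Generates q C →
      κ.Holds fun n => ∀ m, q.RunsWithin (.ofNat n) (C n).toData m →
        ∃ X ∈ D n m q, (C n).eval X ≠ f.value n X

/-!
Both families have a *downward self-reduction* that can be used as a test. A point of stage `r` is
an input in which all vectors (rows of the matrix `X`, respectively vectors `X^j_i`) with number
`i ≥ r`, counted from `0`, are unit vectors. For the permanent, the value at a point of stage `r` is
the expansion along row `r - 1`, whose minors are points of stage `r - 1`. For `E(X)`, one vector
`X^j_{r-1}` clears coordinate `r - 1` of the earlier vectors, and the product over `j` of the values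
of `E` at the resulting points of stage `r - 1` determines the `k`-th power of `E` at stage `r`, up
to powers of a product of entries (`eFamily_value_relation`); the sign that remains ambiguous is
determined by the values at stage `r - 1`. The structure `SelfTest` says what is needed of such a
test, and `permSelfTest` and `eSelfTest` construct it.

If a circuit does not compute `f_n`, take the first stage `r` where it is wrong. Its test of stage
`r`, as a polynomial, is not zero, so it is not zero at some point of a hitting set restricted to
stage `r`; and at such a point the circuit is wrong, because it is right at the points of stage
`r - 1` with which the test compares. The obstruction set consists of the restrictions of a hitting
set to all stages, and the single point selected against a circuit is the first one, by increasing
stage, at which the test of that stage fails (`SelfTest.exists_mem_selected`). The value of a test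
at a given point is the value of a circuit without variables, so whether it vanishes is decided by
the identity testing algorithm.

Obstructions are seeds, that is, arbitrary bit strings `s` of length `m`. The entry number `0` of
every point of the hitting set, an entry that all stages keep, is replaced by the number whose
binary digits are `s`, a separating `1`, and the digits of the entry. Hence different seeds denote
disjoint sets, and no information is lost: adding the tag is an affine map on nonnegative and on
negative integers, so hitting the product of the two substituted tests is enough
(`Instr.exists_tagged_ne_zero`).

The tests are programs for a stack machine that can call the circuit under test; they are compiled
to circuits (`Instr.compile`). All running times come from `Feasible`, a notion of polynomial time
that is closed under composition, folds over lists and bounded iteration. For the diagonalization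
against a program, `Feasible.interpret` gives a universal program with polynomial overhead.
-/

/-! ### Polynomial-time programs -/

open Polynomial in
theorem Polynomial.eval_mono_nat (P : ℕ[X]) {a b : ℕ} (h : a ≤ b) : P.eval a ≤ P.eval b := by
  rw [Polynomial.eval_eq_sum_range, Polynomial.eval_eq_sum_range]
  gcongr

/-- Every polynomial with natural coefficients is below a power of `x + 2`. -/
theorem Polynomial.exists_eval_le_pow (P : Polynomial ℕ) :
    ∃ c : ℕ, ∀ x, P.eval x ≤ (x + 2) ^ c := by
  induction P using Polynomial.induction_on' with
  | add P Q hP hQ =>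
    obtain ⟨c, hc⟩ := hP
    obtain ⟨d, hd⟩ := hQ
    refine ⟨c + d + 1, fun x => ?_⟩
    have h1 : (x + 2) ^ c ≤ (x + 2) ^ (c + d) := Nat.pow_le_pow_right (by omega) (by omega)
    have h2 : (x + 2) ^ d ≤ (x + 2) ^ (c + d) := Nat.pow_le_pow_right (by omega) (by omega)
    have h3 : (x + 2) ^ (c + d + 1) = (x + 2) ^ (c + d) * (x + 2) := pow_succ _ _
    have := hc x
    have := hd x
    rw [Polynomial.eval_add]
    nlinarith
  | monomial n a =>
    refine ⟨a + n, fun x => ?_⟩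
    rw [Polynomial.eval_monomial, pow_add]
    have h1 : a ≤ (x + 2) ^ a := (Nat.lt_pow_self (by omega)).le
    have h2 : x ^ n ≤ (x + 2) ^ n := Nat.pow_le_pow_left (by omega) n
    exact Nat.mul_le_mul h1 h2

namespace Data

@[simp] theorem size_nil : nil.size = 1 := rfl
@[simp] theorem size_node (a b : Data) : (node a b).size = a.size + b.size + 1 := rfl
@[simp] theorem fst_node (a b : Data) : (node a b).fst = a := rfl
@[simp] theorem snd_node (a b : Data) : (node a b).snd = b := rfl
@[simp] theorem ofList_nil {α : Type} (e : α → Data) : ofList e [] = nil := rfl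
@[simp] theorem ofList_cons {α : Type} (e : α → Data) (a : α) (l : List α) :
    ofList e (a :: l) = node (e a) (ofList e l) := rfl

theorem size_pos (d : Data) : 1 ≤ d.size := by cases d <;> simp

theorem size_fst_le (d : Data) : d.fst.size ≤ d.size := by
  cases d with
  | nil => simp [fst]
  | node a b => simp; omega

theorem size_snd_le (d : Data) : d.snd.size ≤ d.size := by
  cases d with
  | nil => simp [snd]
  | node a b => simp; omega

@[simp] theorem size_ofNat (n : ℕ) : (ofNat n).size = 2 * n + 1 := by
  induction n with
  | zero => rfl
  | succ k ih => simp [ofNat, ih]; omega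

theorem size_ofList {α : Type} (e : α → Data) (l : List α) :
    (ofList e l).size = (l.map fun a => (e a).size + 1).sum + 1 := by
  induction l with
  | nil => rfl
  | cons a l ih => simp [ih]; omega

theorem ofList_map {α β : Type} (e : β → Data) (f : α → β) (l : List α) :
    ofList e (l.map f) = ofList (fun a => e (f a)) l := by
  induction l with
  | nil => rfl
  | cons a l ih => simp [ih]

theorem size_ofList_append {α : Type} (e : α → Data) (l l' : List α) :
    (ofList e (l ++ l')).size + 1 = (ofList e l).size + (ofList e l').size := by
  simp only [size_ofList, List.map_append, List.sum_append]; omega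

theorem size_ofList_reverse {α : Type} (e : α → Data) (l : List α) :
    (ofList e l.reverse).size = (ofList e l).size := by
  simp [size_ofList]

theorem length_le_size_ofList {α : Type} (e : α → Data) (l : List α) :
    l.length + 1 ≤ (ofList e l).size := by
  induction l with
  | nil => simp
  | cons a l ih => simp; omega

theorem size_lt_of_mem {α : Type} (e : α → Data) {l : List α} {a : α} (h : a ∈ l) :
    (e a).size < (ofList e l).size := by
  induction l with
  | nil => simp at h
  | cons b l ih =>
    rcases List.mem_cons.1 h with rfl | h
    · simp only [ofList_cons, size_node]; omega
    · have := ih h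
      simp only [ofList_cons, size_node]; omega

theorem size_ofList_le {α : Type} (e : α → Data) (l : List α) {B : ℕ}
    (h : ∀ a ∈ l, (e a).size ≤ B) : (ofList e l).size ≤ l.length * (B + 1) + 1 := by
  induction l with
  | nil => simp
  | cons a l ih =>
    have h1 := ih fun b hb => h b (List.mem_cons_of_mem _ hb)
    have h2 := h a List.mem_cons_self
    simp only [ofList_cons, size_node, List.length_cons, Nat.add_mul]
    omega

theorem size_ofList_prefix {α : Type} (e : α → Data) {l l' : List α} (h : l <+: l') :
    (ofList e l).size ≤ (ofList e l').size := by
  obtain ⟨t, rfl⟩ := h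
  have := size_ofList_append e l t
  have := size_pos (ofList e t)
  omega

end Data

namespace Prog

/-- No datum is larger than the time that was used to produce it. -/
theorem Runs.size_le {p : Prog} {x y : Data} {t : ℕ} (h : Runs p x y t) : y.size ≤ t := by
  induction h with
  | id x => exact le_rfl
  | nil x => exact le_rfl
  | fst x => exact x.size_fst_le
  | snd x => exact x.size_snd_le
  | pair _ _ h1 h2 => simp; omega
  | comp _ _ h1 h2 => omega
  | cond_true _ _ h1 h2 => omega
  | cond_false _ _ h1 h2 => omega
  | loop_done _ h => omega
  | loop_step _ _ _ h1 h2 h3 => omega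

theorem Runs.deterministic {p : Prog} {x y : Data} {t : ℕ} (h : Runs p x y t) :
    ∀ {y' : Data} {t' : ℕ}, Runs p x y' t' → y = y' := by
  induction h with
  | id x => intro _ _ h'; cases h'; rfl
  | nil x => intro _ _ h'; cases h'; rfl
  | fst x => intro _ _ h'; cases h'; rfl
  | snd x => intro _ _ h'; cases h'; rfl
  | pair _ _ h1 h2 =>
    intro _ _ h'
    cases h' with
    | pair a b => rw [h1 a, h2 b]
  | comp _ _ h1 h2 =>
    intro _ _ h'
    cases h' with
    | comp a b => rw [← h1 a] at b; exact h2 b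
  | cond_true _ _ h1 h2 =>
    intro _ _ h'
    cases h' with
    | cond_true a b => exact h2 b
    | cond_false a b => cases h1 a
  | cond_false _ _ h1 h2 =>
    intro _ _ h'
    cases h' with
    | cond_true a b => cases h1 a
    | cond_false a b => exact h2 b
  | loop_done _ h =>
    intro _ _ h'
    cases h' with
    | loop_done a => rfl
    | loop_step a b c => cases h a
  | loop_step _ _ _ h1 h2 h3 =>
    intro _ _ h'
    cases h' with
    | loop_done a => cases h1 a
    | loop_step a b c => rw [← h2 b] at c; exact h3 c

theorem RunsWithin.mono {p : Prog} {x y : Data} {b b' : ℕ} (h : p.RunsWithin x y b)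
    (hb : b ≤ b') : p.RunsWithin x y b' := by
  obtain ⟨t, ht, h⟩ := h
  exact ⟨t, ht.trans hb, h⟩

theorem RunsWithin.size_le {p : Prog} {x y : Data} {b : ℕ} (h : p.RunsWithin x y b) :
    y.size ≤ b := by
  obtain ⟨t, ht, h⟩ := h
  exact h.size_le.trans ht

theorem RunsWithin.pair {f g : Prog} {x y z : Data} {s t : ℕ} (hf : f.RunsWithin x y s)
    (hg : g.RunsWithin x z t) : (Prog.pair f g).RunsWithin x (.node y z) (s + t + 1) := by
  obtain ⟨s', hs, hf⟩ := hf
  obtain ⟨t', ht, hg⟩ := hg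
  exact ⟨_, by omega, hf.pair hg⟩

theorem RunsWithin.comp {f g : Prog} {x y z : Data} {s t : ℕ} (hf : f.RunsWithin x y s)
    (hg : g.RunsWithin y z t) : (Prog.comp g f).RunsWithin x z (s + t + 1) := by
  obtain ⟨s', hs, hf⟩ := hf
  obtain ⟨t', ht, hg⟩ := hg
  exact ⟨_, by omega, hf.comp hg⟩

theorem RunsWithin.cond_true {c f g : Prog} {x a b y : Data} {s t : ℕ}
    (hc : c.RunsWithin x (.node a b) s) (hf : f.RunsWithin x y t) :
    (Prog.cond c f g).RunsWithin x y (s + t + 1) := by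
  obtain ⟨s', hs, hc⟩ := hc
  obtain ⟨t', ht, hf⟩ := hf
  exact ⟨_, by omega, hc.cond_true hf⟩

theorem RunsWithin.cond_false {c f g : Prog} {x y : Data} {s t : ℕ}
    (hc : c.RunsWithin x .nil s) (hg : g.RunsWithin x y t) :
    (Prog.cond c f g).RunsWithin x y (s + t + 1) := by
  obtain ⟨s', hs, hc⟩ := hc
  obtain ⟨t', ht, hg⟩ := hg
  exact ⟨_, by omega, hc.cond_false hg⟩

/-- A loop that passes through the states `S 0, …, S L`. -/
theorem RunsWithin.loop {c f : Prog} {S : ℕ → Data} {B : ℕ} (L : ℕ)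
    (hc : ∀ i < L, ∃ a b, c.RunsWithin (S i) (.node a b) B)
    (hf : ∀ i < L, f.RunsWithin (S i) (S (i + 1)) B)
    (hL : c.RunsWithin (S L) .nil B) (hS : (S L).size ≤ B) :
    (Prog.loop c f).RunsWithin (S 0) (S L) ((L + 1) * (2 * B + 1)) := by
  suffices h : ∀ k ≤ L, (Prog.loop c f).RunsWithin (S (L - k)) (S L) ((k + 1) * (2 * B + 1)) by
    simpa using h L le_rfl
  intro k
  induction k with
  | zero =>
    intro _
    obtain ⟨s, hs, h⟩ := hL
    exact ⟨_, by rw [Nat.sub_zero]; omega, Runs.loop_done h⟩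
  | succ k ih =>
    intro hk
    obtain ⟨u, hu, h3⟩ := ih (by omega)
    obtain ⟨a, b, s, hs, h1⟩ := hc (L - (k + 1)) (by omega)
    obtain ⟨t, ht, h2⟩ := hf (L - (k + 1)) (by omega)
    rw [show L - (k + 1) + 1 = L - k by omega] at h2
    refine ⟨_, ?_, Runs.loop_step h1 h2 h3⟩
    have : (k + 1 + 1) * (2 * B + 1) = (k + 1) * (2 * B + 1) + (2 * B + 1) := by ring
    omega

end Prog

/-- One program maps each datum `inp a` to `out a`, in time polynomial in the size of `inp a`. In
contrast to `PolyTime` the time is measured in the size of the input, so that such maps compose;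
the index `a` ranges over an arbitrary type, so that `inp` describes a domain of inputs on which the
program is correct. -/
def Feasible {α : Type} (inp out : α → Data) : Prop :=
  ∃ (p : Prog) (P : Polynomial ℕ), ∀ a, p.RunsWithin (inp a) (out a) (P.eval (inp a).size)

namespace Feasible

variable {α : Type} {inp : α → Data}

theorem congr {out out' : α → Data} (h : Feasible inp out) (he : ∀ a, out a = out' a) :
    Feasible inp out' := by
  rwa [← funext he]

theorem self : Feasible inp inp := ⟨.id, Polynomial.X, fun a => ⟨_, by simp, .id _⟩⟩

theorem nil : Feasible inp fun _ => Data.nil := ⟨.nil, 1, fun a => ⟨_, by simp, .nil _⟩⟩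

/-- The output of a polynomial-time program has polynomial size. -/
theorem size_le {out : α → Data} (h : Feasible inp out) :
    ∃ P : Polynomial ℕ, ∀ a, (out a).size ≤ P.eval (inp a).size := by
  obtain ⟨p, P, hp⟩ := h
  exact ⟨P, fun a => (hp a).size_le⟩

theorem comp {mid out : α → Data} (h1 : Feasible inp mid) (h2 : Feasible mid out) :
    Feasible inp out := by
  obtain ⟨p, P, hp⟩ := h1
  obtain ⟨q, Q, hq⟩ := h2
  refine ⟨.comp q p, P + Q.comp P + 1, fun a => ((hp a).comp (hq a)).mono ?_⟩
  have := Q.eval_mono_nat (hp a).size_le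
  simp only [Polynomial.eval_add, Polynomial.eval_comp, Polynomial.eval_one]
  omega

theorem pair {f g : α → Data} (h1 : Feasible inp f) (h2 : Feasible inp g) :
    Feasible inp fun a => .node (f a) (g a) := by
  obtain ⟨p, P, hp⟩ := h1
  obtain ⟨q, Q, hq⟩ := h2
  exact ⟨.pair p q, P + Q + 1, fun a => ((hp a).pair (hq a)).mono (by simp)⟩

theorem fst {f : α → Data} (h : Feasible inp f) : Feasible inp fun a => (f a).fst :=
  h.comp ⟨.fst, Polynomial.X, fun a => ⟨_, by simp, .fst _⟩⟩

theorem snd {f : α → Data} (h : Feasible inp f) : Feasible inp fun a => (f a).snd :=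
  h.comp ⟨.snd, Polynomial.X, fun a => ⟨_, by simp, .snd _⟩⟩

theorem const (d : Data) : Feasible inp fun _ => d := by
  induction d with
  | nil => exact nil
  | node a b ha hb => exact ha.pair hb

theorem reindex {out : α → Data} (h : Feasible inp out) {β : Type} (g : β → α) :
    Feasible (fun b => inp (g b)) fun b => out (g b) := by
  obtain ⟨p, P, hp⟩ := h
  exact ⟨p, P, fun b => hp (g b)⟩

/-- Evaluate `out` in a richer environment `env`, from which `inp` can be computed. -/
theorem lift {out : α → Data} (h : Feasible inp out) {β : Type} {env : β → Data} (g : β → α)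
    (he : Feasible env fun b => inp (g b)) : Feasible env fun b => out (g b) :=
  he.comp (h.reindex g)

theorem cond {c f g : α → Data} (hc : Feasible inp c) (hf : Feasible inp f)
    (hg : Feasible inp g) :
    Feasible inp fun a => match c a with
      | .nil => g a
      | .node _ _ => f a := by
  obtain ⟨p, P, hp⟩ := hc
  obtain ⟨q, Q, hq⟩ := hf
  obtain ⟨r, R, hr⟩ := hg
  refine ⟨.cond p q r, P + Q + R + 1, fun a => ?_⟩
  have h := hp a
  simp only [Polynomial.eval_add, Polynomial.eval_one]
  cases hca : c a with
  | nil =>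
    rw [hca] at h
    exact (h.cond_false (hr a)).mono (by omega)
  | node x y =>
    rw [hca] at h
    exact (h.cond_true (hq a)).mono (by omega)

theorem ite {b : α → Bool} {f g : α → Data} (hb : Feasible inp fun a => .ofBool (b a))
    (hf : Feasible inp f) (hg : Feasible inp g) :
    Feasible inp fun a => if b a then f a else g a :=
  (hb.cond hf hg).congr fun a => by cases b a <;> rfl

/-- Folding a list, if every intermediate state has polynomial size. The step only has to be
computed on the states that occur. -/
theorem foldl {β σ : α → Type} (enc : ∀ a, β a → Data) (encS : ∀ a, σ a → Data)
    (l : ∀ a, List (β a)) (s₀ : ∀ a, σ a) (F : ∀ a, σ a → β a → σ a)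
    (hl : Feasible inp fun a => .ofList (enc a) (l a))
    (h₀ : Feasible inp fun a => encS a (s₀ a))
    (hF : Feasible (α := {q : Σ a, List (β a) × β a // q.2.1 ++ [q.2.2] <+: l q.1})
      (fun q => .node (inp q.1.1)
        (.node (encS _ (q.1.2.1.foldl (F _) (s₀ _))) (enc _ q.1.2.2)))
      (fun q => encS _ (F _ (q.1.2.1.foldl (F _) (s₀ _)) q.1.2.2)))
    (hb : ∃ P : Polynomial ℕ, ∀ a pre, pre <+: l a →
      (encS a (pre.foldl (F a) (s₀ a))).size ≤ P.eval (inp a).size) :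
    Feasible inp fun a => encS a ((l a).foldl (F a) (s₀ a)) := by
  obtain ⟨p, P, hp⟩ := hF
  obtain ⟨pl, Pl, hpl⟩ := hl
  obtain ⟨p0, P0, hp0⟩ := h₀
  obtain ⟨Q, hQ⟩ := hb
  -- the loop state is `(inp, (state, rest of the list))`
  let S : ∀ a, ℕ → Data := fun a i => .node (inp a)
    (.node (encS a (((l a).take i).foldl (F a) (s₀ a))) (.ofList (enc a) ((l a).drop i)))
  let arg : Prog := .pair .fst (.pair (.comp .fst .snd) (.comp .fst (.comp .snd .snd)))
  let body : Prog := .pair .fst (.pair (.comp p arg) (.comp .snd (.comp .snd .snd)))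
  let c : Prog := .comp .snd .snd
  let W : Polynomial ℕ := Polynomial.X + Q + Pl + 2
  let T : Polynomial ℕ := 30 * (W + 1) + P.comp W
  have hdropsz : ∀ a i, (Data.ofList (enc a) ((l a).drop i)).size ≤ Pl.eval (inp a).size := by
    intro a i
    have h1 := Data.size_ofList_append (enc a) ((l a).take i) ((l a).drop i)
    rw [List.take_append_drop] at h1
    have h2 : (Data.ofList (enc a) (l a)).size ≤ _ := (hpl a).size_le
    have := Data.size_pos (Data.ofList (enc a) ((l a).take i))
    omega
  have hSsz : ∀ a i, (S a i).size ≤ W.eval (inp a).size := by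
    intro a i
    have h1 := hQ a ((l a).take i) (List.take_prefix _ _)
    have h2 := hdropsz a i
    simp only [S, W, Data.size_node, Polynomial.eval_add, Polynomial.eval_X,
      Polynomial.eval_ofNat]
    omega
  have hcomp : ∀ {f g : Prog} {x y z : Data} {s t : ℕ}, f.RunsWithin x y s →
      g.RunsWithin y z t → (Prog.comp g f).RunsWithin x z (s + t + 1) := fun h1 h2 => h1.comp h2
  refine ⟨.comp (.comp .fst .snd) (.comp (.loop c body) (.pair .id (.pair p0 pl))),
    Polynomial.X + P0 + Pl + 10 + (Pl + 1) * (2 * T + 1) + 3 * W, fun a => ?_⟩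
  set w := W.eval (inp a).size with hw
  have hT : T.eval (inp a).size = 30 * (w + 1) + P.eval w := by
    simp [T, hw]
  have hstart : (Prog.pair .id (.pair p0 pl)).RunsWithin (inp a) (S a 0)
      ((inp a).size + (P0.eval (inp a).size + Pl.eval (inp a).size + 1) + 1) := by
    have := Prog.RunsWithin.pair ⟨_, le_rfl, .id (inp a)⟩ ((hp0 a).pair (hpl a))
    simpa [S] using this
  have hsnd : ∀ i, Prog.snd.RunsWithin (S a i) (S a i).snd w := fun i =>
    ⟨_, hSsz a i, .snd _⟩
  have hsndsz : ∀ i, (S a i).snd.size ≤ w := fun i => (Data.size_snd_le _).trans (hSsz a i)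
  have hsnd2 : ∀ i, (Prog.comp .snd .snd).RunsWithin (S a i) (S a i).snd.snd (w + w + 1) :=
    fun i => hcomp (hsnd i) ⟨_, hsndsz i, .snd _⟩
  have hsndsz2 : ∀ i, (S a i).snd.snd.size ≤ w := fun i => (Data.size_snd_le _).trans (hsndsz i)
  have hloop : (Prog.loop c body).RunsWithin (S a 0) (S a (l a).length)
      (((l a).length + 1) * (2 * T.eval (inp a).size + 1)) := by
    apply Prog.RunsWithin.loop
    · intro i hi
      have h := hsnd2 i
      have e : (S a i).snd.snd = .node (enc a (l a)[i])
          (.ofList (enc a) ((l a).drop (i + 1))) := by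
        simp only [S, Data.snd_node]
        rw [List.drop_eq_getElem_cons hi]
        rfl
      rw [e] at h
      exact ⟨_, _, h.mono (by omega)⟩
    · intro i hi
      have e : (S a i).snd.snd = .node (enc a (l a)[i])
          (.ofList (enc a) ((l a).drop (i + 1))) := by
        simp only [S, Data.snd_node]
        rw [List.drop_eq_getElem_cons hi]
        rfl
      have hpre : (l a).take i ++ [(l a)[i]] <+: l a := by
        rw [List.take_append_getElem hi]
        exact List.take_prefix _ _
      have hstep := hp ⟨⟨a, (l a).take i, (l a)[i]⟩, hpre⟩
      simp only at hstep
      have hfst : Prog.fst.RunsWithin (S a i) (inp a) w := ⟨_, hSsz a i, .fst _⟩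
      have hel : (Prog.comp .fst (.comp .snd .snd)).RunsWithin (S a i) (enc a (l a)[i])
          (w + w + 1 + w + 1) := by
        refine hcomp (hsnd2 i) ⟨_, hsndsz2 i, ?_⟩
        have h := Prog.Runs.fst (S a i).snd.snd
        rw [e] at h ⊢
        exact h
      have hst : (Prog.comp .fst .snd).RunsWithin (S a i)
          (encS a (((l a).take i).foldl (F a) (s₀ a))) (w + w + 1) :=
        hcomp (hsnd i) ⟨_, hsndsz i, .fst _⟩
      have htl : (Prog.comp .snd (.comp .snd .snd)).RunsWithin (S a i)
          (.ofList (enc a) ((l a).drop (i + 1))) (w + w + 1 + w + 1) := by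
        refine hcomp (hsnd2 i) ⟨_, hsndsz2 i, ?_⟩
        have h := Prog.Runs.snd (S a i).snd.snd
        rw [e] at h ⊢
        exact h
      have harg := hfst.pair (hst.pair hel)
      have hszarg : (Data.node (inp a) (.node (encS a (((l a).take i).foldl (F a) (s₀ a)))
          (enc a (l a)[i]))).size ≤ w := by
        have h := hSsz a i
        have h3 : (S a i).snd.snd.size = (enc a (l a)[i]).size +
          (Data.ofList (enc a) ((l a).drop (i + 1))).size + 1 := by rw [e]; rfl
        simp only [S, Data.snd_node] at h3
        simp only [S, Data.size_node] at h ⊢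
        omega
      have hmono := P.eval_mono_nat hszarg
      have := hfst.pair ((harg.comp hstep).pair htl)
      have e2 : S a (i + 1) = .node (inp a) (.node
          (encS a (F a (((l a).take i).foldl (F a) (s₀ a)) (l a)[i]))
          (.ofList (enc a) ((l a).drop (i + 1)))) := by
        simp only [S]
        rw [← List.take_append_getElem hi, List.foldl_append]
        rfl
      rw [e2]
      exact this.mono (by omega)
    · have h := hsnd2 (l a).length
      have e : (S a (l a).length).snd.snd = .nil := by simp [S]
      rw [e] at h
      exact h.mono (by omega)
    · have := hSsz a (l a).length
      omega
  have hend : (Prog.comp .fst .snd).RunsWithin (S a (l a).length)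
      (encS a ((l a).foldl (F a) (s₀ a))) (w + w + 1) := by
    have := hcomp (hsnd (l a).length) (⟨_, hsndsz _, .fst _⟩ : Prog.fst.RunsWithin _ _ w)
    simpa [S] using this
  refine ((hstart.comp hloop).comp hend).mono ?_
  have hlen : (l a).length ≤ Pl.eval (inp a).size :=
    (Nat.le_of_succ_le (Data.length_le_size_ofList (enc a) (l a))).trans (hpl a).size_le
  have hmul : ((l a).length + 1) * (2 * T.eval (inp a).size + 1) ≤
      (Pl.eval (inp a).size + 1) * (2 * T.eval (inp a).size + 1) := by gcongr
  simp only [Polynomial.eval_add, Polynomial.eval_mul, Polynomial.eval_X, Polynomial.eval_one,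
    Polynomial.eval_ofNat, ← hw]
  omega

end Feasible

/-! ### Lists and unary numbers in polynomial time -/

namespace Data

theorem ofNat_eq_ofList (n : ℕ) : ofNat n = ofList (fun _ : Unit => nil) (List.replicate n ()) := by
  induction n with
  | zero => rfl
  | succ n ih => simp [ofNat, List.replicate_succ, ih]

theorem ofList_nil_eq {β : Type} (l : List β) : ofList (fun _ => nil) l = ofNat l.length := by
  induction l with
  | nil => rfl
  | cons b l ih => simp [ofNat, ih]

theorem snd_ofList {β : Type} (e : β → Data) (l : List β) : (ofList e l).snd = ofList e l.tail := by
  cases l <;> rfl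

theorem snd_ofNat (n : ℕ) : (ofNat n).snd = ofNat (n - 1) := by
  cases n <;> rfl

end Data

namespace Feasible

variable {α : Type} {inp : α → Data}

/-- The context in which the step of an operation on lists is evaluated: the input of the whole
operation and one element of the list. -/
abbrev Member {β : α → Type} (l : ∀ a, List (β a)) : Type := {q : Σ a, β a // q.2 ∈ l q.1}

theorem weaken {β : α → Type} (enc : ∀ a, β a → Data) (l : ∀ a, List (β a)) {t : α → Data}
    (ht : Feasible inp t) :
    Feasible (α := Member l) (fun q => .node (inp q.1.1) (enc _ q.1.2)) fun q => t q.1.1 :=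
  ht.lift (fun q : Member l => q.1.1) self.fst

/-- The context in which the step of a fold is evaluated: the input of the whole operation, the
part of the list that has been processed, and the next element. -/
abbrev Prefix {β : α → Type} (l : ∀ a, List (β a)) : Type :=
  {q : Σ a, List (β a) × β a // q.2.1 ++ [q.2.2] <+: l q.1}

theorem lift_prefix {β : α → Type} {enc : ∀ a, β a → Data} {l : ∀ a, List (β a)}
    {g : ∀ a, β a → Data} (hg : Feasible (α := Member l)
      (fun q => .node (inp q.1.1) (enc _ q.1.2)) fun q => g _ q.1.2)
    (S : ∀ a, List (β a) → Data) :
    Feasible (α := Prefix l)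
      (fun q => .node (inp q.1.1) (.node (S _ q.1.2.1) (enc _ q.1.2.2)))
      fun q => g _ q.1.2.2 :=
  hg.lift (β := Prefix l)
    (env := fun q => .node (inp q.1.1) (.node (S _ q.1.2.1) (enc _ q.1.2.2)))
    (fun q => ⟨⟨q.1.1, q.1.2.2⟩, q.2.subset (by simp)⟩) (self.fst.pair self.snd.snd)

theorem reverse_map {β : α → Type} (enc : ∀ a, β a → Data) (l : ∀ a, List (β a))
    (g : ∀ a, β a → Data) (hl : Feasible inp fun a => .ofList (enc a) (l a))
    (hg : Feasible (α := Member l) (fun q => .node (inp q.1.1) (enc _ q.1.2))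
      fun q => g _ q.1.2) :
    Feasible inp fun a => .ofList (g a) (l a).reverse := by
  have key := foldl (σ := fun a => List (β a)) enc (fun a => Data.ofList (g a)) l (fun _ => [])
    (fun _ acc b => b :: acc) hl nil ?_ ?_
  · exact key.congr fun a => by simp
  · exact (hg.lift_prefix fun a pre =>
      .ofList (g a) (pre.foldl (fun acc b => b :: acc) [])).pair self.snd.fst
  · obtain ⟨P, hP⟩ := hg.size_le
    obtain ⟨Q, hQ⟩ := hl.size_le
    refine ⟨Q * (P.comp (Polynomial.X + Q + 1) + 1) + 1, fun a pre hpre => ?_⟩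
    have h1 : pre.foldl (fun acc b => b :: acc) [] = pre.reverse := by simp
    rw [h1, Data.size_ofList_reverse]
    refine (Data.size_ofList_le (g a) pre (B := P.eval ((inp a).size + Q.eval (inp a).size + 1))
      fun b hb => ?_).trans ?_
    · refine (hP ⟨⟨a, b⟩, hpre.subset hb⟩).trans (P.eval_mono_nat ?_)
      have h2 := Data.size_lt_of_mem (enc a) (hpre.subset hb)
      have h3 : (Data.ofList (enc a) (l a)).size ≤ _ := hQ a
      simp only [Data.size_node]
      omega
    · have h3 : (Data.ofList (enc a) (l a)).size ≤ _ := hQ a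
      have h4 := Data.length_le_size_ofList (enc a) (l a)
      have h5 := hpre.length_le
      simp only [Polynomial.eval_add, Polynomial.eval_mul, Polynomial.eval_comp,
        Polynomial.eval_X, Polynomial.eval_one]
      gcongr
      omega

theorem reverse {β : α → Type} {enc : ∀ a, β a → Data} {l : ∀ a, List (β a)}
    (hl : Feasible inp fun a => .ofList (enc a) (l a)) :
    Feasible inp fun a => .ofList (enc a) (l a).reverse :=
  reverse_map enc l enc hl self.snd

theorem map {β : α → Type} (enc : ∀ a, β a → Data) (l : ∀ a, List (β a))
    (g : ∀ a, β a → Data) (hl : Feasible inp fun a => .ofList (enc a) (l a))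
    (hg : Feasible (α := Member l) (fun q => .node (inp q.1.1) (enc _ q.1.2))
      fun q => g _ q.1.2) :
    Feasible inp fun a => .ofList (g a) (l a) :=
  (reverse (reverse_map enc l g hl hg)).congr fun a => by simp

theorem append {β : α → Type} {enc : ∀ a, β a → Data} {l l' : ∀ a, List (β a)}
    (hl : Feasible inp fun a => .ofList (enc a) (l a))
    (hl' : Feasible inp fun a => .ofList (enc a) (l' a)) :
    Feasible inp fun a => .ofList (enc a) (l a ++ l' a) := by
  have key := foldl (σ := fun a => List (β a)) enc (fun a => Data.ofList (enc a))
    (fun a => (l a).reverse) l' (fun _ acc b => b :: acc) (reverse hl) hl' ?_ ?_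
  · exact key.congr fun a => by simp
  · exact self.snd.snd.pair self.snd.fst
  · obtain ⟨P, hP⟩ := hl.size_le
    obtain ⟨Q, hQ⟩ := hl'.size_le
    refine ⟨P + Q, fun a pre hpre => ?_⟩
    have h1 : pre.foldl (fun acc b => b :: acc) (l' a) = pre.reverse ++ l' a := by simp
    have h2 := Data.size_ofList_append (enc a) pre.reverse (l' a)
    have h3 := Data.size_ofList_prefix (enc a) hpre
    rw [Data.size_ofList_reverse] at h2 h3
    have h4 : (Data.ofList (enc a) (l a)).size ≤ _ := hP a
    have h5 : (Data.ofList (enc a) (l' a)).size ≤ _ := hQ a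
    rw [h1, Polynomial.eval_add]
    omega

theorem flatMap {β γ : α → Type} (enc : ∀ a, β a → Data) (l : ∀ a, List (β a))
    (enc' : ∀ a, γ a → Data) (g : ∀ a, β a → List (γ a))
    (hl : Feasible inp fun a => .ofList (enc a) (l a))
    (hg : Feasible (α := Member l) (fun q => .node (inp q.1.1) (enc _ q.1.2))
      fun q => .ofList (enc' _) (g _ q.1.2)) :
    Feasible inp fun a => .ofList (enc' a) ((l a).flatMap (g a)) := by
  have hfold : ∀ a (pre : List (β a)) (acc : List (γ a)),
      pre.foldl (fun acc b => acc ++ g a b) acc = acc ++ pre.flatMap (g a) := by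
    intro a pre
    induction pre with
    | nil => simp
    | cons b pre ih => intro acc; simp [ih]
  have key := foldl (σ := fun a => List (γ a)) enc (fun a => Data.ofList (enc' a)) l (fun _ => [])
    (fun a acc b => acc ++ g a b) hl nil ?_ ?_
  · exact key.congr fun a => by rw [hfold]; simp
  · exact append self.snd.fst
      (hg.lift_prefix (g := fun a b => .ofList (enc' a) (g a b)) fun a pre =>
        .ofList (enc' a) (pre.foldl (fun acc b => acc ++ g a b) []))
  · obtain ⟨P, hP⟩ := hg.size_le
    obtain ⟨Q, hQ⟩ := hl.size_le
    refine ⟨Q * P.comp (Polynomial.X + Q + 1) + 1, fun a pre hpre => ?_⟩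
    rw [hfold, List.nil_append]
    have h3 : (Data.ofList (enc a) (l a)).size ≤ _ := hQ a
    set B := P.eval ((inp a).size + Q.eval (inp a).size + 1) with hB
    have hle : ∀ pre : List (β a), (∀ b ∈ pre, b ∈ l a) →
        (Data.ofList (enc' a) (pre.flatMap (g a))).size ≤ pre.length * B + 1 := by
      intro pre
      induction pre with
      | nil => simp
      | cons b pre ih =>
        intro hb
        have h1 := ih fun c hc => hb c (List.mem_cons_of_mem _ hc)
        have h2 : (Data.ofList (enc' a) (g a b)).size ≤ B := by
          refine (hP ⟨⟨a, b⟩, hb b List.mem_cons_self⟩).trans (P.eval_mono_nat ?_)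
          have := Data.size_lt_of_mem (enc a) (hb b List.mem_cons_self)
          simp only [Data.size_node]
          omega
        have h4 := Data.size_ofList_append (enc' a) (g a b) (pre.flatMap (g a))
        simp only [List.flatMap_cons, List.length_cons, Nat.add_mul, one_mul]
        omega
    refine (hle pre fun b hb => hpre.subset hb).trans ?_
    have h4 := Data.length_le_size_ofList (enc a) (l a)
    have h5 := hpre.length_le
    simp only [Polynomial.eval_add, Polynomial.eval_mul, Polynomial.eval_comp,
      Polynomial.eval_X, Polynomial.eval_one, ← hB]
    gcongr
    omega

/-- The first element with a given property. -/
theorem find {β : α → Type} (enc : ∀ a, β a → Data) (l : ∀ a, List (β a))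
    (t : ∀ a, β a → Bool) (hl : Feasible inp fun a => .ofList (enc a) (l a))
    (ht : Feasible (α := Member l) (fun q => .node (inp q.1.1) (enc _ q.1.2))
      fun q => .ofBool (t _ q.1.2)) :
    Feasible inp fun a => .ofList (enc a) ((l a).find? (t a)).toList := by
  have hfold : ∀ a (pre : List (β a)) (s : Option (β a)),
      pre.foldl (fun s b => s.or (if t a b then some b else none)) s
        = s.or (pre.find? (t a)) := by
    intro a pre
    induction pre with
    | nil => simp
    | cons b pre ih =>
      intro s
      rw [List.foldl_cons, ih, List.find?_cons]
      cases s <;> cases t a b <;> simp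
  have key := foldl (σ := fun a => Option (β a)) enc (fun a s => .ofList (enc a) s.toList) l
    (fun _ => none) (fun a s b => s.or (if t a b then some b else none)) hl nil ?_ ?_
  · exact key.congr fun a => by rw [hfold]; simp
  · have ht' := ht.lift_prefix (g := fun a b => .ofBool (t a b)) fun a pre =>
      .ofList (enc a) (pre.foldl (fun s b => s.or (if t a b then some b else none)) none).toList
    refine (cond self.snd.fst self.snd.fst
      (ite ht' (pair self.snd.snd nil) nil)).congr fun q => ?_
    dsimp only [Data.snd_node, Data.fst_node]
    cases q.1.2.1.foldl (fun s b => s.or (if t q.1.1 b then some b else none)) none with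
    | none => cases t q.1.1 q.1.2.2 <;> rfl
    | some b => rfl
  · obtain ⟨Q, hQ⟩ := hl.size_le
    refine ⟨Q + 2, fun a pre hpre => ?_⟩
    have h3 : (Data.ofList (enc a) (l a)).size ≤ _ := hQ a
    rw [hfold, Option.none_or]
    simp only [Polynomial.eval_add, Polynomial.eval_ofNat]
    cases h : pre.find? (t a) with
    | none => simp
    | some b =>
      have := Data.size_lt_of_mem (enc a) (hpre.subset (List.mem_of_find?_eq_some h))
      simp
      omega

theorem iterate {σ : α → Type} (encS : ∀ a, σ a → Data) (k : α → ℕ) (s₀ : ∀ a, σ a)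
    (F : ∀ a, σ a → σ a) (hk : Feasible inp fun a => .ofNat (k a))
    (h₀ : Feasible inp fun a => encS a (s₀ a))
    (hF : Feasible (α := {q : α × ℕ // q.2 < k q.1})
      (fun q => .node (inp q.1.1) (encS _ ((F q.1.1)^[q.1.2] (s₀ _))))
      (fun q => encS _ (F _ ((F q.1.1)^[q.1.2] (s₀ _)))))
    (hb : ∃ P : Polynomial ℕ, ∀ a i, i ≤ k a →
      (encS a ((F a)^[i] (s₀ a))).size ≤ P.eval (inp a).size) :
    Feasible inp fun a => encS a ((F a)^[k a] (s₀ a)) := by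
  have hfold : ∀ a (pre : List Unit) (s : σ a),
      pre.foldl (fun s _ => F a s) s = (F a)^[pre.length] s := by
    intro a pre
    induction pre with
    | nil => simp
    | cons b pre ih => intro s; simp [ih]
  have key := foldl (β := fun _ => Unit) (fun _ _ => .nil) encS
    (fun a => List.replicate (k a) ()) s₀ (fun a s _ => F a s)
    (hk.congr fun a => Data.ofNat_eq_ofList _) h₀ ?_ ?_
  · exact key.congr fun a => by rw [hfold]; simp
  · have := hF.lift
      (β := {q : Σ _ : α, List Unit × Unit // q.2.1 ++ [q.2.2] <+: List.replicate (k q.1) ()})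
      (env := fun q => .node (inp q.1.1)
        (.node (encS _ (q.1.2.1.foldl (fun s _ => F q.1.1 s) (s₀ _))) .nil))
      (fun q => ⟨⟨q.1.1, q.1.2.1.length⟩, by
        have := q.2.length_le
        simp at this
        simpa using this⟩) ((self.fst.pair self.snd.fst).congr fun q => by
          simp only [hfold]; rfl)
    exact this.congr fun q => by simp only [hfold]
  · obtain ⟨P, hP⟩ := hb
    refine ⟨P, fun a pre hpre => ?_⟩
    rw [hfold]
    exact hP a _ (by simpa using hpre.length_le)

theorem drop {β : α → Type} {enc : ∀ a, β a → Data} {l : ∀ a, List (β a)} {i : α → ℕ}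
    (hl : Feasible inp fun a => .ofList (enc a) (l a)) (hi : Feasible inp fun a => .ofNat (i a)) :
    Feasible inp fun a => .ofList (enc a) ((l a).drop (i a)) := by
  have hit : ∀ a j, List.tail^[j] (l a) = (l a).drop j := by
    intro a j
    induction j with
    | zero => rfl
    | succ j ih => rw [Function.iterate_succ_apply', ih, List.tail_drop]
  refine (iterate (σ := fun a => List (β a)) (fun a => Data.ofList (enc a)) i l
    (fun _ => List.tail) hi hl ?_ ?_).congr fun a => by rw [hit]
  · exact self.snd.snd.congr fun q => Data.snd_ofList _ _
  · obtain ⟨Q, hQ⟩ := hl.size_le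
    refine ⟨Q, fun a j _ => ?_⟩
    have h1 := Data.size_ofList_append (enc a) ((l a).take j) ((l a).drop j)
    have h2 := Data.size_pos (Data.ofList (enc a) ((l a).take j))
    have h3 : (Data.ofList (enc a) (l a)).size ≤ _ := hQ a
    rw [List.take_append_drop] at h1
    rw [hit]
    omega

theorem getD {β : α → Type} {enc : ∀ a, β a → Data} {l : ∀ a, List (β a)} {i : α → ℕ}
    {d : ∀ a, β a} (hl : Feasible inp fun a => .ofList (enc a) (l a))
    (hi : Feasible inp fun a => .ofNat (i a)) (hd : Feasible inp fun a => enc a (d a)) :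
    Feasible inp fun a => enc a ((l a).getD (i a) (d a)) := by
  refine (cond (drop hl hi) (drop hl hi).fst hd).congr fun a => ?_
  rcases lt_or_ge (i a) (l a).length with h | h
  · rw [List.drop_eq_getElem_cons h, List.getD_eq_getElem _ _ h]
    rfl
  · rw [List.drop_eq_nil_of_le h, List.getD_eq_default _ _ h]
    rfl

theorem length {β : α → Type} {enc : ∀ a, β a → Data} {l : ∀ a, List (β a)}
    (hl : Feasible inp fun a => .ofList (enc a) (l a)) :
    Feasible inp fun a => .ofNat (l a).length :=
  (map enc l (fun _ _ => .nil) hl nil).congr fun _ => Data.ofList_nil_eq _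

theorem not {b : α → Bool} (hb : Feasible inp fun a => .ofBool (b a)) :
    Feasible inp fun a => .ofBool (!b a) :=
  (ite hb (const (.ofBool false)) (const (.ofBool true))).congr fun a => by cases b a <;> rfl

theorem and {b c : α → Bool} (hb : Feasible inp fun a => .ofBool (b a))
    (hc : Feasible inp fun a => .ofBool (c a)) : Feasible inp fun a => .ofBool (b a && c a) :=
  (ite hb hc (const (.ofBool false))).congr fun a => by cases b a <;> rfl

theorem add {f g : α → ℕ} (hf : Feasible inp fun a => .ofNat (f a))
    (hg : Feasible inp fun a => .ofNat (g a)) : Feasible inp fun a => .ofNat (f a + g a) :=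
  (append (β := fun _ => Unit) (hf.congr fun a => Data.ofNat_eq_ofList _)
    (hg.congr fun a => Data.ofNat_eq_ofList _)).congr fun a => by
      rw [Data.ofList_nil_eq]; simp

theorem mul {f g : α → ℕ} (hf : Feasible inp fun a => .ofNat (f a))
    (hg : Feasible inp fun a => .ofNat (g a)) : Feasible inp fun a => .ofNat (f a * g a) := by
  refine (flatMap (β := fun _ => Unit) (γ := fun _ => Unit) (fun _ _ => .nil)
    (fun a => List.replicate (f a) ()) (fun _ _ => .nil)
    (fun a (_ : Unit) => List.replicate (g a) ())
    (hf.congr fun a => Data.ofNat_eq_ofList _)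
    ((hg.lift (fun q : Member _ => q.1.1) self.fst).congr fun a => Data.ofNat_eq_ofList _)).congr
      fun a => ?_
  rw [Data.ofList_nil_eq]
  simp

theorem nat (n : ℕ) : Feasible inp fun _ => .ofNat n := const _

theorem pow {f : α → ℕ} (hf : Feasible inp fun a => .ofNat (f a)) (c : ℕ) :
    Feasible inp fun a => .ofNat (f a ^ c) := by
  induction c with
  | zero => simpa using nat 1
  | succ c ih => simpa only [pow_succ] using ih.mul hf

theorem pred {f : α → ℕ} (hf : Feasible inp fun a => .ofNat (f a)) :
    Feasible inp fun a => .ofNat (f a - 1) :=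
  hf.snd.congr fun _ => Data.snd_ofNat _

theorem sub {f g : α → ℕ} (hf : Feasible inp fun a => .ofNat (f a))
    (hg : Feasible inp fun a => .ofNat (g a)) : Feasible inp fun a => .ofNat (f a - g a) := by
  refine (length (drop (hf.congr fun a => Data.ofNat_eq_ofList _) hg)).congr fun a => ?_
  simp

theorem lt {f g : α → ℕ} (hf : Feasible inp fun a => .ofNat (f a))
    (hg : Feasible inp fun a => .ofNat (g a)) :
    Feasible inp fun a => .ofBool (decide (f a < g a)) := by
  refine (cond (hg.sub hf) (const (.ofBool true)) (const (.ofBool false))).congr fun a => ?_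
  rcases lt_or_ge (f a) (g a) with h | h
  · obtain ⟨d, hd⟩ : ∃ d, g a - f a = d + 1 := ⟨g a - f a - 1, by omega⟩
    simp [hd, h, Data.ofNat]
  · have hd : g a - f a = 0 := by omega
    simp [hd, Data.ofNat, Nat.not_lt.2 h]

theorem eq {f g : α → ℕ} (hf : Feasible inp fun a => .ofNat (f a))
    (hg : Feasible inp fun a => .ofNat (g a)) :
    Feasible inp fun a => .ofBool (decide (f a = g a)) :=
  ((hf.lt hg).not.and (hg.lt hf).not).congr fun a => by
    congr 1
    rw [Bool.eq_iff_iff]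
    simp
    omega

/-- Quotient and remainder, by counting up. -/
theorem divMod {f g : α → ℕ} (hf : Feasible inp fun a => .ofNat (f a))
    (hg : Feasible inp fun a => .ofNat (g a)) :
    Feasible inp fun a => .node (.ofNat (f a / g a)) (.ofNat (f a % g a)) := by
  let F : ℕ → ℕ × ℕ → ℕ × ℕ := fun d s =>
    if decide (s.2 + 1 = d) then (s.1 + 1, 0) else (s.1, s.2 + 1)
  have hit : ∀ d j, (F d)^[j] (0, 0) = (j / d, j % d) := by
    intro d j
    induction j with
    | zero => simp
    | succ j ih =>
      rw [Function.iterate_succ_apply', ih]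
      rcases Nat.eq_zero_or_pos d with rfl | hd
      · simp [F]
      · have h1 := Nat.div_add_mod j d
        have h2 := Nat.mod_lt j hd
        simp only [F]
        by_cases h : j % d + 1 = d
        · have h3 : j + 1 = d * (j / d + 1) := by rw [Nat.mul_add]; omega
          simp only [h, decide_true, if_true]
          rw [h3, Nat.mul_div_cancel_left _ hd, Nat.mul_mod_right]
        · have h3 : j + 1 = (j % d + 1) + d * (j / d) := by omega
          simp only [h, decide_false]
          have h4 : j % d + 1 < d := by omega
          rw [h3, Nat.add_mul_div_left _ _ hd, Nat.add_mul_mod_self_left,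
            Nat.mod_eq_of_lt h4, Nat.div_eq_of_lt h4]
          simp
  refine (iterate (σ := fun _ => ℕ × ℕ) (fun _ s => .node (.ofNat s.1) (.ofNat s.2)) f
    (fun _ => (0, 0)) (fun a => F (g a)) hf (const (.node (.ofNat 0) (.ofNat 0))) ?_ ?_).congr
      fun a => by rw [hit]
  · have hd : Feasible (α := {q : α × ℕ // q.2 < f q.1})
        (fun q => .node (inp q.1.1) (.node (.ofNat ((F (g q.1.1))^[q.1.2] (0, 0)).1)
          (.ofNat ((F (g q.1.1))^[q.1.2] (0, 0)).2))) (fun q => .ofNat (g q.1.1)) :=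
      hg.lift (fun q : {q : α × ℕ // q.2 < f q.1} => q.1.1) self.fst
    refine (ite (eq (add self.snd.snd (nat 1)) hd) (pair (add self.snd.fst (nat 1)) (nat 0))
      (pair self.snd.fst (add self.snd.snd (nat 1)))).congr fun q => ?_
    simp only [F]
    split_ifs <;> rfl
  · obtain ⟨Q, hQ⟩ := hf.size_le
    refine ⟨2 * Q + 1, fun a j hj => ?_⟩
    have h1 : (Data.ofNat (f a)).size ≤ _ := hQ a
    have h2 : j / g a ≤ j := Nat.div_le_self _ _
    have h3 : j % g a ≤ j := Nat.mod_le _ _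
    simp only [hit, Data.size_node, Data.size_ofNat, Polynomial.eval_add, Polynomial.eval_mul,
      Polynomial.eval_ofNat, Polynomial.eval_one] at h1 ⊢
    omega

theorem div {f g : α → ℕ} (hf : Feasible inp fun a => .ofNat (f a))
    (hg : Feasible inp fun a => .ofNat (g a)) : Feasible inp fun a => .ofNat (f a / g a) :=
  (hf.divMod hg).fst

theorem mod {f g : α → ℕ} (hf : Feasible inp fun a => .ofNat (f a))
    (hg : Feasible inp fun a => .ofNat (g a)) : Feasible inp fun a => .ofNat (f a % g a) :=
  (hf.divMod hg).snd

theorem range {f : α → ℕ} (hf : Feasible inp fun a => .ofNat (f a)) :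
    Feasible inp fun a => .ofList Data.ofNat (List.range (f a)) := by
  let F : ℕ × List ℕ → ℕ × List ℕ := fun s => (s.1 + 1, s.1 :: s.2)
  have hit : ∀ j, F^[j] (0, []) = (j, (List.range j).reverse) := by
    intro j
    induction j with
    | zero => rfl
    | succ j ih => rw [Function.iterate_succ_apply', ih]; simp [F, List.range_succ]
  have := iterate (σ := fun _ => ℕ × List ℕ)
    (fun _ s => .node (.ofNat s.1) (.ofList Data.ofNat s.2)) f (fun _ => (0, [])) (fun _ => F)
    hf (const (.node (.ofNat 0) .nil)) ?_ ?_
  · refine (reverse (β := fun _ => ℕ) (enc := fun _ => Data.ofNat)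
      (l := fun a => (F^[f a] (0, [])).2) this.snd).congr fun a => ?_
    rw [hit]
    simp
  · exact pair (add self.snd.fst (nat 1)) (pair self.snd.fst self.snd.snd)
  · obtain ⟨Q, hQ⟩ := hf.size_le
    refine ⟨Q + Q * (Q + 1) + 2, fun a j hj => ?_⟩
    have h1 : (Data.ofNat (f a)).size ≤ _ := hQ a
    have h2 := Data.size_ofList_le Data.ofNat (List.range j) (B := 2 * j + 1) fun i hi => by
      have := List.mem_range.1 hi
      simp
      omega
    have h3 : j * (2 * j + 1 + 1) ≤ Q.eval (inp a).size * (Q.eval (inp a).size + 1) := by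
      simp only [Data.size_ofNat] at h1
      gcongr <;> omega
    simp only [Data.size_ofNat] at h1
    simp only [hit, Data.size_node, Data.size_ofNat, Polynomial.eval_add, Polynomial.eval_mul,
      Polynomial.eval_ofNat, Polynomial.eval_one, Data.size_ofList_reverse]
    simp only [List.length_range] at h2
    omega

end Feasible

/-! ### Composition of arithmetic circuits -/

namespace Gate

variable {n N : ℕ} {R : Type} [CommRing R]

/-- The values of a list of nodes at the point `x`. -/
def run (x : Fin n → R) (G : List (Gate n)) : List R :=
  G.foldl (fun vals g => vals ++ [g.value x vals]) []

theorem run_concat (x : Fin n → R) (G : List (Gate n)) (g : Gate n) :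
    run x (G ++ [g]) = run x G ++ [g.value x (run x G)] := by
  simp [run]

@[simp] theorem length_run (x : Fin n → R) (G : List (Gate n)) :
    (run x G).length = G.length := by
  induction G using List.reverseRecOn with
  | nil => rfl
  | append_singleton G g ih => rw [run_concat]; simp [ih]

theorem run_append_getD (x : Fin n → R) (G G' : List (Gate n)) {p : ℕ} (hp : p < G.length) :
    (run x (G ++ G')).getD p 0 = (run x G).getD p 0 := by
  induction G' using List.reverseRecOn with
  | nil => simp
  | append_singleton G' g ih =>
    rw [← List.append_assoc, run_concat, List.getD_append _ _ _ _ (by simp; omega), ih]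

theorem value_congr (x : Fin n → R) {p : ℕ} {vals vals' : List R} {g : Gate n} (hg : g.Below p)
    (h : ∀ i < p, vals.getD i 0 = vals'.getD i 0) : g.value x vals = g.value x vals' := by
  cases g with
  | var i => rfl
  | const z => rfl
  | add a b => simp only [value]; rw [h a hg.1, h b hg.2]
  | mul a b => simp only [value]; rw [h a hg.1, h b hg.2]

theorem Below.mono {p q : ℕ} {g : Gate n} (h : g.Below p) (hpq : p ≤ q) : g.Below q := by
  cases g with
  | var i => trivial
  | const z => trivial
  | add a b => exact ⟨h.1.trans_le hpq, h.2.trans_le hpq⟩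
  | mul a b => exact ⟨h.1.trans_le hpq, h.2.trans_le hpq⟩

/-- A node of a circuit that is copied to a place `k` positions later, where the variables are
replaced by the nodes `σ`. -/
def inline (k : ℕ) (σ : Fin n → Gate N) : Gate n → Gate N
  | var i => σ i
  | const z => const z
  | add a b => add (k + a) (k + b)
  | mul a b => mul (k + a) (k + b)

/-- Every node refers to earlier nodes only. -/
def WF (G : List (Gate n)) : Prop := ∀ (p : ℕ) (h : p < G.length), G[p].Below p

theorem WF.concat {G : List (Gate n)} (h : WF G) {g : Gate n} (hg : g.Below G.length) :
    WF (G ++ [g]) := by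
  intro p hp
  rcases lt_or_ge p G.length with h1 | h1
  · rw [List.getElem_append_left h1]; exact h p h1
  · have h2 : p = G.length := by simp at hp; omega
    subst h2
    simpa using hg

theorem WF.of_concat {G : List (Gate n)} {g : Gate n} (h : WF (G ++ [g])) :
    WF G ∧ g.Below G.length := by
  constructor
  · intro p hp
    have := h p (by simp; omega)
    rwa [List.getElem_append_left hp] at this
  · simpa using h G.length (by simp)

theorem WF.inline {G : List (Gate N)} (h : WF G) {σ : Fin n → Gate N}
    (hσ : ∀ i, (σ i).Below G.length) {L : List (Gate n)} (hL : WF L) :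
    WF (G ++ L.map (inline G.length σ)) := by
  induction L using List.reverseRecOn with
  | nil => simpa using h
  | append_singleton L g ih =>
    obtain ⟨h1, h2⟩ := hL.of_concat
    rw [List.map_append, ← List.append_assoc]
    refine (ih h1).concat ?_
    simp only [List.length_append, List.length_map]
    cases g with
    | var i => exact (hσ i).mono (by omega)
    | const z => trivial
    | add a b => exact ⟨by have := h2.1; omega, by have := h2.2; omega⟩
    | mul a b => exact ⟨by have := h2.1; omega, by have := h2.2; omega⟩

/-- Copying a circuit behind other nodes, with the variables replaced by nodes of known values,
substitutes these values for the variables. -/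
theorem run_inline (x : Fin N → R) (y : Fin n → R) {G : List (Gate N)} {σ : Fin n → Gate N}
    (hσ : ∀ i, (σ i).Below G.length) (hy : ∀ i, (σ i).value x (run x G) = y i)
    {L : List (Gate n)} (hL : WF L) :
    run x (G ++ L.map (inline G.length σ)) = run x G ++ run y L := by
  induction L using List.reverseRecOn with
  | nil => simp [run]
  | append_singleton L g ih =>
    obtain ⟨h1, h2⟩ := hL.of_concat
    rw [List.map_append, ← List.append_assoc, List.map_singleton, run_concat, ih h1, run_concat,
      ← List.append_assoc]
    congr 2
    have hget : ∀ a, (run x G ++ run y L).getD (G.length + a) 0 = (run y L).getD a 0 := by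
      intro a
      rw [List.getD_append_right _ _ _ _ (by simp)]
      simp
    cases g with
    | var i =>
      refine (value_congr x (hσ i) fun p hp => ?_).trans (hy i)
      rw [List.getD_append _ _ _ _ (by simpa using hp)]
    | const z => rfl
    | add a b => simp only [inline, value, hget]
    | mul a b => simp only [inline, value, hget]

theorem run_map {S : Type} [CommRing S] (φ : R →+* S) (x : Fin n → R) (G : List (Gate n)) :
    run (fun i => φ (x i)) G = (run x G).map φ := by
  induction G using List.reverseRecOn with
  | nil => rfl
  | append_singleton G g ih =>
    rw [run_concat, run_concat, ih, List.map_append, List.map_singleton]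
    congr 2
    have hget : ∀ a, ((run x G).map φ).getD a 0 = φ ((run x G).getD a 0) := by
      intro a
      rw [← map_zero φ, List.getD_map]
    cases g with
    | var i => rfl
    | const z => simp [value]
    | add a b => simp only [value, hget, map_add]
    | mul a b => simp only [value, hget, map_mul]

theorem bitSize_pos (g : Gate n) : 1 ≤ g.bitSize := by
  cases g <;> simp [bitSize]

end Gate

namespace Circuit

variable {n N : ℕ} {R : Type} [CommRing R]

theorem eval_eq (C : Circuit n) (x : Fin n → R) : C.eval x = (Gate.run x C.gates).getLastD 0 :=
  rfl

theorem eval_map {S : Type} [CommRing S] (φ : R →+* S) (C : Circuit n) (x : Fin n → R) :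
    C.eval (fun i => φ (x i)) = φ (C.eval x) := by
  rw [eval_eq, eval_eq, Gate.run_map]
  rcases List.eq_nil_or_concat (Gate.run x C.gates) with h | ⟨l, a, h⟩ <;> simp [h]

@[simp] theorem eval_poly (C : Circuit n) (x : Fin n → ℤ) :
    MvPolynomial.eval x C.poly = C.eval x := by
  rw [poly, ← eval_map]
  simp

theorem length_le_bitSize (C : Circuit n) : C.gates.length ≤ C.bitSize := by
  have : ∀ G : List (Gate n), G.length ≤ (G.map Gate.bitSize).sum := by
    intro G
    induction G with
    | nil => simp
    | cons g G ih => have := g.bitSize_pos; simp; omega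
  exact this _

end Circuit

/-! ### Straight-line programs with calls -/

/-- Instructions of a stack program over a commutative ring. The instruction `call` takes as many
values from the stack as a given polynomial map has variables, the first one from the top, and
pushes the value of that map. -/
inductive Instr : Type
  | inp : ℕ → Instr
  | one : Instr
  | negOne : Instr
  | add : Instr
  | mul : Instr
  | dup : Instr
  | call : Instr

namespace Instr

variable {n N : ℕ} {R : Type} [CommRing R]

/-- The effect of an instruction on the stack, where `f` is the map that is called and `y` lists
the inputs. -/
def step (f : (Fin n → R) → R) (y : ℕ → R) (st : List R) : Instr → List R
  | inp i => y i :: st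
  | one => 1 :: st
  | negOne => -1 :: st
  | add => (st.getD 1 0 + st.getD 0 0) :: st.drop 2
  | mul => (st.getD 1 0 * st.getD 0 0) :: st.drop 2
  | dup => st.getD 0 0 :: st
  | call => f (fun i => st.getD i 0) :: st.drop n

/-- The stack after the instructions `t`, started with the stack `st`. -/
def exec (f : (Fin n → R) → R) (y : ℕ → R) (t : List Instr) (st : List R) : List R :=
  t.foldl (step f y) st

@[simp] theorem exec_nil (f : (Fin n → R) → R) (y : ℕ → R) (st : List R) :
    exec f y [] st = st := rfl

@[simp] theorem exec_cons (f : (Fin n → R) → R) (y : ℕ → R) (i : Instr) (t : List Instr)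
    (st : List R) : exec f y (i :: t) st = exec f y t (step f y st i) := rfl

@[simp] theorem exec_append (f : (Fin n → R) → R) (y : ℕ → R) (t t' : List Instr)
    (st : List R) : exec f y (t ++ t') st = exec f y t' (exec f y t st) := by
  simp [exec]

/-- The result of a stack program. -/
def result (f : (Fin n → R) → R) (y : ℕ → R) (t : List Instr) : R := (exec f y t []).getD 0 0

theorem exec_map {S : Type} [CommRing S] (φ : R →+* S) {f : (Fin n → R) → R}
    {f' : (Fin n → S) → S} (hf : ∀ x, f' (fun i => φ (x i)) = φ (f x)) (y : ℕ → R)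
    (t : List Instr) (st : List R) :
    exec f' (fun i => φ (y i)) t (st.map φ) = (exec f y t st).map φ := by
  induction t generalizing st with
  | nil => rfl
  | cons i t ih =>
    rw [exec_cons, exec_cons, ← ih]
    congr 1
    have hget : ∀ a, (st.map φ).getD a 0 = φ (st.getD a 0) := by
      intro a
      rw [← map_zero φ, List.getD_map]
    cases i with
    | inp i => rfl
    | one => simp [step]
    | negOne => simp [step]
    | add => simp only [step, hget, List.map_cons, map_add, List.map_drop]
    | mul => simp only [step, hget, List.map_cons, map_mul, List.map_drop]
    | dup => simp only [step, hget, List.map_cons]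
    | call => simp only [step, hget, List.map_cons, hf, List.map_drop]

theorem result_map {S : Type} [CommRing S] (φ : R →+* S) {f : (Fin n → R) → R}
    {f' : (Fin n → S) → S} (hf : ∀ x, f' (fun i => φ (x i)) = φ (f x)) (y : ℕ → R)
    (t : List Instr) : result f' (fun i => φ (y i)) t = φ (result f y t) := by
  have := exec_map φ hf y t []
  rw [List.map_nil] at this
  rw [result, result, this, ← map_zero φ, List.getD_map]

/-- The translation of an instruction into nodes of a circuit. A state consists of the nodes that
have been written and of the positions of the nodes that hold the values on the stack; node `0` is
the constant `0`, which also stands for missing values. -/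
def compileStep (C : Circuit n) (σ : ℕ → Gate N) (s : List (Gate N) × List ℕ) :
    Instr → List (Gate N) × List ℕ
  | inp i => (s.1 ++ [σ i], s.1.length :: s.2)
  | one => (s.1 ++ [.const 1], s.1.length :: s.2)
  | negOne => (s.1 ++ [.const (-1)], s.1.length :: s.2)
  | add => (s.1 ++ [.add (s.2.getD 1 0) (s.2.getD 0 0)], s.1.length :: s.2.drop 2)
  | mul => (s.1 ++ [.mul (s.2.getD 1 0) (s.2.getD 0 0)], s.1.length :: s.2.drop 2)
  | dup => (s.1, s.2.getD 0 0 :: s.2)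
  | call => ((s.1 ++ [.const 0]) ++
      C.gates.map (Gate.inline (s.1.length + 1) fun i => .add (s.2.getD i 0) 0),
      (s.1.length + C.gates.length) :: s.2.drop n)

/-- The nodes of `s` extend `G₀` to a circuit, and its positions hold the values on the stack `st`
at the point `x`. -/
structure Holds (x : Fin N → R) (G₀ : List (Gate N)) (s : List (Gate N) × List ℕ)
    (st : List R) : Prop where
  pre : G₀ <+: s.1
  pos : 0 < s.1.length
  zero : (Gate.run x s.1).getD 0 0 = 0
  wf : Gate.WF s.1
  lt : ∀ p ∈ s.2, p < s.1.length
  stack : s.2.map (fun p => (Gate.run x s.1).getD p 0) = st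

namespace Holds

variable {x : Fin N → R} {G₀ : List (Gate N)} {s : List (Gate N) × List ℕ} {st : List R}

theorem getD_lt (h : Holds x G₀ s st) (i : ℕ) : s.2.getD i 0 < s.1.length := by
  rcases lt_or_ge i s.2.length with hi | hi
  · rw [List.getD_eq_getElem _ _ hi]; exact h.lt _ (List.getElem_mem _)
  · rw [List.getD_eq_default _ _ hi]; exact h.pos

theorem getD_eq (h : Holds x G₀ s st) (i : ℕ) :
    (Gate.run x s.1).getD (s.2.getD i 0) 0 = st.getD i 0 := by
  have : (s.2.map fun p => (Gate.run x s.1).getD p 0).getD i ((Gate.run x s.1).getD 0 0)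
      = (Gate.run x s.1).getD (s.2.getD i 0) 0 :=
    List.getD_map _ _ fun p => (Gate.run x s.1).getD p 0
  rw [← this, h.zero, h.stack]

/-- Writing more nodes, the last of which holds a new top of the stack. -/
theorem push (h : Holds x G₀ s st) (G' : List (Gate N)) (hG' : G' ≠ [])
    (hwf : Gate.WF (s.1 ++ G')) (k : ℕ) {v : R}
    (hv : (Gate.run x (s.1 ++ G')).getD (s.1.length + G'.length - 1) 0 = v) :
    Holds x G₀ (s.1 ++ G', (s.1.length + G'.length - 1) :: s.2.drop k) (v :: st.drop k) := by
  have hl : 0 < G'.length := List.length_pos_iff.2 hG'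
  refine ⟨h.pre.trans (List.prefix_append _ _), ?_, ?_, hwf, ?_, ?_⟩
  · have := h.pos
    simp only [List.length_append]; omega
  · rw [Gate.run_append_getD _ _ _ h.pos, h.zero]
  · intro p hp
    simp only [List.length_append]
    rcases List.mem_cons.1 hp with rfl | hp
    · omega
    · have := h.lt p (List.mem_of_mem_drop hp)
      omega
  · rw [List.map_cons, hv, ← h.stack, ← List.map_drop]
    congr 1
    refine List.map_congr_left fun p hp => ?_
    rw [Gate.run_append_getD _ _ _ (h.lt p (List.mem_of_mem_drop hp))]

theorem pushGate (h : Holds x G₀ s st) {g : Gate N} (hg : g.Below s.1.length) (k : ℕ) :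
    Holds x G₀ (s.1 ++ [g], s.1.length :: s.2.drop k)
      (g.value x (Gate.run x s.1) :: st.drop k) := by
  refine h.push [g] (by simp) (h.wf.concat hg) k ?_
  rw [Gate.run_concat]
  simp

end Holds

theorem holds_compileStep {x : Fin N → R} {G₀ : List (Gate N)} {C : Circuit n}
    {σ : ℕ → Gate N} {y : ℕ → R} (hσ : ∀ i, (σ i).Below G₀.length)
    (hy : ∀ i, (σ i).value x (Gate.run x G₀) = y i) {s : List (Gate N) × List ℕ} {st : List R}
    (h : Holds x G₀ s st) (t : Instr) :
    Holds x G₀ (compileStep C σ s t) (step C.eval y st t) := by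
  cases t with
  | inp i =>
    have hv : (σ i).value x (Gate.run x s.1) = y i := by
      obtain ⟨G', hG'⟩ := h.pre
      rw [← hy i]
      refine Gate.value_congr x (hσ i) fun p hp => ?_
      rw [← hG', Gate.run_append_getD _ _ _ hp]
    have := h.pushGate ((hσ i).mono h.pre.length_le) 0
    rw [hv] at this
    exact this
  | one =>
    have := h.pushGate (g := .const 1) trivial 0
    rwa [show (Gate.const 1).value x (Gate.run x s.1) = (1 : R) by simp [Gate.value]] at this
  | negOne =>
    have := h.pushGate (g := .const (-1)) trivial 0
    rwa [show (Gate.const (-1)).value x (Gate.run x s.1) = (-1 : R) by simp [Gate.value]] at this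
  | add =>
    have := h.pushGate (g := .add (s.2.getD 1 0) (s.2.getD 0 0))
      ⟨h.getD_lt 1, h.getD_lt 0⟩ 2
    simp only [Gate.value, h.getD_eq] at this
    exact this
  | mul =>
    have := h.pushGate (g := .mul (s.2.getD 1 0) (s.2.getD 0 0))
      ⟨h.getD_lt 1, h.getD_lt 0⟩ 2
    simp only [Gate.value, h.getD_eq] at this
    exact this
  | dup =>
    refine ⟨h.pre, h.pos, h.zero, h.wf, ?_, ?_⟩
    · intro p hp
      rcases List.mem_cons.1 hp with rfl | hp
      · exact h.getD_lt 0
      · exact h.lt p hp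
    · simp only [compileStep, step, List.map_cons, h.getD_eq, h.stack]
  | call =>
    set G := s.1 ++ [Gate.const 0] with hG
    have hGl : G.length = s.1.length + 1 := by simp [hG]
    have hwf : Gate.WF G := h.wf.concat trivial
    have hb : ∀ i : Fin n, (Gate.add (n := N) (s.2.getD i 0) 0).Below G.length := fun i =>
      ⟨by have := h.getD_lt i; omega, by omega⟩
    have hget : ∀ p < s.1.length, (Gate.run x G).getD p 0 = (Gate.run x s.1).getD p 0 :=
      fun p hp => Gate.run_append_getD _ _ _ hp
    have hval : ∀ i : Fin n, (Gate.add (n := N) (s.2.getD i 0) 0).value x (Gate.run x G)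
        = st.getD i 0 := fun i => by
      simp only [Gate.value]
      rw [hget _ (h.getD_lt i), hget _ h.pos, h.zero, h.getD_eq, add_zero]
    have hrun := Gate.run_inline x (fun i : Fin n => st.getD i 0) hb hval C.wf
    have hwf' := hwf.inline hb C.wf
    rw [hGl] at hrun hwf'
    set L := C.gates.map (Gate.inline (s.1.length + 1)
      fun i : Fin n => Gate.add (n := N) (s.2.getD i 0) 0) with hL
    have hLl : L.length = C.gates.length := by simp [hL]
    have := h.push ([Gate.const 0] ++ L) (by simp) (by rw [← List.append_assoc]; exact hwf') n
      (v := C.eval fun i : Fin n => st.getD i 0) (by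
        rw [← List.append_assoc, ← hG, hrun, Circuit.eval_eq]
        have e : s.1.length + ([Gate.const (n := N) 0] ++ L).length - 1
            = s.1.length + C.gates.length := by simp [hLl]
        rw [e, hG, Gate.run_concat]
        set V := Gate.run (fun i : Fin n => st.getD i 0) C.gates with hV
        have hVl : V.length = C.gates.length := by simp [hV]
        rw [← hVl]
        rcases List.eq_nil_or_concat V with h0 | ⟨l, a, h0⟩
        · simp [h0, Gate.value]
        · rw [h0]
          simp [Gate.value])
    have e : s.1.length + ([Gate.const (n := N) 0] ++ L).length - 1
        = s.1.length + C.gates.length := by simp [hLl]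
    rw [e, ← List.append_assoc] at this
    exact this

/-- The state after the translation of the instructions `t`. -/
def compileState (C : Circuit n) (G₀ : List (Gate N)) (σ : ℕ → Gate N) (t : List Instr) :
    List (Gate N) × List ℕ :=
  t.foldl (compileStep C σ) (G₀, [])

theorem compileState_concat (C : Circuit n) (G₀ : List (Gate N)) (σ : ℕ → Gate N)
    (t : List Instr) (i : Instr) :
    compileState C G₀ σ (t ++ [i]) = compileStep C σ (compileState C G₀ σ t) i := by
  simp [compileState]

/-- The nodes of the circuit for the stack program `t`. -/
def compileGates (C : Circuit n) (G₀ : List (Gate N)) (σ : ℕ → Gate N) (t : List Instr) :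
    List (Gate N) :=
  (compileState C G₀ σ t).1 ++ [.add ((compileState C G₀ σ t).2.getD 0 0) 0]

/-- Nodes to start from: the first one is the constant `0`, and the nodes `σ` refer to them. -/
structure Start (G₀ : List (Gate N)) (σ : ℕ → Gate N) : Prop where
  head : G₀.head? = some (.const 0)
  wf : Gate.WF G₀
  below : ∀ i, (σ i).Below G₀.length

theorem Start.pos {G₀ : List (Gate N)} {σ : ℕ → Gate N} (h : Start G₀ σ) : 0 < G₀.length := by
  have := h.head
  cases G₀ <;> simp_all

theorem Start.holds {G₀ : List (Gate N)} {σ : ℕ → Gate N} (h : Start G₀ σ) (x : Fin N → R)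
    (C : Circuit n) (t : List Instr) :
    Holds x G₀ (compileState C G₀ σ t)
      (exec C.eval (fun i => (σ i).value x (Gate.run x G₀)) t []) := by
  induction t using List.reverseRecOn with
  | nil =>
    refine ⟨List.prefix_refl _, h.pos, ?_, h.wf, by simp [compileState], by simp [compileState]⟩
    have hh := h.head
    cases G₀ with
    | nil => simp at hh
    | cons g G =>
      simp only [List.head?_cons, Option.some.injEq] at hh
      subst hh
      have := Gate.run_append_getD x [Gate.const 0] G (p := 0) (by simp)
      exact this.trans (by simp [Gate.run, Gate.value])
  | append_singleton t i ih =>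
    rw [compileState_concat, exec_append]
    exact holds_compileStep h.below (fun _ => rfl) ih i

/-- The circuit for the stack program `t`. -/
def compile (C : Circuit n) {G₀ : List (Gate N)} {σ : ℕ → Gate N} (h : Start G₀ σ)
    (t : List Instr) : Circuit N where
  gates := compileGates C G₀ σ t
  wf := (h.holds (R := ℤ) (fun _ => 0) C t).wf.concat
    ⟨(h.holds (R := ℤ) (fun _ => 0) C t).getD_lt 0, (h.holds (R := ℤ) (fun _ => 0) C t).pos⟩

theorem eval_compile (C : Circuit n) {G₀ : List (Gate N)} {σ : ℕ → Gate N} (h : Start G₀ σ)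
    (t : List Instr) (x : Fin N → R) :
    (compile C h t).eval x = result C.eval (fun i => (σ i).value x (Gate.run x G₀)) t := by
  have hh := h.holds x C t
  rw [Circuit.eval_eq]
  simp only [compile, compileGates, Gate.run_concat, Gate.value, hh.getD_eq, hh.zero]
  simp [result]

/-- The total bit size of a list of nodes. -/
def totalBits (G : List (Gate N)) : ℕ := (G.map Gate.bitSize).sum

theorem totalBits_append (G G' : List (Gate N)) :
    totalBits (G ++ G') = totalBits G + totalBits G' := by simp [totalBits]

theorem totalBits_inline (C : Circuit n) (k : ℕ) (σ : Fin n → Gate N)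
    (hσ : ∀ i, (σ i).bitSize = 1) : totalBits (C.gates.map (Gate.inline k σ)) = C.bitSize := by
  rw [totalBits, Circuit.bitSize, List.map_map]
  congr 1
  refine List.map_congr_left fun g _ => ?_
  cases g with
  | var i => exact hσ i
  | const z => rfl
  | add a b => rfl
  | mul a b => rfl

/-- Every instruction costs at most one copy of `C` and a bounded number of further nodes. -/
theorem bitSize_compile_le (C : Circuit n) {G₀ : List (Gate N)} {σ : ℕ → Gate N}
    (h : Start G₀ σ) {B : ℕ} (hσ : ∀ i, (σ i).bitSize ≤ B) (t : List Instr) :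
    (compile C h t).bitSize ≤ totalBits G₀ + t.length * (C.bitSize + B + 3) + 1 := by
  suffices hs : totalBits (compileState C G₀ σ t).1 ≤
      totalBits G₀ + t.length * (C.bitSize + B + 3) by
    have : (compile C h t).bitSize = totalBits (compileState C G₀ σ t).1 + 1 := by
      simp [compile, Circuit.bitSize, compileGates, totalBits, Gate.bitSize]
    omega
  induction t using List.reverseRecOn with
  | nil => simp [compileState]
  | append_singleton t i ih =>
    rw [compileState_concat]
    have hl : (t ++ [i]).length * (C.bitSize + B + 3) =
        t.length * (C.bitSize + B + 3) + (C.bitSize + B + 3) := by simp [Nat.add_mul]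
    rw [hl]
    have h1 : ∀ g : Gate N, totalBits [g] = g.bitSize := fun g => by simp [totalBits]
    cases i with
    | inp i => simp only [compileStep, totalBits_append, h1]; have := hσ i; omega
    | one => simp only [compileStep, totalBits_append, h1]; simp [Gate.bitSize]; omega
    | negOne => simp only [compileStep, totalBits_append, h1]; simp [Gate.bitSize]; omega
    | add => simp only [compileStep, totalBits_append, h1]; simp [Gate.bitSize]; omega
    | mul => simp only [compileStep, totalBits_append, h1]; simp [Gate.bitSize]; omega
    | dup => simp only [compileStep]; omega
    | call =>
      simp only [compileStep, totalBits_append, h1]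
      rw [totalBits_inline _ _ _ fun _ => rfl]
      simp [Gate.bitSize]; omega

end Instr

/-! ### Writing down circuits in polynomial time -/

theorem PolyTime.feasible {α : Type} {dom : α → Prop} {inp out : α → Data} {len : α → ℕ}
    (h : PolyTime dom inp out len) (Q : Polynomial ℕ)
    (hQ : ∀ a, dom a → len a ≤ Q.eval (inp a).size) :
    Feasible (α := {a // dom a}) (fun a => inp a.1) fun a => out a.1 := by
  obtain ⟨p, c, hp⟩ := h
  refine ⟨p, (Q + 2) ^ c, fun a => (hp a.1 a.2).mono ?_⟩
  simp only [Polynomial.eval_pow, Polynomial.eval_add, Polynomial.eval_ofNat]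
  have := hQ a.1 a.2
  gcongr

theorem Feasible.polyTime {α : Type} {dom : α → Prop} {inp out : α → Data} {len : α → ℕ}
    (h : Feasible (α := {a // dom a}) (fun a => inp a.1) fun a => out a.1) (Q : Polynomial ℕ)
    (hQ : ∀ a, dom a → (inp a).size ≤ Q.eval (len a)) : PolyTime dom inp out len := by
  obtain ⟨p, P, hp⟩ := h
  obtain ⟨c, hc⟩ := (P.comp Q).exists_eval_le_pow
  refine ⟨p, c, fun a ha => (hp ⟨a, ha⟩).mono ?_⟩
  refine (P.eval_mono_nat (hQ a ha)).trans ?_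
  rw [← Polynomial.eval_comp]
  exact hc _

namespace Data

/-- The length of a tree as a list. -/
def spine : Data → List Data
  | nil => []
  | node a b => a :: b.spine

theorem ofList_spine (d : Data) : ofList (fun x => x) d.spine = d := by
  induction d with
  | nil => rfl
  | node a b _ hb => simp [spine, hb]

@[simp] theorem length_spine_ofNat (n : ℕ) : (ofNat n).spine.length = n := by
  induction n with
  | zero => rfl
  | succ n ih => simp [ofNat, spine, ih]

theorem two_mul_natSize_le (z : ℤ) : 2 * z.natAbs.size + 3 ≤ (ofInt z).size := by
  have h1 : z.natAbs.bits.length = z.natAbs.size := by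
    rw [Nat.size_eq_bits_len]
  have h2 : ∀ l : List Bool, 2 * l.length + 1 ≤ (ofList ofBool l).size := by
    intro l
    induction l with
    | nil => simp
    | cons b l ih =>
      have := size_pos (ofBool b)
      simp only [ofList_cons, size_node, List.length_cons]; omega
  have := h2 z.natAbs.bits
  have := size_pos (ofBool (decide (z < 0)))
  simp only [ofInt, size_node]
  omega

theorem size_ofInt_le (z : ℤ) : (ofInt z).size ≤ 4 * z.natAbs.size + 5 := by
  have h1 : z.natAbs.bits.length = z.natAbs.size := by
    rw [Nat.size_eq_bits_len]
  have hb : ∀ b, (ofBool b).size ≤ 3 := by intro b; cases b <;> simp [ofBool]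
  have h2 := size_ofList_le ofBool z.natAbs.bits (B := 3) fun b _ => hb b
  have := hb (decide (z < 0))
  simp only [ofInt, size_node]
  omega

end Data

namespace Circuit

variable {n : ℕ}

theorem bitSize_le_size_toData (C : Circuit n) : C.bitSize ≤ C.toData.size := by
  have hg : ∀ g : Gate n, g.bitSize ≤ g.toData.size := by
    intro g
    cases g with
    | const z =>
      have := Data.two_mul_natSize_le z
      simp only [Gate.bitSize, Gate.toData, Data.size_node]; omega
    | var i => exact Data.size_pos _
    | add a b => exact Data.size_pos _
    | mul a b => exact Data.size_pos _
  have : ∀ G : List (Gate n), (G.map Gate.bitSize).sum ≤ (Data.ofList Gate.toData G).size := by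
    intro G
    induction G with
    | nil => simp
    | cons g G ih =>
      have := hg g
      simp only [List.map_cons, List.sum_cons, Data.ofList_cons, Data.size_node]; omega
  exact this _

/-- The description of a circuit has size polynomial in its bit size and the number of variables.
-/
theorem size_toData_le (C : Circuit n) :
    C.toData.size ≤ C.bitSize * (4 * (n + C.bitSize) + 20 + 1) + 1 := by
  have hconst : ∀ g ∈ C.gates, g.bitSize ≤ C.bitSize := fun g hg =>
    List.single_le_sum (by simp) _ (List.mem_map_of_mem hg)
  refine (Data.size_ofList_le Gate.toData C.gates (B := 4 * (n + C.bitSize) + 20)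
    fun g hg => ?_).trans ?_
  · obtain ⟨p, hp, rfl⟩ := List.getElem_of_mem hg
    have h1 := C.length_le_bitSize
    have h2 := C.wf p hp
    have h3 := hconst _ hg
    revert h2 h3
    generalize C.gates[p] = g
    cases g with
    | var i =>
      intro _ _
      have := i.2
      simp only [Gate.toData, Data.size_node, Data.size_ofNat]; omega
    | const z =>
      intro _ h3
      have := Data.size_ofInt_le z
      simp only [Gate.toData, Data.size_node, Data.size_ofNat, Gate.bitSize] at h3 ⊢; omega
    | add a b =>
      rintro ⟨h4, h5⟩ _
      simp only [Gate.toData, Data.size_node, Data.size_ofNat]; omega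
    | mul a b =>
      rintro ⟨h4, h5⟩ _
      simp only [Gate.toData, Data.size_node, Data.size_ofNat]; omega
  · have := C.length_le_bitSize
    gcongr

end Circuit

namespace Instr

variable {n : ℕ}

/-- The number of an instruction. -/
def tag : Instr → ℕ
  | inp _ => 0
  | one => 1
  | negOne => 2
  | add => 3
  | mul => 4
  | dup => 5
  | call => 6

/-- The operand of an instruction. -/
def arg : Instr → ℕ
  | inp i => i
  | _ => 0

/-- An instruction as a datum. -/
def toData (t : Instr) : Data := .node (.ofNat t.tag) (.ofNat t.arg)

theorem start_const (Y : List ℤ) :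
    Start (N := 0) [.const 0] fun i => .const (Y.getD i 0) where
  head := rfl
  wf := Gate.WF.concat (G := []) (fun p hp => absurd hp (by simp)) trivial
  below _ := trivial

/-- The circuit without variables for the stack program `t` with inputs `Y`. -/
def compileAt (C : Circuit n) (Y : List ℤ) (t : List Instr) : Circuit 0 :=
  compile C (start_const Y) t

theorem poly_compileAt_eq_zero (C : Circuit n) (Y : List ℤ) (t : List Instr) :
    (compileAt C Y t).poly = 0 ↔ result C.eval (fun i => Y.getD i 0) t = 0 := by
  have h2 : (compileAt C Y t).eval (fun i : Fin 0 => (i.elim0 : ℤ)) =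
      result C.eval (fun i => Y.getD i 0) t := by
    rw [compileAt, eval_compile]
    simp [Gate.value]
  rw [← h2, ← Circuit.eval_poly]
  constructor
  · intro h; rw [h, map_zero]
  · intro h
    refine MvPolynomial.funext fun x => ?_
    rw [map_zero, ← h]
    congr 1
    exact congrArg _ (Subsingleton.elim _ _)

/-- Bounds for the number and the size of the nodes that a translation writes. -/
theorem compileState_bounds (C : Circuit n) (Y : List ℤ) (L B : ℕ) (hB : 4 * L + 20 ≤ B)
    (hY : (Data.ofList Data.ofInt Y).size + 10 ≤ B) (hC : C.toData.size ≤ B) (t : List Instr)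
    (ht : 1 + t.length * (C.gates.length + 1) ≤ L) :
    let s := compileState C [.const (n := 0) 0] (fun i => .const (Y.getD i 0)) t
    s.1.length ≤ 1 + t.length * (C.gates.length + 1) ∧ s.2.length ≤ t.length ∧
      (∀ p ∈ s.2, p < L) ∧ ∀ g ∈ s.1, g.toData.size ≤ B := by
  have hY' : ∀ i, (Gate.const (n := 0) (Y.getD i 0)).toData.size ≤ B := by
    intro i
    simp only [Gate.toData, Data.size_node, Data.size_ofNat]
    rcases lt_or_ge i Y.length with hi | hi
    · rw [List.getD_eq_getElem _ _ hi]
      have := Data.size_lt_of_mem Data.ofInt (List.getElem_mem hi)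
      omega
    · rw [List.getD_eq_default _ _ hi]
      have : (Data.ofInt 0).size = 3 := rfl
      omega
  have h0 : (Gate.const (n := 0) 0).toData.size ≤ B := by
    have : (Gate.const (n := 0) 0).toData.size = 7 := rfl
    omega
  induction t using List.reverseRecOn with
  | nil =>
    refine ⟨by simp [compileState], by simp [compileState], by simp [compileState], ?_⟩
    simp only [compileState, List.foldl_nil, List.mem_singleton]
    rintro g rfl
    exact h0
  | append_singleton t i ih =>
    have hl : (t ++ [i]).length * (C.gates.length + 1) =
        t.length * (C.gates.length + 1) + (C.gates.length + 1) := by simp [Nat.add_mul]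
    have hl' : (t ++ [i]).length = t.length + 1 := by simp
    rw [hl] at ht ⊢
    rw [hl']
    obtain ⟨h1, h2, h3, h4⟩ := ih (by omega)
    rw [compileState_concat]
    set s := compileState C [.const (n := 0) 0] (fun i => .const (Y.getD i 0)) t with hs
    have hget : ∀ j, s.2.getD j 0 < L := by
      intro j
      rcases lt_or_ge j s.2.length with hj | hj
      · rw [List.getD_eq_getElem _ _ hj]; exact h3 _ (List.getElem_mem _)
      · rw [List.getD_eq_default _ _ hj]; omega
    have hone : ∀ (g : Gate 0) (k : ℕ), g.toData.size ≤ B →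
        (s.1 ++ [g]).length ≤ 1 + (t.length * (C.gates.length + 1) + (C.gates.length + 1)) ∧
        (s.1.length :: s.2.drop k).length ≤ t.length + 1 ∧
        (∀ p ∈ s.1.length :: s.2.drop k, p < L) ∧ ∀ g' ∈ s.1 ++ [g], g'.toData.size ≤ B := by
      intro g k hg
      refine ⟨by simp only [List.length_append, List.length_singleton]; omega,
        by simp only [List.length_cons, List.length_drop]; omega, ?_, ?_⟩
      · intro p hp
        rcases List.mem_cons.1 hp with rfl | hp
        · omega
        · exact h3 p (List.mem_of_mem_drop hp)
      · intro g' hg'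
        rcases List.mem_append.1 hg' with hg' | hg'
        · exact h4 g' hg'
        · rw [List.mem_singleton.1 hg']; exact hg
    have hc1 : (Gate.const (n := 0) 1).toData.size ≤ B := by
      have : (Gate.const (n := 0) 1).toData.size = 11 := by
        simp [Gate.toData, Data.ofInt, Data.ofBool, Data.ofNat]
      omega
    have hc2 : (Gate.const (n := 0) (-1)).toData.size ≤ B := by
      have : (Gate.const (n := 0) (-1)).toData.size = 13 := by
        simp [Gate.toData, Data.ofInt, Data.ofBool, Data.ofNat]
      omega
    have hga := hget 0
    have hgb := hget 1
    cases i with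
    | inp i => exact hone _ 0 (hY' i)
    | one => exact hone _ 0 hc1
    | negOne => exact hone _ 0 hc2
    | add =>
      refine hone _ 2 ?_
      simp only [Gate.toData, Data.size_node, Data.size_ofNat]; omega
    | mul =>
      refine hone _ 2 ?_
      simp only [Gate.toData, Data.size_node, Data.size_ofNat]; omega
    | dup =>
      refine ⟨by simp only [compileStep]; omega,
        by simp only [compileStep, List.length_cons]; omega,
        ?_, h4⟩
      intro p hp
      rcases List.mem_cons.1 hp with rfl | hp
      · exact hga
      · exact h3 p hp
    | call =>
      refine ⟨by simp only [compileStep, List.length_append, List.length_map,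
          List.length_singleton]; omega,
        by simp only [compileStep, List.length_cons, List.length_drop]; omega, ?_, ?_⟩
      · intro p hp
        rcases List.mem_cons.1 hp with rfl | hp
        · omega
        · exact h3 p (List.mem_of_mem_drop hp)
      · intro g hg
        rcases List.mem_append.1 hg with hg | hg
        · rcases List.mem_append.1 hg with hg | hg
          · exact h4 g hg
          · rw [List.mem_singleton.1 hg]; exact h0
        · obtain ⟨g', hg', rfl⟩ := List.mem_map.1 hg
          have hsz := Data.size_lt_of_mem Gate.toData hg'
          obtain ⟨p, hp, rfl⟩ := List.getElem_of_mem hg'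
          have hw := C.wf p hp
          revert hsz hw
          generalize C.gates[p] = g
          intro hsz hw
          have hsz' : g.toData.size < C.toData.size := hsz
          cases g with
          | var i =>
            have := hget i
            simp only [Gate.inline, Gate.toData, Data.size_node, Data.size_ofNat]; omega
          | const z =>
            simp only [Gate.inline, Gate.toData] at hsz' ⊢; omega
          | add a b =>
            have := hw.1
            have := hw.2
            simp only [Gate.inline, Gate.toData, Data.size_node, Data.size_ofNat]; omega
          | mul a b =>
            have := hw.1
            have := hw.2
            simp only [Gate.inline, Gate.toData, Data.size_node, Data.size_ofNat]; omega

end Instr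

namespace Feasible

variable {α : Type} {inp : α → Data}

/-- A datum as a number. -/
theorem spineLength {d : α → Data} (h : Feasible inp d) :
    Feasible inp fun a => .ofNat (d a).spine.length :=
  length (β := fun _ => Data) (enc := fun _ x => x) (l := fun a => (d a).spine)
    (h.congr fun _ => (Data.ofList_spine _).symm)

theorem singleton {β : α → Type} {enc : ∀ a, β a → Data} {x : ∀ a, β a}
    (h : Feasible inp fun a => enc a (x a)) : Feasible inp fun a => .ofList (enc a) [x a] :=
  h.pair nil

/-- Copying a circuit, with the variables replaced by sums of the nodes at given positions and
node `0`. -/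
theorem inlineGates {n N : α → ℕ} {C : ∀ a, Circuit (n a)} {k : α → ℕ} {ps : α → List ℕ}
    (hC : Feasible inp fun a => (C a).toData) (hk : Feasible inp fun a => .ofNat (k a))
    (hps : Feasible inp fun a => .ofList Data.ofNat (ps a)) :
    Feasible inp fun a => .ofList Gate.toData ((C a).gates.map
      (Gate.inline (N := N a) (k a) fun i => .add ((ps a).getD i 0) 0)) := by
  refine (map (fun _ => Gate.toData) (fun a => (C a).gates)
    (fun a g => (Gate.inline (N := N a) (k a) (fun i => .add ((ps a).getD i 0) 0) g).toData)
    hC ?_).congr fun a => (Data.ofList_map _ _ _).symm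
  have hk' := hk.lift (fun q : Member fun a => (C a).gates => q.1.1)
    (env := fun q => .node (inp q.1.1) q.1.2.toData) self.fst
  have hps' := hps.lift (fun q : Member fun a => (C a).gates => q.1.1)
    (env := fun q => .node (inp q.1.1) q.1.2.toData) self.fst
  have hg : Feasible (fun q : Member fun a => (C a).gates => .node (inp q.1.1) q.1.2.toData)
    fun q => q.1.2.toData := self.snd
  have hpos := getD (β := fun _ => ℕ) (enc := fun _ => Data.ofNat) (d := fun _ => 0) hps'
    hg.snd.spineLength (nat 0)
  refine (ite (eq hg.fst.spineLength (nat 0))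
    ((nat 2).pair (hpos.pair (nat 0)))
    (ite (eq hg.fst.spineLength (nat 1)) hg
      (hg.fst.pair ((hk'.add hg.snd.fst.spineLength).pair
        (hk'.add hg.snd.snd.spineLength))))).congr fun q => ?_
  obtain ⟨⟨a, g⟩, _⟩ := q
  cases g <;> simp [Gate.toData, Gate.inline]

theorem compileStep {n : α → ℕ} {C : ∀ a, Circuit (n a)} {Y : α → List ℤ}
    {G : α → List (Gate 0)} {ps : α → List ℕ} {t : α → Instr}
    (hn : Feasible inp fun a => .ofNat (n a)) (hC : Feasible inp fun a => (C a).toData)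
    (hY : Feasible inp fun a => .ofList Data.ofInt (Y a))
    (hG : Feasible inp fun a => .ofList Gate.toData (G a))
    (hps : Feasible inp fun a => .ofList Data.ofNat (ps a))
    (ht : Feasible inp fun a => (t a).toData) :
    Feasible inp fun a =>
      let s := Instr.compileStep (C a) (fun i => .const ((Y a).getD i 0)) (G a, ps a) (t a)
      .node (.ofList Gate.toData s.1) (.ofList Data.ofNat s.2) := by
  have htag : Feasible inp fun a => .ofNat (t a).tag := ht.fst
  have harg : Feasible inp fun a => .ofNat (t a).arg := ht.snd
  have hlen := length (β := fun _ => Gate 0) (enc := fun _ => Gate.toData) hG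
  have hget : ∀ i, Feasible inp fun a => .ofNat ((ps a).getD i 0) := fun i =>
    getD (β := fun _ => ℕ) (enc := fun _ => Data.ofNat) (d := fun _ => 0) hps (nat i) (nat 0)
  have hconst : ∀ z : ℤ, Feasible inp fun _ => (Gate.const (n := 0) z).toData := fun z => const _
  have hpush : ∀ {g : α → Gate 0} {k : α → ℕ}, (Feasible inp fun a => (g a).toData) →
      (Feasible inp fun a => .ofNat (k a)) →
      Feasible inp fun a => .node (.ofList Gate.toData (G a ++ [g a]))
        (.ofList Data.ofNat ((G a).length :: (ps a).drop (k a))) := fun hg hk =>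
    (append (β := fun _ => Gate 0) (enc := fun _ => Gate.toData) hG
      (singleton (β := fun _ => Gate 0) (enc := fun _ => Gate.toData) hg)).pair
      (hlen.pair (drop (β := fun _ => ℕ) (enc := fun _ => Data.ofNat) hps hk))
  have hY' := getD (β := fun _ => ℤ) (enc := fun _ => Data.ofInt) (d := fun _ => 0) hY harg
    (const (.ofInt 0))
  have h0 := hpush (g := fun a => .const ((Y a).getD (t a).arg 0)) ((nat 1).pair hY') (nat 0)
  have h1 := hpush (hconst 1) (nat 0)
  have h2 := hpush (hconst (-1)) (nat 0)
  have h3 := hpush (g := fun a => .add ((ps a).getD 1 0) ((ps a).getD 0 0))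
    ((nat 2).pair ((hget 1).pair (hget 0))) (nat 2)
  have h4 := hpush (g := fun a => .mul ((ps a).getD 1 0) ((ps a).getD 0 0))
    ((nat 3).pair ((hget 1).pair (hget 0))) (nat 2)
  have h5 : Feasible inp fun a => .node (.ofList Gate.toData (G a))
      (.ofList Data.ofNat ((ps a).getD 0 0 :: ps a)) := hG.pair ((hget 0).pair hps)
  have hlenC := length (β := fun a => Gate (n a)) (enc := fun _ => Gate.toData)
    (l := fun a => (C a).gates) hC
  have h6 := (append (β := fun _ => Gate 0) (enc := fun _ => Gate.toData)
    (append (β := fun _ => Gate 0) (enc := fun _ => Gate.toData) hG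
      (singleton (β := fun _ => Gate 0) (enc := fun _ => Gate.toData) (hconst 0)))
    (inlineGates (N := fun _ => 0) hC (hlen.add (nat 1)) hps)).pair
    ((hlen.add hlenC).pair (drop (β := fun _ => ℕ) (enc := fun _ => Data.ofNat) hps hn))
  refine (ite (eq htag (nat 0)) h0 (ite (eq htag (nat 1)) h1 (ite (eq htag (nat 2)) h2
    (ite (eq htag (nat 3)) h3 (ite (eq htag (nat 4)) h4 (ite (eq htag (nat 5)) h5 h6)))))).congr
      fun a => ?_
  cases t a <;> rfl

theorem compileAt {n : α → ℕ} {C : ∀ a, Circuit (n a)} {Y : α → List ℤ} {t : α → List Instr}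
    (hn : Feasible inp fun a => .ofNat (n a)) (hC : Feasible inp fun a => (C a).toData)
    (hY : Feasible inp fun a => .ofList Data.ofInt (Y a))
    (ht : Feasible inp fun a => .ofList Instr.toData (t a)) :
    Feasible inp fun a => (Instr.compileAt (C a) (Y a) (t a)).toData := by
  have hst : Feasible inp fun a =>
      (fun s : List (Gate 0) × List ℕ =>
        Data.node (.ofList Gate.toData s.1) (.ofList Data.ofNat s.2))
        ((t a).foldl (Instr.compileStep (C a) fun i => .const ((Y a).getD i 0))
          ([.const 0], [])) := by
    refine foldl (σ := fun _ => List (Gate 0) × List ℕ) (fun _ => Instr.toData)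
      (fun _ s => .node (.ofList Gate.toData s.1) (.ofList Data.ofNat s.2)) t
      (fun _ => ([.const 0], []))
      (fun a => Instr.compileStep (C a) fun i => .const ((Y a).getD i 0))
      ht (const (.node (.ofList Gate.toData [Gate.const (n := 0) 0]) (.ofList Data.ofNat [])))
      ?_ ?_
    · exact compileStep (hn.lift (fun q : Prefix t => q.1.1) self.fst)
        (hC.lift (fun q : Prefix t => q.1.1) self.fst)
        (hY.lift (fun q : Prefix t => q.1.1) self.fst) self.snd.fst.fst self.snd.fst.snd
        self.snd.snd
    · obtain ⟨P, hP⟩ := hC.size_le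
      obtain ⟨Q, hQ⟩ := hY.size_le
      obtain ⟨T, hT⟩ := ht.size_le
      let L : Polynomial ℕ := 1 + T * (P + 1)
      let B : Polynomial ℕ := 4 * L + 20 + Q + P
      refine ⟨L * (B + 1) + T * (2 * L + 2) + 3, fun a pre hpre => ?_⟩
      have h1 : (C a).toData.size ≤ _ := hP a
      have h2 : (Data.ofList Data.ofInt (Y a)).size ≤ _ := hQ a
      have h3 : (Data.ofList Instr.toData (t a)).size ≤ _ := hT a
      have h4 := Data.length_le_size_ofList Instr.toData (t a)
      have h5 : (C a).gates.length + 1 ≤ (C a).toData.size := Data.length_le_size_ofList _ _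
      have h6 := hpre.length_le
      have hL : L.eval (inp a).size =
          1 + T.eval (inp a).size * (P.eval (inp a).size + 1) := by simp [L]
      have hB : B.eval (inp a).size = 4 * L.eval (inp a).size + 20 + Q.eval (inp a).size
          + P.eval (inp a).size := by simp [B]
      have h7 : pre.length * ((C a).gates.length + 1) ≤
          T.eval (inp a).size * (P.eval (inp a).size + 1) := by gcongr <;> omega
      obtain ⟨b1, b2, b3, b4⟩ := Instr.compileState_bounds (C a) (Y a) (L.eval (inp a).size)
        (B.eval (inp a).size) (by omega) (by omega) (by omega) pre (by omega)
      have e : pre.foldl (Instr.compileStep (C a) fun i => .const ((Y a).getD i 0))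
          ([.const 0], []) = Instr.compileState (C a) [.const (n := 0) 0]
            (fun i => .const ((Y a).getD i 0)) pre := rfl
      rw [e]
      set s := Instr.compileState (C a) [.const (n := 0) 0] (fun i => .const ((Y a).getD i 0)) pre
      have c1 := Data.size_ofList_le Gate.toData s.1 b4
      have c2 := Data.size_ofList_le Data.ofNat s.2 (B := 2 * L.eval (inp a).size + 1)
        fun p hp => by have := b3 p hp; simp; omega
      have c3 : s.1.length * (B.eval (inp a).size + 1) ≤
          L.eval (inp a).size * (B.eval (inp a).size + 1) := by gcongr; omega
      have c4 : s.2.length * (2 * L.eval (inp a).size + 1 + 1) ≤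
          T.eval (inp a).size * (2 * L.eval (inp a).size + 2) := by gcongr; omega
      simp only [Data.size_node, Polynomial.eval_add, Polynomial.eval_mul, Polynomial.eval_ofNat,
        Polynomial.eval_one]
      omega
  exact append (β := fun _ => Gate 0) (enc := fun _ => Gate.toData) hst.fst
    (singleton (β := fun _ => Gate 0) (enc := fun _ => Gate.toData) ((nat 2).pair
      ((getD (β := fun _ => ℕ) (enc := fun _ => Data.ofNat) (d := fun _ => 0) hst.snd (nat 0)
        (nat 0)).pair (nat 0))))

/-- With polynomial identity testing, the vanishing of a stack program at integer inputs can be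
decided in polynomial time, although its value may have exponentially many bits. -/
theorem result_ne_zero
    (hPIT : PolyTime (α := Σ n : ℕ, Circuit n) (fun _ => True)
      (fun a => .node (.ofNat a.1) a.2.toData) (fun a => .ofProp (a.2.poly = 0))
      (fun a => a.1 + a.2.bitSize))
    {n : α → ℕ} {C : ∀ a, Circuit (n a)} {Y : α → List ℤ} {t : α → List Instr}
    (hn : Feasible inp fun a => .ofNat (n a)) (hC : Feasible inp fun a => (C a).toData)
    (hY : Feasible inp fun a => .ofList Data.ofInt (Y a))
    (ht : Feasible inp fun a => .ofList Instr.toData (t a)) :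
    Feasible inp fun a =>
      .ofBool (decide (Instr.result (C a).eval (fun i => (Y a).getD i 0) (t a) ≠ 0)) := by
  have h := hPIT.feasible Polynomial.X fun a _ => by
    have := a.2.bitSize_le_size_toData
    simp only [Data.size_node, Data.size_ofNat, Polynomial.eval_X]; omega
  have h2 := h.lift (fun a : α => ⟨⟨0, Instr.compileAt (C a) (Y a) (t a)⟩, trivial⟩)
    ((nat 0).pair (compileAt hn hC hY ht))
  refine (cond h2 (const (.ofBool false)) (const (.ofBool true))).congr fun a => ?_
  simp only [Instr.poly_compileAt_eq_zero, Data.ofProp]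
  split_ifs with h3
  · rw [decide_eq_false (not_not.2 h3)]
  · rw [decide_eq_true h3]

end Feasible

/-! ### A universal program -/

/-- Commands of a stack machine that interprets programs. -/
inductive Cmd : Type
  | run : Prog → Cmd
  | swap : Cmd
  | cons : Cmd
  | branch : Prog → Prog → Cmd
  | again : Prog → Prog → Cmd

namespace Cmd

/-- A command as a datum. The codes of programs use the tags up to `7`. -/
def code : Cmd → Data
  | run p => p.code
  | swap => .node (.ofNat 8) .nil
  | cons => .node (.ofNat 9) .nil
  | branch f g => .node (.ofNat 10) (.node f.code g.code)
  | again c f => .node (.ofNat 11) (.node c.code f.code)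

/-- The state of the stack machine: the commands to be carried out, and a stack of data. -/
abbrev Config : Type := List Cmd × List Data

/-- One step of the stack machine. A command `run p` replaces the top of the stack by the output of
`p`; `branch f g` takes a condition from the stack and runs `f` or `g`; `again c f` takes the
condition of a loop from the stack. -/
def step : Config → Config
  | ([], V) => ([], V)
  | (run .id :: K, V) => (K, V)
  | (run .nil :: K, V) => (K, .nil :: V.tail)
  | (run .fst :: K, V) => (K, (V.headD .nil).fst :: V.tail)
  | (run .snd :: K, V) => (K, (V.headD .nil).snd :: V.tail)
  | (run (.pair f g) :: K, V) =>
      (run f :: swap :: run g :: cons :: K, V.headD .nil :: V.headD .nil :: V.tail)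
  | (run (.comp g f) :: K, V) => (run f :: run g :: K, V)
  | (run (.cond c f g) :: K, V) =>
      (run c :: branch f g :: K, V.headD .nil :: V.headD .nil :: V.tail)
  | (run (.loop c f) :: K, V) =>
      (run c :: again c f :: K, V.headD .nil :: V.headD .nil :: V.tail)
  | (swap :: K, V) => (K, V.tail.headD .nil :: V.headD .nil :: V.tail.tail)
  | (cons :: K, V) => (K, .node (V.tail.headD .nil) (V.headD .nil) :: V.tail.tail)
  | (branch f g :: K, V) => match V.headD .nil with
      | .nil => (run g :: K, V.tail)
      | .node _ _ => (run f :: K, V.tail)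
  | (again c f :: K, V) => match V.headD .nil with
      | .nil => (K, V.tail)
      | .node _ _ => (run f :: run (.loop c f) :: K, V.tail)

/-- A state of the stack machine as a datum. -/
def encode (s : Config) : Data := .node (.ofList code s.1) (.ofList (fun d => d) s.2)

theorem fst_ofList (V : List Data) : (Data.ofList (fun d => d) V).fst = V.headD .nil := by
  cases V <;> rfl

/-- A step inspects the tag of the first command, which determines one of twelve outcomes. -/
theorem feasible_step : Feasible encode fun s => encode (step s) := by
  have hk : Feasible encode fun s => .ofList code s.1 := Feasible.self.fst
  have hv : Feasible encode fun s => .ofList (fun d => d) s.2 := Feasible.self.snd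
  have hK := hk.snd
  have hx := hv.fst
  have hx2 := hv.snd.fst
  have hV := hv.snd
  have hV2 := hv.snd.snd
  have harg := hk.fst.snd
  have htag := hk.fst.fst.spineLength
  have n8 := Feasible.const (inp := encode) swap.code
  have n9 := Feasible.const (inp := encode) cons.code
  have hxx := hx.pair (hx.pair hV)
  have c0 := hK.pair hv
  have c1 := hK.pair (Feasible.nil.pair hV)
  have c2 := hK.pair (hx.fst.pair hV)
  have c3 := hK.pair (hx.snd.pair hV)
  have c4 := (harg.fst.pair (n8.pair (harg.snd.pair (n9.pair hK)))).pair hxx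
  have c5 := (harg.snd.pair (harg.fst.pair hK)).pair hv
  have c6 := (harg.fst.pair (((Feasible.nat 10).pair harg.snd).pair hK)).pair hxx
  have c7 := (harg.fst.pair (((Feasible.nat 11).pair harg).pair hK)).pair hxx
  have c8 := hK.pair (hx2.pair (hx.pair hV2))
  have c9 := hK.pair ((hx2.pair hx).pair hV2)
  have c10 := hx.cond ((harg.fst.pair hK).pair hV) ((harg.snd.pair hK).pair hV)
  have c11 := hx.cond ((harg.snd.pair (((Feasible.nat 7).pair harg).pair hK)).pair hV)
    (hK.pair hV)
  have hall := hk.cond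
    (.ite (htag.eq (.nat 0)) c0 <| .ite (htag.eq (.nat 1)) c1 <| .ite (htag.eq (.nat 2)) c2 <|
     .ite (htag.eq (.nat 3)) c3 <| .ite (htag.eq (.nat 4)) c4 <| .ite (htag.eq (.nat 5)) c5 <|
     .ite (htag.eq (.nat 6)) c6 <| .ite (htag.eq (.nat 7)) c7 <| .ite (htag.eq (.nat 8)) c8 <|
     .ite (htag.eq (.nat 9)) c9 <| .ite (htag.eq (.nat 10)) c10 c11) Feasible.self
  refine hall.congr fun s => ?_
  obtain ⟨K, V⟩ := s
  match K with
  | [] => rfl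
  | i :: K =>
    simp only [Data.ofList_cons, Data.fst_node, Data.snd_node]
    cases i with
    | run p =>
      cases p <;>
        simp [code, Prog.code, encode, step, Data.snd_ofList, fst_ofList]
    | swap => simp [code, encode, step, Data.snd_ofList, fst_ofList]
    | cons => simp [code, encode, step, Data.snd_ofList, fst_ofList]
    | branch f g =>
      simp only [code, encode, step, fst_ofList]
      cases V.headD .nil <;> simp [code, Data.snd_ofList]
    | again c f =>
      simp only [code, encode, step, fst_ofList]
      cases V.headD .nil <;> simp [code, Prog.code, Data.snd_ofList]

/-- The machine gets from `s` to `s'` in `N` steps, through states of size at most `B`. -/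
def Reaches (B N : ℕ) (s s' : Config) : Prop :=
  step^[N] s = s' ∧ ∀ j ≤ N, (encode (step^[j] s)).size ≤ B

theorem Reaches.trans {B N N' : ℕ} {s s' s'' : Config} (h : Reaches B N s s')
    (h' : Reaches B N' s' s'') : Reaches B (N' + N) s s'' := by
  refine ⟨by rw [Function.iterate_add_apply, h.1, h'.1], fun j hj => ?_⟩
  rcases le_total j N with hjN | hjN
  · exact h.2 j hjN
  · obtain ⟨k, rfl⟩ := Nat.exists_eq_add_of_le' hjN
    rw [Function.iterate_add_apply, h.1]
    exact h'.2 k (by omega)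

theorem Reaches.mono {B B' N : ℕ} {s s' : Config} (h : Reaches B N s s') (hB : B ≤ B') :
    Reaches B' N s s' :=
  ⟨h.1, fun j hj => (h.2 j hj).trans hB⟩

theorem Reaches.single {B : ℕ} {s s' : Config} (h : step s = s') (h1 : (encode s).size ≤ B)
    (h2 : (encode s').size ≤ B) : Reaches B 1 s s' := by
  refine ⟨h, fun j hj => ?_⟩
  interval_cases j
  · exact h1
  · simpa [h] using h2

/-- The machine simulates a program. Every subprogram under evaluation occupies space at most
`2 * M + 4 * P + 100`, and there are at most as many of them as the time. -/
theorem reaches_of_runs {p : Prog} {x y : Data} {t : ℕ} (h : Prog.Runs p x y t) {M P : ℕ}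
    (hM : x.size + t ≤ M) (hP : p.code.size ≤ P) (K : List Cmd) (V : List Data) :
    ∃ N ≤ 4 * t, Reaches ((encode (K, V)).size + t * (2 * M + 4 * P + 100)) N
      (run p :: K, x :: V) (K, y :: V) := by
  induction h generalizing K V with
  | id x =>
    have : 1 * (2 * M + 4 * P + 100) ≤ x.size * (2 * M + 4 * P + 100) := by
      gcongr; exact x.size_pos
    refine ⟨1, by have := x.size_pos; omega, .single rfl ?_ ?_⟩
    · simp only [encode, Data.ofList_cons, Data.size_node, code]
      omega
    · simp only [encode, Data.ofList_cons, Data.size_node]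
      omega
  | nil x =>
    refine ⟨1, by omega, .single rfl ?_ ?_⟩
    · simp only [encode, Data.ofList_cons, Data.size_node, code]
      omega
    · simp only [encode, Data.ofList_cons, Data.size_node, Data.size_nil]
      omega
  | fst x =>
    have : 1 * (2 * M + 4 * P + 100) ≤ x.size * (2 * M + 4 * P + 100) := by
      gcongr; exact x.size_pos
    have := x.size_fst_le
    refine ⟨1, by have := x.size_pos; omega, .single rfl ?_ ?_⟩
    · simp only [encode, Data.ofList_cons, Data.size_node, code]
      omega
    · simp only [encode, Data.ofList_cons, Data.size_node]
      omega
  | snd x =>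
    have : 1 * (2 * M + 4 * P + 100) ≤ x.size * (2 * M + 4 * P + 100) := by
      gcongr; exact x.size_pos
    have := x.size_snd_le
    refine ⟨1, by have := x.size_pos; omega, .single rfl ?_ ?_⟩
    · simp only [encode, Data.ofList_cons, Data.size_node, code]
      omega
    · simp only [encode, Data.ofList_cons, Data.size_node]
      omega
  | @pair f g x y z s t hf hg ihf ihg =>
    have hP' := hP
    simp only [Prog.code, Data.size_node] at hP'
    have hy := hf.size_le
    have hz := hg.size_le
    have n8 : (Data.ofNat 8).size = 17 := rfl
    have n9 : (Data.ofNat 9).size = 19 := rfl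
    obtain ⟨N1, hN1, h1⟩ := ihf (by omega) (by omega) (swap :: run g :: cons :: K) (x :: V)
    obtain ⟨N2, hN2, h2⟩ := ihg (by omega) (by omega) (cons :: K) (y :: V)
    set W := 2 * M + 4 * P + 100 with hW
    have e1 : (s + t + 1) * W = s * W + t * W + W := by ring
    have s1 : (encode (swap :: run g :: cons :: K, x :: V)).size ≤ (encode (K, V)).size + W := by
      simp only [encode, Data.ofList_cons, Data.size_node, n8, n9, code, Data.size_nil]; omega
    have s2 : (encode (cons :: K, y :: V)).size ≤ (encode (K, V)).size + W := by
      simp only [encode, Data.ofList_cons, Data.size_node, n9, code, Data.size_nil]; omega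
    have r0 : Reaches ((encode (K, V)).size + (s + t + 1) * W) 1
        (run (.pair f g) :: K, x :: V)
        (run f :: swap :: run g :: cons :: K, x :: x :: V) := by
      refine .single rfl ?_ ((h1.2 0 (by omega)).trans (by omega))
      simp only [encode, Data.ofList_cons, Data.size_node, code]; omega
    have r1 : Reaches ((encode (K, V)).size + (s + t + 1) * W) 1
        (swap :: run g :: cons :: K, y :: x :: V) (run g :: cons :: K, x :: y :: V) := by
      refine .single rfl ?_ ((h2.2 0 (by omega)).trans (by omega))
      have := h1.2 N1 le_rfl
      rw [h1.1] at this
      omega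
    have r2 : Reaches ((encode (K, V)).size + (s + t + 1) * W) 1
        (cons :: K, z :: y :: V) (K, .node y z :: V) := by
      refine .single rfl ?_ ?_
      · have := h2.2 N2 le_rfl
        rw [h2.1] at this
        omega
      · simp only [encode, Data.ofList_cons, Data.size_node]; omega
    exact ⟨_, by omega, (((r0.trans (h1.mono (by omega))).trans r1).trans
      (h2.mono (by omega))).trans r2⟩
  | @comp f g x y z s t hf hg ihf ihg =>
    have hP' := hP
    simp only [Prog.code, Data.size_node] at hP'
    have hy := hf.size_le
    obtain ⟨N1, hN1, h1⟩ := ihf (by omega) (by omega) (run g :: K) V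
    obtain ⟨N2, hN2, h2⟩ := ihg (by omega) (by omega) K V
    set W := 2 * M + 4 * P + 100 with hW
    have e1 : (s + t + 1) * W = s * W + t * W + W := by ring
    have s1 : (encode (run g :: K, V)).size ≤ (encode (K, V)).size + W := by
      simp only [encode, Data.ofList_cons, Data.size_node, code]; omega
    have r0 : Reaches ((encode (K, V)).size + (s + t + 1) * W) 1
        (run (.comp g f) :: K, x :: V) (run f :: run g :: K, x :: V) := by
      refine .single rfl ?_ ((h1.2 0 (by omega)).trans (by omega))
      simp only [encode, Data.ofList_cons, Data.size_node, code]; omega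
    exact ⟨_, by omega, (r0.trans (h1.mono (by omega))).trans (h2.mono (by omega))⟩
  | @cond_true c f g x a b y s t hf hg ihf ihg =>
    have hP' := hP
    simp only [Prog.code, Data.size_node] at hP'
    have n10 : (Data.ofNat 10).size = 21 := rfl
    obtain ⟨N1, hN1, h1⟩ := ihf (by omega) (by omega) (branch f g :: K) (x :: V)
    obtain ⟨N2, hN2, h2⟩ := ihg (by omega) (by omega) K V
    set W := 2 * M + 4 * P + 100 with hW
    have e1 : (s + t + 1) * W = s * W + t * W + W := by ring
    have s1 : (encode (branch f g :: K, x :: V)).size ≤ (encode (K, V)).size + W := by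
      simp only [encode, Data.ofList_cons, Data.size_node, code, n10]; omega
    have r0 : Reaches ((encode (K, V)).size + (s + t + 1) * W) 1
        (run (.cond c f g) :: K, x :: V) (run c :: branch f g :: K, x :: x :: V) := by
      refine .single rfl ?_ ((h1.2 0 (by omega)).trans (by omega))
      simp only [encode, Data.ofList_cons, Data.size_node, code]; omega
    have r1 : Reaches ((encode (K, V)).size + (s + t + 1) * W) 1
        (branch f g :: K, .node a b :: x :: V) (run f :: K, x :: V) := by
      refine .single rfl ?_ ((h2.2 0 (by omega)).trans (by omega))
      have := h1.2 N1 le_rfl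
      rw [h1.1] at this
      omega
    exact ⟨_, by omega, ((r0.trans (h1.mono (by omega))).trans r1).trans (h2.mono (by omega))⟩
  | @cond_false c f g x y s t hf hg ihf ihg =>
    have hP' := hP
    simp only [Prog.code, Data.size_node] at hP'
    have n10 : (Data.ofNat 10).size = 21 := rfl
    obtain ⟨N1, hN1, h1⟩ := ihf (by omega) (by omega) (branch f g :: K) (x :: V)
    obtain ⟨N2, hN2, h2⟩ := ihg (by omega) (by omega) K V
    set W := 2 * M + 4 * P + 100 with hW
    have e1 : (s + t + 1) * W = s * W + t * W + W := by ring
    have s1 : (encode (branch f g :: K, x :: V)).size ≤ (encode (K, V)).size + W := by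
      simp only [encode, Data.ofList_cons, Data.size_node, code, n10]; omega
    have r0 : Reaches ((encode (K, V)).size + (s + t + 1) * W) 1
        (run (.cond c f g) :: K, x :: V) (run c :: branch f g :: K, x :: x :: V) := by
      refine .single rfl ?_ ((h1.2 0 (by omega)).trans (by omega))
      simp only [encode, Data.ofList_cons, Data.size_node, code]; omega
    have r1 : Reaches ((encode (K, V)).size + (s + t + 1) * W) 1
        (branch f g :: K, .nil :: x :: V) (run g :: K, x :: V) := by
      refine .single rfl ?_ ((h2.2 0 (by omega)).trans (by omega))
      have := h1.2 N1 le_rfl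
      rw [h1.1] at this
      omega
    exact ⟨_, by omega, ((r0.trans (h1.mono (by omega))).trans r1).trans (h2.mono (by omega))⟩
  | @loop_done c f x s hc ihc =>
    have hP' := hP
    simp only [Prog.code, Data.size_node] at hP'
    have n11 : (Data.ofNat 11).size = 23 := rfl
    obtain ⟨N1, hN1, h1⟩ := ihc (by omega) (by omega) (again c f :: K) (x :: V)
    set W := 2 * M + 4 * P + 100 with hW
    have e1 : (s + x.size + 1) * W = s * W + x.size * W + W := by ring
    have s1 : (encode (again c f :: K, x :: V)).size ≤ (encode (K, V)).size + W := by
      simp only [encode, Data.ofList_cons, Data.size_node, code, n11]; omega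
    have r0 : Reaches ((encode (K, V)).size + (s + x.size + 1) * W) 1
        (run (.loop c f) :: K, x :: V) (run c :: again c f :: K, x :: x :: V) := by
      refine .single rfl ?_ ((h1.2 0 (by omega)).trans (by omega))
      simp only [encode, Data.ofList_cons, Data.size_node, code]; omega
    have r1 : Reaches ((encode (K, V)).size + (s + x.size + 1) * W) 1
        (again c f :: K, .nil :: x :: V) (K, x :: V) := by
      refine .single rfl ?_ ?_
      · have := h1.2 N1 le_rfl
        rw [h1.1] at this
        omega
      · simp only [encode, Data.ofList_cons, Data.size_node]; omega
    exact ⟨_, by omega, (r0.trans (h1.mono (by omega))).trans r1⟩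
  | @loop_step c f x a b y z s t u hc hf hl ihc ihf ihl =>
    have hP' := hP
    simp only [Prog.code, Data.size_node] at hP'
    have n11 : (Data.ofNat 11).size = 23 := rfl
    have hy := hf.size_le
    obtain ⟨N1, hN1, h1⟩ := ihc (by omega) (by omega) (again c f :: K) (x :: V)
    obtain ⟨N2, hN2, h2⟩ := ihf (by omega) (by omega) (run (.loop c f) :: K) V
    obtain ⟨N3, hN3, h3⟩ := ihl (by omega) (by omega) K V
    set W := 2 * M + 4 * P + 100 with hW
    have e1 : (s + t + u + 1) * W = s * W + t * W + u * W + W := by ring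
    have s1 : (encode (again c f :: K, x :: V)).size ≤ (encode (K, V)).size + W := by
      simp only [encode, Data.ofList_cons, Data.size_node, code, n11]; omega
    have s2 : (encode (run (.loop c f) :: K, V)).size ≤ (encode (K, V)).size + W := by
      simp only [encode, Data.ofList_cons, Data.size_node, code]; omega
    have r0 : Reaches ((encode (K, V)).size + (s + t + u + 1) * W) 1
        (run (.loop c f) :: K, x :: V) (run c :: again c f :: K, x :: x :: V) := by
      refine .single rfl ?_ ((h1.2 0 (by omega)).trans (by omega))
      simp only [encode, Data.ofList_cons, Data.size_node, code]; omega
    have r1 : Reaches ((encode (K, V)).size + (s + t + u + 1) * W) 1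
        (again c f :: K, .node a b :: x :: V) (run f :: run (.loop c f) :: K, x :: V) := by
      refine .single rfl ?_ ((h2.2 0 (by omega)).trans (by omega))
      have := h1.2 N1 le_rfl
      rw [h1.1] at this
      omega
    exact ⟨_, by omega, (((r0.trans (h1.mono (by omega))).trans r1).trans
      (h2.mono (by omega))).trans (h3.mono (by omega))⟩

theorem iterate_step_done (V : List Data) (j : ℕ) : step^[j] ([], V) = ([], V) := by
  induction j with
  | zero => rfl
  | succ j ih => rw [Function.iterate_succ_apply', ih]; rfl

end Cmd

/-- Programs can be interpreted in polynomial time: if `q a` halts on `x a` within time `m a`, then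
its output is computed from its text, its input and the time limit. -/
theorem Feasible.interpret {α : Type} {inp : α → Data} {q : α → Prog} {x y : α → Data}
    {m : α → ℕ} (hrun : ∀ a, (q a).RunsWithin (x a) (y a) (m a))
    (hq : Feasible inp fun a => (q a).code) (hx : Feasible inp x)
    (hm : Feasible inp fun a => .ofNat (m a)) : Feasible inp y := by
  have hkey : ∀ a, ∃ N ≤ 4 * m a, Cmd.Reaches (3 + m a * (2 * ((x a).size + m a)
      + 4 * (q a).code.size + 100)) N ([.run (q a)], [x a]) ([], [y a]) := by
    intro a
    obtain ⟨t, ht, hr⟩ := hrun a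
    obtain ⟨N, hN, h⟩ := Cmd.reaches_of_runs hr (M := (x a).size + m a) (by omega) le_rfl [] []
    refine ⟨N, by omega, h.mono ?_⟩
    have e : (Cmd.encode ([], [])).size = 3 := rfl
    rw [e]
    gcongr
  have hfin : ∀ a, Cmd.step^[4 * m a] ([.run (q a)], [x a]) = ([], [y a]) := by
    intro a
    obtain ⟨N, hN, h⟩ := hkey a
    obtain ⟨k, hk⟩ := Nat.exists_eq_add_of_le' hN
    rw [hk, Function.iterate_add_apply, h.1, Cmd.iterate_step_done]
  have := iterate (σ := fun _ => Cmd.Config) (fun _ => Cmd.encode) (fun a => 4 * m a)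
    (fun a => ([.run (q a)], [x a])) (fun _ => Cmd.step) ((nat 4).mul hm)
    ((hq.pair nil).pair (hx.pair nil)) ?_ ?_
  · exact this.snd.fst.congr fun a => by rw [hfin]; rfl
  · exact Cmd.feasible_step.lift (fun q' : {r : α × ℕ // r.2 < 4 * m r.1} =>
      Cmd.step^[q'.1.2] ([.run (q q'.1.1)], [x q'.1.1])) self.snd
  · obtain ⟨A, hA⟩ := hq.size_le
    obtain ⟨B, hB⟩ := hx.size_le
    obtain ⟨D, hD⟩ := hm.size_le
    refine ⟨3 + D * (2 * (B + D) + 4 * A + 100), fun a i _ => ?_⟩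
    obtain ⟨N, hN, h⟩ := hkey a
    have h1 : (q a).code.size ≤ _ := hA a
    have h2 : (x a).size ≤ _ := hB a
    have h3 : m a ≤ D.eval (inp a).size := by
      have : (Data.ofNat (m a)).size ≤ _ := hD a
      simp only [Data.size_ofNat] at this
      omega
    have hle : (Cmd.encode (Cmd.step^[i] ([.run (q a)], [x a]))).size ≤
        3 + m a * (2 * ((x a).size + m a) + 4 * (q a).code.size + 100) := by
      rcases le_total i N with hi | hi
      · exact h.2 i hi
      · obtain ⟨k, rfl⟩ := Nat.exists_eq_add_of_le' hi
        rw [Function.iterate_add_apply, h.1, Cmd.iterate_step_done, ← h.1]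
        exact h.2 N le_rfl
    refine hle.trans ?_
    simp only [Polynomial.eval_add, Polynomial.eval_mul, Polynomial.eval_ofNat]
    gcongr

/-! ### Tagged integers -/

/-- The natural number with binary digits `s`, then `1`, then the digits of `k` (least significant
digits first). -/
def tagNat (s : List Bool) (k : ℕ) : ℕ := s.foldr Nat.bit (Nat.bit true k)

theorem tagNat_ne_zero (s : List Bool) (k : ℕ) : tagNat s k ≠ 0 := by
  induction s with
  | nil => simp [tagNat]
  | cons b s ih => exact fun h => ih (Nat.bit_eq_zero_iff.1 h).1

theorem bits_tagNat (s : List Bool) (k : ℕ) : (tagNat s k).bits = s ++ true :: k.bits := by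
  induction s with
  | nil => simp [tagNat]
  | cons b s ih =>
    have : tagNat (b :: s) k = Nat.bit b (tagNat s k) := rfl
    rw [this, Nat.bits_append_bit _ _ fun h => absurd h (tagNat_ne_zero s k), ih]
    rfl

theorem tagNat_eq (s : List Bool) (k : ℕ) :
    tagNat s k = 2 ^ (s.length + 1) * k + tagNat s 0 := by
  induction s with
  | nil => simp [tagNat, Nat.bit_val]
  | cons b s ih =>
    have h : ∀ k, tagNat (b :: s) k = 2 * tagNat s k + b.toNat := fun k => by
      show Nat.bit b (tagNat s k) = _
      rw [Nat.bit_val]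
    rw [h, h, ih, List.length_cons]
    ring

theorem size_tagNat_zero (s : List Bool) : (tagNat s 0).size = s.length + 1 := by
  rw [← Nat.size_eq_bits_len, bits_tagNat]
  simp

/-- The integer with the sign of `x` whose absolute value has the binary digits `s`, then `1`, then
those of `|x|`. -/
def tagInt (s : List Bool) (x : ℤ) : ℤ :=
  if x < 0 then -(tagNat s x.natAbs : ℤ) else (tagNat s x.natAbs : ℤ)

theorem tagInt_neg_iff (s : List Bool) (x : ℤ) : tagInt s x < 0 ↔ x < 0 := by
  have := tagNat_ne_zero s x.natAbs
  unfold tagInt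
  split_ifs with h <;> omega

theorem natAbs_tagInt (s : List Bool) (x : ℤ) : (tagInt s x).natAbs = tagNat s x.natAbs := by
  unfold tagInt
  split_ifs <;> simp

theorem tagInt_injective {s s' : List Bool} (hs : s.length = s'.length) {x x' : ℤ}
    (h : tagInt s x = tagInt s' x') : s = s' := by
  have := congrArg (fun z : ℤ => z.natAbs.bits) h
  simp only [natAbs_tagInt, bits_tagNat] at this
  exact List.append_inj_left this hs

/-- On nonnegative integers and on negative integers, adding the tag is an affine map. -/
theorem tagInt_eq (s : List Bool) (x : ℤ) :
    tagInt s x = 2 ^ (s.length + 1) * x + tagNat s 0 ∨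
      tagInt s x = 2 ^ (s.length + 1) * x + -(tagNat s 0 : ℤ) := by
  unfold tagInt
  split_ifs with h
  · right
    rw [tagNat_eq, show x = -(x.natAbs : ℤ) by omega]
    push_cast
    simp
    ring
  · left
    rw [tagNat_eq]
    push_cast
    rw [abs_of_nonneg (by omega)]

/-! ### Stages -/

section Stages

variable {R : Type} [CommRing R]

/-- The `N` variables come in vectors of length `n`, the `q`-th variable being a coordinate of
vector number `(q / n) % n`. At stage `r` the vectors with numbers below `r` keep their values `x`,
and the other ones are unit vectors. Positions from `N` on hold `0`. -/
def stage (N n r : ℕ) (x : ℕ → R) (q : ℕ) : R :=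
  if q < N then
    if q / n % n < r then x q else if q / n % n = q % n then 1 else 0
  else 0

theorem stage_self {N n : ℕ} (hn : 0 < n) (x : ℕ → R) {q : ℕ} (hq : q < N) :
    stage N n n x q = x q := by
  simp [stage, Nat.mod_lt _ hn, hq]

theorem stage_map {S : Type} [CommRing S] (φ : R →+* S) (N n r : ℕ) (x : ℕ → R) (q : ℕ) :
    φ (stage N n r x q) = stage N n r (fun q => φ (x q)) q := by
  unfold stage
  split_ifs <;> simp

theorem stage_congr {N n r : ℕ} {x x' : ℕ → R} (h : ∀ q < N, x q = x' q) :
    stage N n r x = stage N n r x' := by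
  funext q
  unfold stage
  split_ifs with hq
  · exact h q hq
  all_goals rfl

theorem stage_stage {N n r r' : ℕ} (h : r ≤ r') (x : ℕ → R) :
    stage N n r' (stage N n r x) = stage N n r x := by
  funext q
  unfold stage
  split_ifs <;> first | rfl | omega

/-- An integer point as a sequence, padded with zeros. -/
def pad {N : ℕ} (X : Fin N → ℤ) (q : ℕ) : ℤ := (List.ofFn X).getD q 0

theorem pad_val {N : ℕ} (X : Fin N → ℤ) (i : Fin N) : pad X i = X i := by
  rw [pad, List.getD_eq_getElem _ _ (by simp)]
  simp

theorem pad_of_le {N : ℕ} (X : Fin N → ℤ) {q : ℕ} (h : N ≤ q) : pad X q = 0 := by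
  rw [pad, List.getD_eq_default _ _ (by simpa using h)]

/-- The variable number `0` is tagged. -/
def tagged (s : List Bool) (x : ℕ → ℤ) (q : ℕ) : ℤ := if q = 0 then tagInt s (x 0) else x q

/-- The point of stage `r` that belongs to the tagged point `X`. -/
def stagePoint {N : ℕ} (n r : ℕ) (s : List Bool) (X : Fin N → ℤ) (i : Fin N) : ℤ :=
  stage N n r (tagged s (pad X)) i

end Stages

/-! ### Hitting sets for tests -/

namespace Circuit

variable {N : ℕ}

theorem exists_mul (C D : Circuit N) (hC : C.gates ≠ []) (hD : D.gates ≠ []) :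
    ∃ E : Circuit N, E.bitSize = C.bitSize + D.bitSize + 1 ∧
      ∀ {R : Type} [CommRing R] (x : Fin N → R), E.eval x = C.eval x * D.eval x := by
  have hCl := List.length_pos_iff.2 hC
  have hDl := List.length_pos_iff.2 hD
  have hwf := Gate.WF.inline (G := C.gates) C.wf (σ := Gate.var) (fun _ => trivial) D.wf
  set G := C.gates ++ D.gates.map (Gate.inline C.gates.length Gate.var) with hG
  have hGl : G.length = C.gates.length + D.gates.length := by simp [hG]
  have hwf' : Gate.WF (G ++ [.mul (C.gates.length - 1) (G.length - 1)]) :=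
    hwf.concat ⟨by omega, by omega⟩
  refine ⟨⟨_, hwf'⟩, ?_, ?_⟩
  · have h1 := Instr.totalBits_inline D C.gates.length (Gate.var (n := N)) fun _ => rfl
    simp only [Instr.totalBits] at h1
    simp only [bitSize, hG, List.map_append, List.sum_append, h1]
    simp [Gate.bitSize]
  · intro R _ x
    have hrun := Gate.run_inline x x (G := C.gates) (σ := Gate.var) (fun _ => trivial)
      (fun _ => rfl) D.wf
    rw [← hG] at hrun
    have hlast : ∀ l : List R, l.getD (l.length - 1) 0 = l.getLastD 0 := by
      intro l
      rcases List.eq_nil_or_concat l with h | ⟨l, a, h⟩ <;> simp [h]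
    have h1 : (Gate.run x G).getD (C.gates.length - 1) 0 = C.eval x := by
      rw [hrun, List.getD_append _ _ _ _ (by simpa using hCl), eval_eq, ← hlast]
      simp
    have h2 : (Gate.run x G).getD (G.length - 1) 0 = D.eval x := by
      rw [hrun, List.getD_append_right _ _ _ _ (by simp; omega), eval_eq, ← hlast]
      congr 1
      simp
      omega
    have h3 : Gate.run x (G ++ [.mul (C.gates.length - 1) (G.length - 1)]) =
        Gate.run x G ++ [C.eval x * D.eval x] := by
      rw [Gate.run_concat, Gate.value, h1, h2]
    rw [eval_eq, h3]
    simp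

end Circuit

namespace Instr

variable {n N : ℕ}

/-- The nodes for the inputs of a test, where `a * x + b` is substituted for the variable `x` with
number `0`. -/
def stageGate (N n r q : ℕ) : Gate N :=
  if h : q < N then
    if q / n % n < r then if q = 0 then .add 5 0 else .var ⟨q, h⟩
    else if q / n % n = q % n then .const 1 else .const 0
  else .const 0

/-- The nodes that `stageGate` refers to. -/
def affineGates (i : Fin N) (a b : ℤ) : List (Gate N) :=
  [.const 0, .var i, .const a, .mul 1 2, .const b, .add 3 4]

theorem start_stageGate (i : Fin N) (a b : ℤ) (n r : ℕ) :
    Start (affineGates i a b) (stageGate N n r) where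
  head := rfl
  wf := by
    intro p hp
    simp only [affineGates, List.length_cons, List.length_nil] at hp
    interval_cases p <;> simp [affineGates, Gate.Below]
  below q := by
    unfold stageGate
    split_ifs <;> simp [Gate.Below, affineGates]

theorem value_stageGate (i : Fin N) (a b : ℤ) (n r q : ℕ) (X : Fin N → ℤ) :
    (stageGate N n r q).value X (Gate.run X (affineGates i a b)) =
      stage N n r (fun q => if q = 0 then a * X i + b else pad X q) q := by
  unfold stageGate stage
  beta_reduce
  split_ifs with h1 h2 h3 h4
  · simp [Gate.value, Gate.run, affineGates, mul_comm]
  · rw [pad_val X ⟨q, h1⟩]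
    rfl
  all_goals simp [Gate.value]

/-- A test that fails at some point fails at a tagged point of any hitting set for circuits of
suitable size: such a hitting set also hits the product of the two affine substitutions that add
the tag to nonnegative and to negative integers. -/
theorem exists_tagged_ne_zero {n r : ℕ} (C : Circuit N) {m : ℕ} (hC : C.bitSize ≤ m)
    (hN : 0 < N) (t : List Instr) {s : List Bool} (hs : s.length = m) {m' : ℕ}
    (hm' : 2 * (2 * m + 13 + t.length * (m + 6)) + 1 ≤ m') {h : List (Fin N → ℤ)}
    (hh : IsHittingSet N m' h) {x : ℕ → ℤ}
    (hne : result C.eval (stage N n r x) t ≠ 0) :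
    ∃ X ∈ h, result C.eval (stage N n r (tagged s (pad X))) t ≠ 0 := by
  classical
  let i₀ : Fin N := ⟨0, hN⟩
  -- `D b` tests the circuit with `a * X 0 + b` in place of the variable number `0`
  let a : ℤ := 2 ^ (m + 1)
  have ha : a ≠ 0 := by positivity
  -- the test as a polynomial in the variable number `0` alone is not zero
  let p : Polynomial ℤ := result C.eval
    (stage N n r fun q => if q = 0 then Polynomial.X else Polynomial.C (x q)) t
  have hp : ∀ c : ℤ, p.eval c =
      result C.eval (stage N n r fun q => if q = 0 then c else x q) t := by
    intro c
    have := result_map (Polynomial.evalRingHom c) (f := C.eval) (f' := C.eval)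
      (fun y => C.eval_map _ y)
      (stage N n r fun q => if q = 0 then Polynomial.X else Polynomial.C (x q)) t
    rw [Polynomial.coe_evalRingHom] at this
    rw [← this]
    congr 1
    funext q
    have := stage_map (Polynomial.evalRingHom c) N n r
      (fun q => if q = 0 then Polynomial.X else Polynomial.C (x q)) q
    rw [Polynomial.coe_evalRingHom] at this
    rw [this]
    congr 1
    funext q
    split_ifs <;> simp
  have hp0 : p ≠ 0 := by
    intro h0
    apply hne
    have := hp (x 0)
    rw [h0, Polynomial.eval_zero] at this
    rw [this]
    congr 2
    funext q
    split_ifs with hq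
    · rw [hq]
    · rfl
  let D : ℤ → Circuit N := fun b => compile C (start_stageGate i₀ a b n r) t
  have hD : ∀ b (X : Fin N → ℤ), (D b).eval X =
      result C.eval (stage N n r fun q => if q = 0 then a * X i₀ + b else pad X q) t := by
    intro b X
    rw [eval_compile]
    congr 1
    funext q
    exact value_stageGate i₀ a b n r q X
  have hD0 : ∀ b, (D b).poly ≠ 0 := by
    intro b h0
    refine hp0 (Polynomial.eq_zero_of_infinite_isRoot p ?_)
    refine Set.Infinite.mono (s := Set.range fun c : ℤ => a * c + b) ?_
      (Set.infinite_range_of_injective fun c d hcd => ?_)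
    · rintro _ ⟨c, rfl⟩
      have h1 := hD b fun i => if (i : ℕ) = 0 then c else x i
      rw [← Circuit.eval_poly, h0, map_zero] at h1
      rw [Set.mem_ofPred_eq, Polynomial.IsRoot, hp, h1]
      congr 1
      refine stage_congr fun q hqN => ?_
      by_cases hq : q = 0
      · simp [i₀, hq]
      · rw [if_neg hq, if_neg hq]
        have := pad_val (fun i : Fin N => if (i : ℕ) = 0 then c else x i) ⟨q, hqN⟩
        simp only at this
        rw [this, if_neg hq]
    · exact mul_left_cancel₀ ha (add_right_cancel hcd)
  have hsz : ∀ b : ℤ, b.natAbs.size = m + 1 →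
      (D b).bitSize ≤ 2 * m + 13 + t.length * (m + 6) := by
    intro b hb
    refine (bitSize_compile_le C (start_stageGate i₀ a b n r) (B := 3) ?_ t).trans ?_
    · intro q
      unfold stageGate
      split_ifs <;> simp [Gate.bitSize]
    · have h1 : a.natAbs.size = m + 2 := by
        have : a.natAbs = 2 ^ (m + 1) := by simp [a, Int.natAbs_pow]
        rw [this, Nat.size_pow]
      have h2 : totalBits (affineGates i₀ a b) = 2 * m + 12 := by
        simp [totalBits, affineGates, Gate.bitSize, h1, hb]
        omega
      have h3 : t.length * (C.bitSize + 3 + 3) ≤ t.length * (m + 6) := by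
        exact Nat.mul_le_mul_left _ (by omega)
      omega
  have hw : (tagNat s 0).size = m + 1 := by rw [size_tagNat_zero, hs]
  obtain ⟨E, hE, hEval⟩ := Circuit.exists_mul (D (tagNat s 0)) (D (-(tagNat s 0 : ℤ)))
    (by simp [D, compile, compileGates]) (by simp [D, compile, compileGates])
  have h1 := hsz (tagNat s 0) (by simpa using hw)
  have h2 := hsz (-(tagNat s 0 : ℤ)) (by simpa using hw)
  obtain ⟨X, hX, hX0⟩ := hh E (by omega) (by
    rw [Circuit.poly, hEval]
    exact mul_ne_zero (hD0 _) (hD0 _))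
  refine ⟨X, hX, ?_⟩
  rw [hEval] at hX0
  have key : ∀ b, tagInt s (pad X 0) = a * X i₀ + b →
      result C.eval (stage N n r (tagged s (pad X))) t = (D b).eval X := by
    intro b hb
    rw [hD]
    congr 2
    funext q
    unfold tagged
    rw [hb]
  have hp0 : pad X 0 = X i₀ := pad_val X i₀
  rcases tagInt_eq s (pad X 0) with hb | hb
  · rw [key (tagNat s 0) (by rw [hb, hs, hp0])]
    exact left_ne_zero_of_mul hX0
  · rw [key (-(tagNat s 0 : ℤ)) (by rw [hb, hs, hp0])]
    exact right_ne_zero_of_mul hX0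

end Instr

/-! ### Families that can be tested stage by stage -/

/-- The function `F` agrees with the `n`-th polynomial of `f` at all points of stage `r`. -/
def AgreesAt (f : PolyFamily) (n r : ℕ) (F : f.Point n → ℤ) : Prop :=
  ∀ x : ℕ → ℤ, F (fun i => stage (f.vars n) n r x i) = f.value n fun i => stage (f.vars n) n r x i

/-- A downward self-reduction of `f`, as a test for functions `F` that claim to be `f`: the test of
stage `r` compares the value of `F` at a point of stage `r` with values of `F` at points of stage
`r - 1`. If `F` agrees with `f` at stage `r - 1`, then the test of stage `r` is passed at all points
where `F` agrees with `f`, and a polynomial that passes it at all points agrees with `f` at stage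
`r`. -/
structure SelfTest (f : PolyFamily) where
  /-- The test of stage `r` for matrices of size `n`. -/
  test : ℕ → ℕ → List Instr
  vars_pos : ∀ n, 0 < n → 0 < f.vars n
  vars_feasible : Feasible Data.ofNat fun n => Data.ofNat (f.vars n)
  test_feasible : Feasible (α := ℕ × ℕ) (fun a => .node (.ofNat a.1) (.ofNat a.2))
    fun a => .ofList Instr.toData (test a.1 a.2)
  sound : ∀ n r, 0 < r → r ≤ n → ∀ F : f.Point n → ℤ, (1 < r → AgreesAt f n (r - 1) F) →
    ∀ x : ℕ → ℤ, F (fun i => stage (f.vars n) n r x i) =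
      f.value n (fun i => stage (f.vars n) n r x i) →
      Instr.result F (stage (f.vars n) n r x) (test n r) = 0
  complete : ∀ n r, 0 < r → r ≤ n → ∀ P : MvPolynomial (Fin (f.vars n)) ℤ,
    (1 < r → AgreesAt f n (r - 1) fun X => MvPolynomial.eval X P) →
    (∀ x : ℕ → ℤ, Instr.result (fun X => MvPolynomial.eval X P) (stage (f.vars n) n r x)
      (test n r) = 0) →
    AgreesAt f n r fun X => MvPolynomial.eval X P

theorem pad_stagePoint {N : ℕ} (n r : ℕ) (s : List Bool) (X : Fin N → ℤ) :
    pad (stagePoint n r s X) = stage N n r (tagged s (pad X)) := by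
  funext q
  rcases lt_or_ge q N with hq | hq
  · exact pad_val (stagePoint n r s X) ⟨q, hq⟩
  · rw [pad_of_le _ hq, stage, if_neg (by omega)]

/-- At stage `n` all points occur. -/
theorem AgreesAt.eq_of_self {f : PolyFamily} {n : ℕ} (hn : 0 < n)
    {P : MvPolynomial (Fin (f.vars n)) ℤ}
    (h : AgreesAt f n n fun X => MvPolynomial.eval X P) : P = f.poly n := by
  refine MvPolynomial.funext fun X => ?_
  have := h (pad X)
  have e : (fun i : Fin (f.vars n) => stage (f.vars n) n n (pad X) i) = X := by
    funext i
    rw [stage_self hn _ i.2, pad_val]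
  simp only [e] at this
  exact this

namespace SelfTest

variable {f : PolyFamily} (T : SelfTest f)

/-- The candidates for counterexamples that the seed `s` denotes, with their stages in increasing
order: the tagged points of a hitting set `h`, restricted to all stages. -/
def candidates (n : ℕ) (s : List Bool) (h : List (f.Point n)) : List (ℕ × f.Point n) :=
  (List.range n).flatMap fun i => h.map fun X => (i + 1, stagePoint n (i + 1) s X)

/-- A circuit fails the test at a candidate. -/
def fails (n : ℕ) (C : Circuit (f.vars n)) (Y : ℕ × f.Point n) : Bool :=
  decide (Instr.result C.eval (pad Y.2) (T.test n Y.1) ≠ 0)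

/-- The first candidate at which a circuit fails the test (a list with at most one element). -/
def selected (n : ℕ) (s : List Bool) (h : List (f.Point n)) (C : Circuit (f.vars n)) :
    List (f.Point n) :=
  ((candidates n s h).find? (T.fails n C)).toList.map Prod.snd

theorem length_selected_le (n : ℕ) (s : List Bool) (h : List (f.Point n))
    (C : Circuit (f.vars n)) : (T.selected n s h C).length ≤ 1 := by
  unfold selected
  cases (candidates n s h).find? (T.fails n C) <;> simp

theorem selected_subset (n : ℕ) (s : List Bool) (h : List (f.Point n)) (C : Circuit (f.vars n)) :
    T.selected n s h C ⊆ (candidates n s h).map Prod.snd := by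
  intro X hX
  obtain ⟨Y, hY, rfl⟩ := List.mem_map.1 hX
  rw [Option.mem_toList] at hY
  exact List.mem_map_of_mem (List.mem_of_find?_eq_some hY)

theorem mem_candidates {n : ℕ} {s : List Bool} {h : List (f.Point n)} {Y : ℕ × f.Point n} :
    Y ∈ candidates n s h ↔
      0 < Y.1 ∧ Y.1 ≤ n ∧ ∃ X ∈ h, Y.2 = stagePoint n Y.1 s X := by
  simp only [candidates, List.mem_flatMap, List.mem_range, List.mem_map]
  constructor
  · rintro ⟨i, hi, X, hX, rfl⟩
    exact ⟨by simp, hi, X, hX, rfl⟩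
  · rintro ⟨h1, h2, X, hX, h3⟩
    refine ⟨Y.1 - 1, by omega, X, hX, ?_⟩
    rw [show Y.1 - 1 + 1 = Y.1 by omega, ← h3]

theorem pairwise_candidates (n : ℕ) (s : List Bool) (h : List (f.Point n)) :
    (candidates n s h).Pairwise fun Y Z => Y.1 ≤ Z.1 := by
  unfold candidates
  rw [List.pairwise_flatMap]
  constructor
  · intro i _
    rw [List.pairwise_map]
    exact List.Pairwise.imp (fun _ => le_rfl) (List.pairwise_of_forall (R := fun _ _ => True)
      fun _ _ => trivial)
  · refine List.pairwise_lt_range.imp fun {i j} hij => ?_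
    intro Y hY Z hZ
    obtain ⟨X, _, rfl⟩ := List.mem_map.1 hY
    obtain ⟨X', _, rfl⟩ := List.mem_map.1 hZ
    simp only
    omega

/-- At the first stage where a circuit is wrong its test fails at a candidate, and every candidate
of that stage at which the test fails is a counterexample. -/
theorem exists_mem_selected {n m m' : ℕ} (hn : 0 < n) {C : Circuit (f.vars n)}
    (hC : C.bitSize ≤ m) (hne : C.poly ≠ f.poly n) {s : List Bool} (hs : s.length = m)
    (hm' : ∀ r ≤ n, 2 * (2 * m + 13 + (T.test n r).length * (m + 6)) + 1 ≤ m')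
    {h : List (f.Point n)} (hh : IsHittingSet (f.vars n) m' h) :
    ∃ X ∈ T.selected n s h C, C.eval X ≠ f.value n X := by
  classical
  have hev : (fun X => MvPolynomial.eval X C.poly) = C.eval (R := ℤ) := by
    funext X; exact C.eval_poly X
  have hex : ∃ r, 0 < r ∧ ¬ AgreesAt f n r C.eval := by
    refine ⟨n, hn, fun ha => hne ?_⟩
    rw [← hev] at ha
    exact ha.eq_of_self hn
  obtain ⟨hr0, hr1⟩ := Nat.find_spec hex
  have hmin : ∀ r', 0 < r' → r' < Nat.find hex → AgreesAt f n r' C.eval := fun r' h0 h1 => by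
    have := Nat.find_min hex h1
    push Not at this
    exact this h0
  -- `r` is the first stage where the circuit is wrong
  set r := Nat.find hex with hr
  have hrn : r ≤ n := Nat.find_min' hex ⟨hn, fun ha => hne (by
    rw [← hev] at ha
    exact ha.eq_of_self hn)⟩
  have hfail : ∃ x : ℕ → ℤ, Instr.result C.eval (stage (f.vars n) n r x) (T.test n r) ≠ 0 := by
    by_contra hcon
    push Not at hcon
    have := T.complete n r hr0 hrn C.poly
    rw [hev] at this
    exact hr1 (this (fun h1 => hmin _ (by omega) (by omega)) hcon)
  obtain ⟨x, hx⟩ := hfail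
  obtain ⟨X, hX, hX0⟩ := Instr.exists_tagged_ne_zero C hC (T.vars_pos n hn) (T.test n r) hs
    (hm' r hrn) hh hx
  rw [← pad_stagePoint] at hX0
  have hmem : (r, stagePoint n r s X) ∈ candidates n s h :=
    mem_candidates.2 ⟨hr0, hrn, X, hX, rfl⟩
  have hfails : T.fails n C (r, stagePoint n r s X) = true := by
    simpa [fails] using hX0
  obtain ⟨Y, hY⟩ : ∃ Y, (candidates n s h).find? (T.fails n C) = some Y := by
    rw [← Option.isSome_iff_exists, List.find?_isSome]
    exact ⟨_, hmem, hfails⟩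
  have hYf := List.find?_some hY
  have hYc := mem_candidates.1 (List.mem_of_find?_eq_some hY)
  obtain ⟨hY0, hYn, Z, hZ, hYZ⟩ := hYc
  -- candidates are searched by increasing stage, and one of stage `r` fails
  have hYr : Y.1 ≤ r := by
    obtain ⟨_, as, bs, hl, has⟩ := List.find?_eq_some_iff_append.1 hY
    have hp := pairwise_candidates n s h
    rw [hl] at hp hmem
    rcases List.mem_append.1 hmem with h1 | h1
    · have := has _ h1
      rw [hfails] at this
      simp at this
    · rcases List.mem_cons.1 h1 with h1 | h1
      · rw [← h1]
      · exact (List.pairwise_cons.1 (List.pairwise_append.1 hp).2.1).1 _ h1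
  refine ⟨Y.2, by simp [selected, hY], fun heq => ?_⟩
  have hsound := T.sound n Y.1 hY0 hYn C.eval (fun h1 => hmin _ (by omega) (by omega))
    (tagged s (pad Z))
  have e : (fun i : Fin (f.vars n) => stage (f.vars n) n Y.1 (tagged s (pad Z)) i) = Y.2 := by
    rw [hYZ]
    rfl
  rw [e] at hsound
  have h2 := hsound heq
  rw [← pad_stagePoint, ← hYZ] at h2
  simp [fails, h2] at hYf

/-- The variable number `0` belongs to a vector that is kept at every stage, so that the tag can be
read off any candidate. -/
theorem disjoint_candidates {n : ℕ} (hn : 0 < f.vars n) {s s' : List Bool}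
    (hs : s.length = s'.length) (hne : s ≠ s') (h : List (f.Point n)) :
    List.Disjoint ((candidates n s h).map Prod.snd) ((candidates n s' h).map Prod.snd) := by
  intro X hX hX'
  obtain ⟨Y, hY, rfl⟩ := List.mem_map.1 hX
  obtain ⟨Y', hY', h1⟩ := List.mem_map.1 hX'
  obtain ⟨hr0, hrn, Z, _, hZ⟩ := mem_candidates.1 hY
  obtain ⟨hr0', hrn', Z', _, hZ'⟩ := mem_candidates.1 hY'
  have h2 := congrFun (hZ'.symm.trans (h1.trans hZ)) ⟨0, hn⟩
  simp only [stagePoint, stage, tagged, Nat.zero_div, Nat.zero_mod, hn, hr0, hr0', if_true] at h2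
  exact hne (tagInt_injective hs h2.symm)

end SelfTest

namespace Feasible

variable {α : Type} {inp : α → Data}

theorem ofFn_eq_map_range {N : ℕ} (g : ℕ → ℤ) :
    List.ofFn (fun i : Fin N => g i) = (List.range N).map g := by
  apply List.ext_getElem <;> simp

theorem tagInt {s : α → List Bool} {x : α → ℤ} (hs : Feasible inp fun a => .ofBits (s a))
    (hx : Feasible inp fun a => .ofInt (x a)) :
    Feasible inp fun a => .ofInt (tagInt (s a) (x a)) := by
  refine (hx.fst.pair (append (β := fun _ => Bool) (enc := fun _ => Data.ofBool)
    (l' := fun a => true :: (x a).natAbs.bits) hs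
    ((const (.ofBool true)).pair hx.snd))).congr fun a => ?_
  simp only [Data.ofInt, natAbs_tagInt, bits_tagNat, tagInt_neg_iff, Data.fst_node]

theorem stagePoint {N n r : α → ℕ} {s : α → List Bool} {X : ∀ a, Fin (N a) → ℤ}
    (hN : Feasible inp fun a => .ofNat (N a)) (hn : Feasible inp fun a => .ofNat (n a))
    (hr : Feasible inp fun a => .ofNat (r a)) (hs : Feasible inp fun a => .ofBits (s a))
    (hX : Feasible inp fun a => .ofPoint (X a)) :
    Feasible inp fun a => .ofPoint (stagePoint (n a) (r a) (s a) (X a)) := by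
  have key := map (β := fun _ => ℕ) (fun _ => Data.ofNat) (fun a => List.range (N a))
    (fun a q => .ofInt (stage (N a) (n a) (r a) (tagged (s a) (pad (X a))) q)) (range hN) ?_
  · refine key.congr fun a => ?_
    rw [Data.ofPoint, ← Data.ofList_map, ← ofFn_eq_map_range]
    rfl
  · let g : Member (fun a => List.range (N a)) → α := fun q => q.1.1
    have hn' := hn.lift g (env := fun q => .node (inp q.1.1) (.ofNat q.1.2)) self.fst
    have hr' := hr.lift g (env := fun q => .node (inp q.1.1) (.ofNat q.1.2)) self.fst
    have hs' := hs.lift g (env := fun q => .node (inp q.1.1) (.ofNat q.1.2)) self.fst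
    have hX' := hX.lift g (env := fun q => .node (inp q.1.1) (.ofNat q.1.2)) self.fst
    have hq : Feasible (fun q : Member fun a => List.range (N a) =>
      .node (inp q.1.1) (.ofNat q.1.2)) fun q => .ofNat q.1.2 := self.snd
    have hget := fun {k : Member (fun a => List.range (N a)) → ℕ} => getD (β := fun _ => ℤ)
      (enc := fun _ => Data.ofInt) (l := fun q => List.ofFn (X (g q))) (i := k) (d := fun _ => 0)
      hX'
    refine (ite (lt (mod (div hq hn') hn') hr')
      (ite (eq hq (nat 0)) (tagInt hs' (hget (nat 0) (const (.ofInt 0))))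
        (hget hq (const (.ofInt 0))))
      (ite (eq (mod (div hq hn') hn') (mod hq hn')) (const (.ofInt 1))
        (const (.ofInt 0)))).congr fun q => ?_
    have hlt : q.1.2 < N q.1.1 := List.mem_range.1 q.2
    simp only [stage, hlt, if_true, decide_eq_true_eq, tagged, pad, g]
    split_ifs <;> rfl

/-- A candidate as a datum. -/
abbrev encCandidate {N : ℕ} (Y : ℕ × (Fin N → ℤ)) : Data := .node (.ofNat Y.1) (.ofPoint Y.2)

theorem candidatesAt {f : PolyFamily} {n r : α → ℕ} {s : α → List Bool}
    {h : ∀ a, List (f.Point (n a))} (hN : Feasible inp fun a => .ofNat (f.vars (n a)))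
    (hn : Feasible inp fun a => .ofNat (n a)) (hr : Feasible inp fun a => .ofNat (r a))
    (hs : Feasible inp fun a => .ofBits (s a)) (hh : Feasible inp fun a => .ofPoints (h a)) :
    Feasible inp fun a => .ofList encCandidate
      ((h a).map fun X => (r a, _root_.stagePoint (n a) (r a) (s a) X)) := by
  let enc : ∀ a, f.Point (n a) → Data := fun _ => Data.ofPoint
  refine (map enc h
    (fun a X => encCandidate (r a, _root_.stagePoint (n a) (r a) (s a) X)) hh ?_).congr
    fun a => (Data.ofList_map _ _ _).symm
  have hr' := hr.weaken enc h
  exact hr'.pair (stagePoint (hN.weaken enc h) (hn.weaken enc h) hr' (hs.weaken enc h) self.snd)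

theorem candidates {f : PolyFamily} (T : SelfTest f) {n : α → ℕ} {s : α → List Bool}
    {h : ∀ a, List (f.Point (n a))} (hn : Feasible inp fun a => .ofNat (n a))
    (hs : Feasible inp fun a => .ofBits (s a)) (hh : Feasible inp fun a => .ofPoints (h a)) :
    Feasible inp fun a => .ofList encCandidate (SelfTest.candidates (n a) (s a) (h a)) := by
  have hN : Feasible inp fun a => .ofNat (f.vars (n a)) := T.vars_feasible.lift n hn
  let enc : α → ℕ → Data := fun _ => Data.ofNat
  let l : α → List ℕ := fun a => List.range (n a)
  refine flatMap (γ := fun a => ℕ × f.Point (n a)) enc l (fun _ => encCandidate)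
    (fun a i => (h a).map fun X => (i + 1, _root_.stagePoint (n a) (i + 1) (s a) X)) (range hn) ?_
  have hi : Feasible (α := Member l) (fun q => .node (inp q.1.1) (enc q.1.1 q.1.2))
    fun q => .ofNat q.1.2 := self.snd
  exact candidatesAt (hN.weaken enc l) (hn.weaken enc l) (hi.add (nat 1)) (hs.weaken enc l)
    (hh.weaken enc l)

theorem selected
    (hPIT : PolyTime (α := Σ n : ℕ, Circuit n) (fun _ => True)
      (fun a => .node (.ofNat a.1) a.2.toData) (fun a => .ofProp (a.2.poly = 0))
      (fun a => a.1 + a.2.bitSize))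
    {f : PolyFamily} (T : SelfTest f) {n : α → ℕ} {s : α → List Bool}
    {h : ∀ a, List (f.Point (n a))} {C : ∀ a, Circuit (f.vars (n a))}
    (hn : Feasible inp fun a => .ofNat (n a)) (hs : Feasible inp fun a => .ofBits (s a))
    (hh : Feasible inp fun a => .ofPoints (h a)) (hC : Feasible inp fun a => (C a).toData) :
    Feasible inp fun a => .ofPoints (T.selected (n a) (s a) (h a) (C a)) := by
  have hN : Feasible inp fun a => .ofNat (f.vars (n a)) := T.vars_feasible.lift n hn
  let enc : ∀ a, ℕ × f.Point (n a) → Data := fun _ => encCandidate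
  let l : ∀ a, List (ℕ × f.Point (n a)) := fun a => SelfTest.candidates (n a) (s a) (h a)
  have hfind := find enc l (fun a => T.fails (n a) (C a)) (candidates T hn hs hh) ?_
  · exact (map enc (fun a => ((l a).find? (T.fails (n a) (C a))).toList)
      (fun _ Y => .ofPoint Y.2) hfind self.snd.snd).congr fun a => (Data.ofList_map _ _ _).symm
  · have hY : Feasible (α := Member l) (fun q => .node (inp q.1.1) (enc q.1.1 q.1.2))
      fun q => .ofList Data.ofInt (List.ofFn q.1.2.2) := self.snd.snd
    have hr : Feasible (α := Member l) (fun q => .node (inp q.1.1) (enc q.1.1 q.1.2))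
      fun q => .ofNat q.1.2.1 := self.snd.fst
    have ht := T.test_feasible.lift (fun q : Member l => (n q.1.1, q.1.2.1))
      ((hn.weaken enc l).pair hr)
    exact result_ne_zero hPIT (hN.weaken enc l) (C := fun q : Member l => C q.1.1)
      (hC.weaken enc l) hY ht

end Feasible

/-! ### Texts determine circuits -/

namespace Data

theorem ofNat_injective : Function.Injective ofNat := by
  intro a b h
  have := congrArg size h
  simp at this
  exact this

theorem ofBool_injective : Function.Injective ofBool := by
  intro a b h
  cases a <;> cases b <;> simp_all [ofBool]

theorem ofList_injective {α : Type} {e : α → Data} (he : Function.Injective e) :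
    Function.Injective (ofList e) := by
  intro l
  induction l with
  | nil => intro l' h; cases l' <;> simp_all
  | cons a l ih =>
    intro l' h
    cases l' with
    | nil => simp at h
    | cons b l' =>
      simp only [ofList_cons, node.injEq] at h
      rw [he h.1, ih h.2]

theorem ofInt_injective : Function.Injective ofInt := by
  intro a b h
  simp only [ofInt, node.injEq] at h
  have h1 := ofBool_injective h.1
  have h2 : a.natAbs = b.natAbs := by
    have := ofList_injective ofBool_injective h.2
    have hc := congrArg (fun l : List Bool => l.foldr Nat.bit 0) this
    have hb : ∀ n : ℕ, n.bits.foldr Nat.bit 0 = n := by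
      intro n
      induction n using Nat.binaryRec' with
      | zero => simp
      | bit b n hn ih => rw [Nat.bits_append_bit _ _ hn, List.foldr_cons, ih]
    simpa only [hb] using hc
  rw [decide_eq_decide] at h1
  omega

end Data

theorem Gate.toData_injective {n : ℕ} : Function.Injective (Gate.toData (n := n)) := by
  intro g g' h
  have h01 : ∀ {a b : ℕ}, Data.ofNat a = Data.ofNat b → a = b := fun h => Data.ofNat_injective h
  cases g <;> cases g' <;> simp only [Gate.toData, Data.node.injEq] at h <;>
    first
    | exact absurd (h01 h.1) (by omega)
    | skip
  · rw [Fin.ext (h01 h.2)]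
  · rw [Data.ofInt_injective h.2]
  · rw [h01 h.2.1, h01 h.2.2]
  · rw [h01 h.2.1, h01 h.2.2]

theorem Circuit.toData_injective {n : ℕ} : Function.Injective (Circuit.toData (n := n)) := by
  rintro ⟨G, hG⟩ ⟨G', hG'⟩ h
  have : G = G' := Data.ofList_injective Gate.toData_injective h
  subst this
  rfl

/-! ### From self-reductions to explicit proofs -/

/-- An implication that holds for all sufficiently large `n` transfers both senses of an asymptotic
lower bound. -/
theorem Sense.Holds.mono {κ : Sense} {P Q : ℕ → Prop} (h : κ.Holds P)
    (hPQ : ∀ᶠ n in Filter.atTop, P n → Q n) : κ.Holds Q := by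
  cases κ with
  | almostAll => exact Filter.Eventually.mp h hPQ
  | infinitelyMany => exact Filter.Frequently.mp h hPQ

theorem Data.size_ofBits_le (s : List Bool) : (Data.ofBits s).size ≤ 4 * s.length + 1 := by
  have hb : ∀ b, (Data.ofBool b).size ≤ 3 := by intro b; cases b <;> simp [Data.ofBool]
  have := Data.size_ofList_le Data.ofBool s (B := 3) fun b _ => hb b
  rw [Data.ofBits]
  omega

theorem Data.ofBits_replicate (m : ℕ) : Data.ofBits (List.replicate m false) = Data.ofNat m := by
  induction m with
  | zero => rfl
  | succ m ih =>
    rw [List.replicate_succ]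
    show Data.node _ (Data.ofBits _) = _
    rw [ih]
    rfl

namespace SelfTest

variable {f : PolyFamily}

/-- Hitting sets for circuits of bit size `(n + m + 2) ^ c` serve for the tests of circuits of bit
size `m`. -/
theorem exists_bound (T : SelfTest f) : ∃ c : ℕ, ∀ n m, ∀ r ≤ n,
    2 * (2 * m + 13 + (T.test n r).length * (m + 6)) + 1 ≤ (n + m + 2) ^ c := by
  obtain ⟨P, hP⟩ := T.test_feasible.size_le
  obtain ⟨c, hc⟩ := (2 * (2 * Polynomial.X + 13 +
    P.comp (4 * Polynomial.X + 3) * (Polynomial.X + 6)) + 1 : Polynomial ℕ).exists_eval_le_pow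
  refine ⟨c, fun n m r hr => le_trans ?_ (hc (n + m))⟩
  have h1 : (Data.ofList Instr.toData (T.test n r)).size ≤ P.eval (4 * (n + m) + 3) := by
    refine (hP (n, r)).trans (P.eval_mono_nat ?_)
    simp only [Data.size_node, Data.size_ofNat]
    omega
  have h2 := Data.length_le_size_ofList Instr.toData (T.test n r)
  have h3 : (T.test n r).length * (m + 6) ≤ P.eval (4 * (n + m) + 3) * (n + m + 6) := by
    gcongr <;> omega
  simp only [Polynomial.eval_add, Polynomial.eval_mul, Polynomial.eval_comp, Polynomial.eval_X,
    Polynomial.eval_ofNat, Polynomial.eval_one]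
  omega

/-- Identity testing in polynomial time, as in `BlackBoxPITDerandomized`. -/
abbrev _root_.PITPolyTime : Prop :=
  PolyTime (α := Σ n : ℕ, Circuit n) (fun _ => True)
    (fun a => .node (.ofNat a.1) a.2.toData) (fun a => .ofProp (a.2.poly = 0))
    (fun a => a.1 + a.2.bitSize)

/-- Hitting sets `hit n m` that are computed in polynomial time and are large enough for the tests
of circuits of bit size `m`. -/
structure IsSource (T : SelfTest f) (hit : ∀ n : ℕ, ℕ → List (f.Point n)) : Prop where
  hits : ∀ n m, ∃ m', (∀ r ≤ n, 2 * (2 * m + 13 + (T.test n r).length * (m + 6)) + 1 ≤ m') ∧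
    IsHittingSet (f.vars n) m' (hit n m)
  feasible : Feasible (α := ℕ × ℕ) (fun a => .node (.ofNat a.1) (.ofNat a.2))
    fun a => .ofPoints (hit a.1 a.2)

theorem exists_isSource (T : SelfTest f) (hBB : BlackBoxPITDerandomized) :
    ∃ hit, T.IsSource hit := by
  obtain ⟨_, H, hH⟩ := hBB
  obtain ⟨h, hmem, hconstr⟩ := hH.construct
  obtain ⟨c, hc⟩ := T.exists_bound
  refine ⟨fun n m => h (f.vars n) ((n + m + 2) ^ c),
    fun n m => ⟨_, hc n m, hH.hits _ _ _ (hmem _ _)⟩, ?_⟩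
  have h1 := hconstr.feasible Polynomial.X fun a _ => by
    simp only [Data.size_node, Data.size_ofNat, Polynomial.eval_X]
    omega
  have hn : Feasible (α := ℕ × ℕ) (fun a => .node (.ofNat a.1) (.ofNat a.2))
    fun a => .ofNat a.1 := Feasible.self.fst
  have hm : Feasible (α := ℕ × ℕ) (fun a => .node (.ofNat a.1) (.ofNat a.2))
    fun a => .ofNat a.2 := Feasible.self.snd
  exact h1.lift (fun a : ℕ × ℕ => ⟨(f.vars a.1, (a.1 + a.2 + 2) ^ c), trivial⟩)
    ((T.vars_feasible.lift _ hn).pair (((hn.add hm).add (.nat 2)).pow c))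

theorem exists_size_toData_le (T : SelfTest f) : ∃ Q : Polynomial ℕ,
    ∀ n (C : Circuit (f.vars n)), C.toData.size ≤ Q.eval (n + C.bitSize) := by
  obtain ⟨P, hP⟩ := T.vars_feasible.size_le
  refine ⟨Polynomial.X * (4 * (P.comp (2 * Polynomial.X + 1) + Polynomial.X) + 20 + 1) + 1,
    fun n C => C.size_toData_le.trans ?_⟩
  have h1 : f.vars n ≤ P.eval (2 * (n + C.bitSize) + 1) := by
    have h2 := hP n
    have h3 : P.eval (Data.ofNat n).size ≤ P.eval (2 * (n + C.bitSize) + 1) :=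
      P.eval_mono_nat (by simp only [Data.size_ofNat]; omega)
    simp only [Data.size_ofNat] at h2 h3
    omega
  simp only [Polynomial.eval_add, Polynomial.eval_mul, Polynomial.eval_comp, Polynomial.eval_X,
    Polynomial.eval_ofNat, Polynomial.eval_one]
  gcongr <;> omega

variable {hit : ∀ n : ℕ, ℕ → List (f.Point n)}

theorem IsSource.counterexample {T : SelfTest f} (hT : T.IsSource hit) {κ : Sense}
    (hf : UniformlyHard κ f) (C : ∀ n, Circuit (f.vars n)) (hC : IsUniform C) :
    κ.Holds fun n => ∀ m, (C n).bitSize ≤ m → ∀ s : List Bool, s.length = m →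
      ∃ X ∈ T.selected n s (hit n m) (C n), (C n).eval X ≠ f.value n X := by
  refine (hf C hC).mono ?_
  filter_upwards [Filter.eventually_gt_atTop 0] with n hn hne m hm s hs
  obtain ⟨m', hm', hh⟩ := hT.hits n m
  exact T.exists_mem_selected hn hm hne hs hm' hh

theorem IsSource.decode {T : SelfTest f} (hT : T.IsSource hit) :
    PolyTime (α := ℕ × ℕ × List Bool) (fun a => a.2.2 ∈ {s : List Bool | s.length = a.2.1})
      (fun a => .node (.ofNat a.1) (.node (.ofNat a.2.1) (.ofBits a.2.2)))
      (fun a => .ofPoints ((candidates a.1 a.2.2 (hit a.1 a.2.1)).map Prod.snd))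
      (fun a => a.1 + a.2.1 + a.2.2.length) := by
  refine Feasible.polyTime ?_ (6 * Polynomial.X + 10) fun a _ => ?_
  · let α := {a : ℕ × ℕ × List Bool // a.2.2 ∈ {s : List Bool | s.length = a.2.1}}
    let inp : α → Data := fun a =>
      .node (.ofNat a.1.1) (.node (.ofNat a.1.2.1) (.ofBits a.1.2.2))
    have hn : Feasible inp fun a => .ofNat a.1.1 := Feasible.self.fst
    have hm : Feasible inp fun a => .ofNat a.1.2.1 := Feasible.self.snd.fst
    have hs : Feasible inp fun a => .ofBits a.1.2.2 := Feasible.self.snd.snd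
    have hh := hT.feasible.lift (fun a : α => (a.1.1, a.1.2.1)) (hn.pair hm)
    have hcand := Feasible.candidates T hn hs hh
    let l : ∀ a : α, List (ℕ × f.Point a.1.1) := fun a =>
      candidates a.1.1 a.1.2.2 (hit a.1.1 a.1.2.1)
    exact (Feasible.map (fun _ => Feasible.encCandidate) l (fun _ Y => .ofPoint Y.2) hcand
      Feasible.self.snd.snd).congr fun a => (Data.ofList_map _ _ _).symm
  · have := Data.size_ofBits_le a.2.2
    simp only [Data.size_node, Data.size_ofNat, Polynomial.eval_add, Polynomial.eval_mul,
      Polynomial.eval_X, Polynomial.eval_ofNat]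
    omega

theorem IsSource.select {T : SelfTest f} (hT : T.IsSource hit) (hPIT : PITPolyTime) :
    PolyTime (α := Σ n : ℕ, ℕ × List Bool × Circuit (f.vars n))
      (fun a => a.2.2.1 ∈ {s : List Bool | s.length = a.2.1} ∧ a.2.2.2.bitSize ≤ a.2.1)
      (fun a => .node (.ofNat a.1) (.node (.ofNat a.2.1)
        (.node (.ofBits a.2.2.1) a.2.2.2.toData)))
      (fun a => .ofPoints (T.selected a.1 a.2.2.1 (hit a.1 a.2.1) a.2.2.2))
      (fun a => a.1 + a.2.1 + a.2.2.1.length) := by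
  obtain ⟨Q, hQ⟩ := T.exists_size_toData_le
  refine Feasible.polyTime ?_ (6 * Polynomial.X + 10 + Q.comp (2 * Polynomial.X))
    fun a ha => ?_
  · let α := {a : Σ n : ℕ, ℕ × List Bool × Circuit (f.vars n) //
      a.2.2.1 ∈ {s : List Bool | s.length = a.2.1} ∧ a.2.2.2.bitSize ≤ a.2.1}
    let inp : α → Data := fun a => .node (.ofNat a.1.1) (.node (.ofNat a.1.2.1)
      (.node (.ofBits a.1.2.2.1) a.1.2.2.2.toData))
    have hn : Feasible inp fun a => .ofNat a.1.1 := Feasible.self.fst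
    have hm : Feasible inp fun a => .ofNat a.1.2.1 := Feasible.self.snd.fst
    have hs : Feasible inp fun a => .ofBits a.1.2.2.1 := Feasible.self.snd.snd.fst
    have hC : Feasible inp fun a => a.1.2.2.2.toData := Feasible.self.snd.snd.snd
    have hh := hT.feasible.lift (fun a : α => (a.1.1, a.1.2.1)) (hn.pair hm)
    exact Feasible.selected hPIT T (h := fun a : α => hit a.1.1 a.1.2.1)
      (C := fun a : α => a.1.2.2.2) hn hs hh hC
  · have h1 := Data.size_ofBits_le a.2.2.1
    have h2 := hQ a.1 a.2.2.2
    have h3 := Q.eval_mono_nat (show a.1 + a.2.2.2.bitSize ≤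
      2 * (a.1 + a.2.1 + a.2.2.1.length) by have := ha.2; omega)
    simp only [Data.size_node, Data.size_ofNat, Polynomial.eval_add, Polynomial.eval_mul,
      Polynomial.eval_X, Polynomial.eval_ofNat, Polynomial.eval_comp]
    omega

theorem verify_length :
    PolyTime (α := ℕ × ℕ × List Bool) (fun _ => True)
      (fun a => .node (.ofNat a.1) (.node (.ofNat a.2.1) (.ofBits a.2.2)))
      (fun a => .ofProp (a.2.2 ∈ {s : List Bool | s.length = a.2.1}))
      (fun a => a.1 + a.2.1 + a.2.2.length) := by
  refine Feasible.polyTime ?_ (6 * Polynomial.X + 10) fun a _ => ?_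
  · let inp : {a : ℕ × ℕ × List Bool // True} → Data := fun a =>
      .node (.ofNat a.1.1) (.node (.ofNat a.1.2.1) (.ofBits a.1.2.2))
    have hs : Feasible inp fun a => .ofBits a.1.2.2 := Feasible.self.snd.snd
    have hm : Feasible inp fun a => .ofNat a.1.2.1 := Feasible.self.snd.fst
    refine ((Feasible.length (β := fun _ => Bool) (enc := fun _ => Data.ofBool) hs).eq
      hm).congr fun a => ?_
    by_cases he : a.1.2.2.length = a.1.2.1
    · rw [decide_eq_true he, Data.ofProp, if_pos (by exact he)]
      rfl
    · rw [decide_eq_false he, Data.ofProp, if_neg (by exact he)]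
      rfl
  · have := Data.size_ofBits_le a.2.2
    simp only [Data.size_node, Data.size_ofNat, Polynomial.eval_add, Polynomial.eval_mul,
      Polynomial.eval_X, Polynomial.eval_ofNat]
    omega

theorem construct_replicate :
    PolyTime (α := ℕ × ℕ) (fun _ => True) (fun a => .node (.ofNat a.1) (.ofNat a.2))
      (fun a => .ofBits (List.replicate a.2 false)) (fun a => a.1 + a.2) := by
  refine Feasible.polyTime ?_ (2 * Polynomial.X + 3) fun a _ => ?_
  · exact Feasible.self.snd.congr fun a => (Data.ofBits_replicate _).symm
  · simp only [Data.size_node, Data.size_ofNat, Polynomial.eval_add, Polynomial.eval_mul,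
      Polynomial.eval_X, Polynomial.eval_ofNat]
    omega

/-- The obstructions are the seeds: all bit strings of length `m`. Every seed denotes the points of
the same hitting set, tagged by the seed and restricted to all stages; different seeds denote
disjoint sets. -/
theorem IsSource.isUniformFlip {T : SelfTest f} (hT : T.IsSource hit) (hPIT : PITPolyTime)
    {κ : Sense} (hf : UniformlyHard κ f) :
    IsUniformFlip κ f (fun _ m => {s | s.length = m})
      (fun n m s => (candidates n s (hit n m)).map Prod.snd)
      (fun n m s C => T.selected n s (hit n m) C) where
  short := ⟨1, fun n m => ⟨List.replicate m false, by simp, by simp; omega⟩⟩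
  small := by
    obtain ⟨p, e, hp⟩ := hT.decode
    refine ⟨e, fun n m s hs => ?_⟩
    have h1 := (hp (n, m, s) hs).size_le
    have h2 := Data.length_le_size_ofList Data.ofPoint
      ((candidates n s (hit n m)).map Prod.snd)
    simp only [Data.ofPoints] at h1
    omega
  obstructs C hC := by
    refine (hT.counterexample hf C hC).mono
      (Filter.Eventually.of_forall fun n hn m hm s hs => ?_)
    obtain ⟨X, hX, hne⟩ := hn m hm s hs
    exact ⟨X, T.selected_subset n s _ _ hX, hne⟩
  decode := hT.decode
  select_subset n m s _ C _ := T.selected_subset n s _ C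
  select_small := ⟨1, fun n m s _ C _ => T.length_selected_le n s _ C⟩
  select_time := hT.select hPIT
  select_counterexample := hT.counterexample hf
  rich := by
    classical
    refine ⟨1, one_pos, 1, 1, fun n m hn hm => ⟨Finset.univ.image (fun v : List.Vector Bool m =>
      v.toList), ?_, ?_, ?_⟩⟩
    · intro s hs
      obtain ⟨v, _, rfl⟩ := Finset.mem_image.1 hs
      exact ⟨v.toList_length, by rw [v.toList_length, pow_one]; omega⟩
    · rw [Finset.card_image_of_injective _ List.Vector.toList_injective, Finset.card_univ,
        card_vector, one_mul, Real.rpow_natCast]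
      simp
    · intro s hs s' hs' hne
      obtain ⟨v, _, rfl⟩ := Finset.mem_image.1 hs
      obtain ⟨v', _, rfl⟩ := Finset.mem_image.1 hs'
      exact disjoint_candidates (T.vars_pos n hn) (by simp) hne _
  verify := verify_length
  construct := ⟨fun _ m => List.replicate m false, fun n m => by simp, construct_replicate⟩

open Classical in
/-- The counterexample against the circuit that `q` generates at size `n` within time `m`, selected
with the seed that consists of zeros (empty if `q` does not write down a circuit in that time). -/
noncomputable def diagonal (T : SelfTest f) (hit : ∀ n : ℕ, ℕ → List (f.Point n)) (n m : ℕ)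
    (q : Prog) : List (f.Point n) :=
  if hq : ∃ C : Circuit (f.vars n), q.RunsWithin (.ofNat n) C.toData m then
    T.selected n (List.replicate m false) (hit n m) hq.choose
  else []

theorem diagonal_eq (T : SelfTest f) {n m : ℕ} {q : Prog} {C : Circuit (f.vars n)}
    (hq : q.RunsWithin (.ofNat n) C.toData m) :
    T.diagonal hit n m q = T.selected n (List.replicate m false) (hit n m) C := by
  have hex : ∃ C : Circuit (f.vars n), q.RunsWithin (.ofNat n) C.toData m := ⟨C, hq⟩
  obtain ⟨t, _, h1⟩ := hex.choose_spec
  obtain ⟨t', _, h2⟩ := hq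
  rw [diagonal, dif_pos hex, Circuit.toData_injective (h1.deterministic h2)]

theorem IsSource.efficientDiagonalization {T : SelfTest f} (hT : T.IsSource hit)
    (hPIT : PITPolyTime) {κ : Sense} (hf : UniformlyHard κ f) : EfficientDiagonalization κ f := by
  refine ⟨T.diagonal hit, ⟨1, fun n m q => ?_⟩, ?_, ?_⟩
  · unfold diagonal
    split_ifs
    · exact T.length_selected_le _ _ _ _
    · simp
  · refine Feasible.polyTime ?_ (6 * Polynomial.X + 10) fun a _ => ?_
    · let α := {a : ℕ × ℕ × Prog // ∃ C : Circuit (f.vars a.1),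
        a.2.2.RunsWithin (.ofNat a.1) C.toData a.2.1}
      let inp : α → Data := fun a => .node (.ofNat a.1.1) (.node (.ofNat a.1.2.1) a.1.2.2.code)
      have hn : Feasible inp fun a => .ofNat a.1.1 := Feasible.self.fst
      have hm : Feasible inp fun a => .ofNat a.1.2.1 := Feasible.self.snd.fst
      have hs : Feasible inp fun a => .ofBits (List.replicate a.1.2.1 false) :=
        hm.congr fun a => (Data.ofBits_replicate _).symm
      have hC : Feasible inp fun a => a.2.choose.toData :=
        Feasible.interpret (fun a : α => a.2.choose_spec) Feasible.self.snd.snd hn hm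
      have hh := hT.feasible.lift (fun a : α => (a.1.1, a.1.2.1)) (hn.pair hm)
      exact (Feasible.selected hPIT T (h := fun a : α => hit a.1.1 a.1.2.1)
        (C := fun a : α => a.2.choose) hn hs hh hC).congr fun a => by
          rw [diagonal_eq T a.2.choose_spec]
    · simp only [Data.size_node, Data.size_ofNat, Polynomial.eval_add, Polynomial.eval_mul,
        Polynomial.eval_X, Polynomial.eval_ofNat]
      omega
  · -- the output of `q` is written down in the running time, which thus bounds the bit size
    intro q C hq
    refine (hT.counterexample hf C ⟨q, hq⟩).mono (Filter.Eventually.of_forall fun n hn m hm => ?_)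
    rw [diagonal_eq T hm]
    exact hn m ((C n).bitSize_le_size_toData.trans hm.size_le) _ (by simp)

/-- A family with a downward self-reduction has an explicit proof of its uniform hardness. -/
theorem hasExplicitProof_and_efficientDiagonalization (T : SelfTest f) {κ : Sense}
    (hBB : BlackBoxPITDerandomized) (hf : UniformlyHard κ f) :
    HasExplicitProof κ f ∧ EfficientDiagonalization κ f := by
  obtain ⟨hit, hT⟩ := T.exists_isSource hBB
  exact ⟨⟨_, _, _, hT.isUniformFlip hBB.1 hf⟩, hT.efficientDiagonalization hBB.1 hf⟩

end SelfTest

/-! ### Stack programs for arithmetic expressions -/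

namespace Instr

variable {n : ℕ} {R : Type} [CommRing R] {f : (Fin n → R) → R} {y : ℕ → R}

/-- The stack program `t` computes the value `v`: its effect is to push `v`. -/
def Yields (f : (Fin n → R) → R) (y : ℕ → R) (t : List Instr) (v : R) : Prop :=
  ∀ st, exec f y t st = v :: st

theorem Yields.result_eq {t : List Instr} {v : R} (h : Yields f y t v) : result f y t = v := by
  simp [result, h []]

theorem yields_inp (i : ℕ) : Yields f y [.inp i] (y i) := fun _ => rfl

theorem yields_one : Yields f y [.one] 1 := fun _ => rfl

/-- Pushes `0`. -/
def zeroProg : List Instr := [.one, .negOne, .add]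

theorem yields_zero : Yields f y zeroProg 0 := fun st => by simp [zeroProg, step]

/-- Pushes the product. -/
def mulProg (t t' : List Instr) : List Instr := t ++ t' ++ [.mul]

theorem Yields.mul {t t' : List Instr} {v v' : R} (h : Yields f y t v) (h' : Yields f y t' v') :
    Yields f y (mulProg t t') (v * v') := fun st => by
  simp [mulProg, step, h st, h' (v :: st)]

/-- Pushes the difference. -/
def subProg (t t' : List Instr) : List Instr := t ++ (t' ++ [.negOne, .mul, .add])

theorem Yields.sub {t t' : List Instr} {v v' : R} (h : Yields f y t v) (h' : Yields f y t' v') :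
    Yields f y (subProg t t') (v - v') := fun st => by
  simp [subProg, step, h st, h' (v :: st), sub_eq_add_neg]

/-- Pushes the sum over `j < k`. -/
def sumProg (k : ℕ) (g : ℕ → List Instr) : List Instr :=
  zeroProg ++ (List.range k).flatMap fun j => g j ++ [.add]

theorem yields_sum {k : ℕ} {g : ℕ → List Instr} {v : ℕ → R}
    (h : ∀ j < k, Yields f y (g j) (v j)) :
    Yields f y (sumProg k g) (∑ j ∈ Finset.range k, v j) := by
  intro st
  induction k with
  | zero => simpa [sumProg] using yields_zero st
  | succ k ih =>
    have ih' := ih fun j hj => h j (by omega)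
    simp only [sumProg, exec_append] at ih' ⊢
    rw [List.range_succ, List.flatMap_append, exec_append, ih', Finset.sum_range_succ]
    simp [h k (by omega) _, step]

/-- Pushes the product over `j < k`. -/
def prodProg (k : ℕ) (g : ℕ → List Instr) : List Instr :=
  .one :: (List.range k).flatMap fun j => g j ++ [.mul]

theorem yields_prod {k : ℕ} {g : ℕ → List Instr} {v : ℕ → R}
    (h : ∀ j < k, Yields f y (g j) (v j)) :
    Yields f y (prodProg k g) (∏ j ∈ Finset.range k, v j) := by
  intro st
  induction k with
  | zero => simp [prodProg, step]
  | succ k ih =>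
    have ih' := ih fun j hj => h j (by omega)
    simp only [prodProg, exec_cons] at ih' ⊢
    rw [List.range_succ, List.flatMap_append, exec_append, ih', Finset.prod_range_succ]
    simp [h k (by omega) _, step]

theorem Yields.pow {t : List Instr} {v : R} (h : Yields f y t v) (k : ℕ) :
    Yields f y (prodProg k fun _ => t) (v ^ k) := by
  have := yields_prod (f := f) (y := y) (k := k) (g := fun _ => t) (v := fun _ => v) fun _ _ => h
  rwa [Finset.prod_const, Finset.card_range] at this

/-- Replaces the top `v` of a stack by `v ^ k`, for `k > 0`. -/
def powBlock (k : ℕ) : List Instr :=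
  List.replicate (k - 1) .dup ++ List.replicate (k - 1) .mul

theorem exec_powBlock {k : ℕ} (hk : 0 < k) (v : R) (st : List R) :
    exec f y (powBlock k) (v :: st) = v ^ k :: st := by
  have hdup : ∀ j, exec f y (List.replicate j .dup) (v :: st) =
      v :: (List.replicate j v ++ st) := by
    intro j
    induction j with
    | zero => rfl
    | succ j ih =>
      rw [List.replicate_succ', exec_append, ih]
      rfl
  have hmul : ∀ j (w : R), exec f y (List.replicate j .mul) (w :: (List.replicate j v ++ st)) =
      v ^ j * w :: st := by
    intro j
    induction j with
    | zero => simp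
    | succ j ih =>
      intro w
      have : step f y (w :: (List.replicate (j + 1) v ++ st)) .mul =
          v * w :: (List.replicate j v ++ st) := by
        simp [step, List.replicate_succ]
      rw [List.replicate_succ (a := Instr.mul), exec_cons, this, ih]
      ring_nf
  rw [powBlock, exec_append, hdup, hmul, ← pow_succ, Nat.sub_add_cancel hk]

/-- Pushes `v ^ k ^ l`, where `t` pushes `v`: a power that is too large for repeated
multiplication. -/
def powPowProg (k l : ℕ) (t : List Instr) : List Instr :=
  t ++ (List.range l).flatMap fun _ => powBlock k

theorem Yields.powPow {t : List Instr} {v : R} (h : Yields f y t v) {k : ℕ} (hk : 0 < k) (l : ℕ) :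
    Yields f y (powPowProg k l t) (v ^ k ^ l) := by
  intro st
  induction l with
  | zero => simpa [powPowProg] using h st
  | succ l ih =>
    simp only [powPowProg, exec_append] at ih ⊢
    rw [List.range_succ, List.flatMap_append, exec_append, ih, pow_succ, pow_mul]
    simpa using exec_powBlock hk _ _

/-- Pushes the value of the map that is called at the point with coordinates `g 0`, ...,
`g (N - 1)`. -/
def callProg (N : ℕ) (g : ℕ → List Instr) : List Instr :=
  (List.range N).reverse.flatMap g ++ [.call]

theorem yields_call {g : ℕ → List Instr} {v : ℕ → R} (h : ∀ q < n, Yields f y (g q) (v q)) :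
    Yields f y (callProg n g) (f fun i => v i) := by
  have key : ∀ N ≤ n, ∀ st, exec f y ((List.range N).reverse.flatMap g) st =
      (List.range N).map v ++ st := by
    intro N
    induction N with
    | zero => intro _ st; rfl
    | succ N ih =>
      intro hN st
      rw [List.range_succ, List.reverse_append, List.flatMap_append, exec_append]
      simp only [List.reverse_singleton, List.flatMap_singleton]
      rw [h N (by omega), ih (by omega), List.map_append]
      simp
  intro st
  rw [callProg, exec_append, key n le_rfl]
  have h1 : ∀ i : Fin n, ((List.range n).map v ++ st).getD i 0 = v i := by
    intro i
    rw [List.getD_append _ _ _ _ (by simp), List.getD_eq_getElem _ _ (by simp)]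
    simp
  simp only [exec_cons, exec_nil, step, h1]
  congr 1
  exact List.drop_left' (by simp)

/-- Pushes the entry number `q` of a point of stage `r`, where `t` pushes the entry of the general
point that is restricted to this stage. -/
def stageProg (n r q : ℕ) (t : List Instr) : List Instr :=
  if q / n % n < r then t else if q / n % n = q % n then [.one] else zeroProg

theorem yields_stage {N m r q : ℕ} {t : List Instr} {x : ℕ → R} (hq : q < N)
    (h : Yields f y t (x q)) : Yields f y (stageProg m r q t) (stage N m r x q) := by
  unfold stageProg stage
  rw [if_pos hq]
  split_ifs
  exacts [h, yields_one, yields_zero]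

end Instr

namespace Feasible

open Instr

variable {α : Type} {inp : α → Data}

theorem instr (i : Instr) : Feasible inp fun _ => .ofList Instr.toData [i] := const _

theorem inpProg {i : α → ℕ} (hi : Feasible inp fun a => .ofNat (i a)) :
    Feasible inp fun a => .ofList Instr.toData [.inp (i a)] :=
  ((nat 0).pair hi).pair nil

theorem zeroProg : Feasible inp fun _ => .ofList Instr.toData Instr.zeroProg := const _

theorem appendProg {t t' : α → List Instr} (h : Feasible inp fun a => .ofList Instr.toData (t a))
    (h' : Feasible inp fun a => .ofList Instr.toData (t' a)) :
    Feasible inp fun a => .ofList Instr.toData (t a ++ t' a) :=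
  append (β := fun _ => Instr) (enc := fun _ => Instr.toData) h h'

theorem mulProg {t t' : α → List Instr} (h : Feasible inp fun a => .ofList Instr.toData (t a))
    (h' : Feasible inp fun a => .ofList Instr.toData (t' a)) :
    Feasible inp fun a => .ofList Instr.toData (mulProg (t a) (t' a)) :=
  (h.appendProg h').appendProg (const _)

theorem subProg {t t' : α → List Instr} (h : Feasible inp fun a => .ofList Instr.toData (t a))
    (h' : Feasible inp fun a => .ofList Instr.toData (t' a)) :
    Feasible inp fun a => .ofList Instr.toData (subProg (t a) (t' a)) :=
  h.appendProg (h'.appendProg (const _))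

/-- The context in which the part with index `j < k` of a stack program is written down. -/
abbrev Below (k : α → ℕ) : Type := Member (β := fun _ : α => ℕ) fun a => List.range (k a)

/-- The input in the context `Below k`. -/
abbrev belowInp (inp : α → Data) (k : α → ℕ) (q : Below k) : Data :=
  .node (inp q.1.1) (.ofNat q.1.2)

theorem below {k : α → ℕ} {d : α → Data} (h : Feasible inp d) :
    Feasible (belowInp inp k) fun q => d q.1.1 :=
  h.weaken (β := fun _ => ℕ) (fun _ => Data.ofNat) fun a => List.range (k a)

theorem index {k : α → ℕ} : Feasible (belowInp inp k) fun q => .ofNat q.1.2 := self.snd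

theorem flatMapRange {k : α → ℕ} {g : α → ℕ → List Instr}
    (hk : Feasible inp fun a => .ofNat (k a))
    (hg : Feasible (belowInp inp k) fun q => .ofList Instr.toData (g q.1.1 q.1.2)) :
    Feasible inp fun a => .ofList Instr.toData ((List.range (k a)).flatMap (g a)) :=
  flatMap (β := fun _ => ℕ) (γ := fun _ => Instr) (fun _ => Data.ofNat)
    (fun a => List.range (k a)) (fun _ => Instr.toData) g hk.range hg

theorem sumProg {k : α → ℕ} {g : α → ℕ → List Instr}
    (hk : Feasible inp fun a => .ofNat (k a))
    (hg : Feasible (belowInp inp k) fun q => .ofList Instr.toData (g q.1.1 q.1.2)) :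
    Feasible inp fun a => .ofList Instr.toData (sumProg (k a) (g a)) :=
  zeroProg.appendProg (flatMapRange (g := fun a j => g a j ++ [.add]) hk
    (hg.appendProg (instr .add)))

theorem prodProg {k : α → ℕ} {g : α → ℕ → List Instr}
    (hk : Feasible inp fun a => .ofNat (k a))
    (hg : Feasible (belowInp inp k) fun q => .ofList Instr.toData (g q.1.1 q.1.2)) :
    Feasible inp fun a => .ofList Instr.toData (prodProg (k a) (g a)) :=
  (instr .one).appendProg
    (flatMapRange (g := fun a j => g a j ++ [Instr.mul]) hk (hg.appendProg (instr .mul)))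

theorem powPowProg {l : α → ℕ} {t : α → List Instr} (k : ℕ)
    (hl : Feasible inp fun a => .ofNat (l a))
    (ht : Feasible inp fun a => .ofList Instr.toData (t a)) :
    Feasible inp fun a => .ofList Instr.toData (powPowProg k (l a) (t a)) :=
  ht.appendProg (flatMapRange (g := fun _ _ => powBlock k) hl (const _))

theorem callProg {N : α → ℕ} {g : α → ℕ → List Instr}
    (hN : Feasible inp fun a => .ofNat (N a))
    (hg : Feasible (belowInp inp N) fun q => .ofList Instr.toData (g q.1.1 q.1.2)) :
    Feasible inp fun a => .ofList Instr.toData (callProg (N a) (g a)) := by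
  refine appendProg (flatMap (β := fun _ => ℕ) (γ := fun _ => Instr) (fun _ => Data.ofNat)
    (fun a => (List.range (N a)).reverse) (fun _ => Instr.toData) g
    (reverse (β := fun _ => ℕ) (enc := fun _ => Data.ofNat) hN.range) ?_) (const _)
  exact hg.reindex fun q : Member (fun a => (List.range (N a)).reverse) =>
    (⟨q.1, List.mem_reverse.1 q.2⟩ : Below N)

theorem iteProg {c : α → Prop} [DecidablePred c] {t t' : α → List Instr}
    (hc : Feasible inp fun a => .ofBool (decide (c a)))
    (h : Feasible inp fun a => .ofList Instr.toData (t a))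
    (h' : Feasible inp fun a => .ofList Instr.toData (t' a)) :
    Feasible inp fun a => .ofList Instr.toData (if c a then t a else t' a) :=
  (ite hc h h').congr fun a => by by_cases hca : c a <;> simp [hca]

theorem stageProg {n r q : α → ℕ} {t : α → List Instr} (hn : Feasible inp fun a => .ofNat (n a))
    (hr : Feasible inp fun a => .ofNat (r a)) (hq : Feasible inp fun a => .ofNat (q a))
    (ht : Feasible inp fun a => .ofList Instr.toData (t a)) :
    Feasible inp fun a => .ofList Instr.toData (stageProg (n a) (r a) (q a) (t a)) :=
  iteProg (((hq.div hn).mod hn).lt hr) ht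
    (iteProg (((hq.div hn).mod hn).eq (hq.mod hn)) (instr .one) zeroProg)

end Feasible

/-! ### Downward self-reduction of the permanent -/

namespace Matrix

variable {n : ℕ} {R : Type} [CommRing R]

/-- The minor of `M` without row `p` and column `j`, completed by unit vectors to an `n × n` matrix,
if the rows of `M` after row `p` are unit vectors. -/
def paddedMinor (M : Matrix (Fin n) (Fin n) R) (p j : Fin n) : Matrix (Fin n) (Fin n) R :=
  of fun i c => if i < p then M i (Equiv.swap j p c) else if i = c then 1 else 0

/-- Expansion of the permanent along row `p`, if the rows after row `p` are unit vectors. The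
permutations with `σ p = j` are `swap j p * τ` with `τ p = p`; they contribute nothing if
`j > p`. -/
theorem permanent_eq_sum_paddedMinor (M : Matrix (Fin n) (Fin n) R) (p : Fin n)
    (hM : ∀ i, p < i → ∀ c, M i c = if i = c then 1 else 0) :
    M.permanent = ∑ j, if j ≤ p then M p j * (M.paddedMinor p j).permanent else 0 := by
  have hsum : ∀ A : Matrix (Fin n) (Fin n) R,
      A.permanent = ∑ σ : Equiv.Perm (Fin n), ∏ i, A i (σ i) :=
    fun A => by rw [← permanent_transpose]; rfl
  rw [hsum, ← Finset.sum_fiberwise (s := Finset.univ) (g := fun σ : Equiv.Perm (Fin n) => σ p)]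
  refine Finset.sum_congr rfl fun j _ => ?_
  split_ifs with hj
  · rw [hsum, Finset.mul_sum, Finset.sum_filter,
      ← Equiv.sum_comp (Equiv.mulLeft (Equiv.swap j p))]
    refine Finset.sum_congr rfl fun τ _ => ?_
    simp only [Equiv.coe_mulLeft, Equiv.Perm.mul_apply]
    have hj' : Equiv.swap j p (τ p) = j ↔ τ p = p := by
      rw [Equiv.swap_apply_eq_iff, Equiv.swap_apply_left]
    simp only [hj']
    rw [← Finset.mul_prod_erase _ _ (Finset.mem_univ p),
      ← Finset.mul_prod_erase _ (fun i => M.paddedMinor p j i (τ i)) (Finset.mem_univ p)]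
    split_ifs with hp
    · rw [hp, Equiv.swap_apply_right]
      congr 1
      have h1 : M.paddedMinor p j p p = 1 := by simp [paddedMinor]
      rw [h1, one_mul]
      refine Finset.prod_congr rfl fun i hi => ?_
      have hip := Finset.ne_of_mem_erase hi
      rcases lt_or_ge i p with h | h
      · simp [paddedMinor, h]
      · have hpi : p < i := lt_of_le_of_ne h (Ne.symm hip)
        have hij : i ≠ j := (hj.trans_lt hpi).ne'
        rw [hM i hpi]
        simp only [paddedMinor, of_apply, if_neg (not_lt.2 h)]
        have : (i = Equiv.swap j p (τ i)) ↔ i = τ i := by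
          rw [eq_comm, Equiv.swap_apply_eq_iff, Equiv.swap_apply_of_ne_of_ne hij hip, eq_comm]
        simp only [this]
    · have h1 : M.paddedMinor p j p (τ p) = 0 := by
        simp [paddedMinor, Ne.symm hp]
      rw [h1]
      simp
  · refine Finset.sum_eq_zero fun σ hσ => ?_
    have hσ' : σ p = j := (Finset.mem_filter.1 hσ).2
    refine Finset.prod_eq_zero (Finset.mem_univ j) ?_
    rw [hM j (not_le.1 hj), if_neg]
    intro h
    rw [h] at hσ'
    exact hj (σ.injective hσ' ▸ le_rfl)

end Matrix

theorem permFamily_value (n : ℕ) (y : ℕ → ℤ) :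
    permFamily.value n (fun i => y i) =
      (Matrix.of fun i j : Fin n => y (j + n * i)).permanent := by
  change MvPolynomial.eval (fun i : Fin (n * n) => y i) (Matrix.permanent (Matrix.of
    fun i j : Fin n => MvPolynomial.X (finProdFinEquiv (i, j)))) = _
  simp [Matrix.permanent, map_sum, map_prod]

/-- The position in `y` of entry number `q` of the point whose restriction to stage `p` is the
padded minor of `y` without row `p` and column `j`. -/
def swapColumns (n p j : ℕ) (q : ℕ) : ℕ :=
  n * (q / n) + if q % n = j then p else if q % n = p then j else q % n

theorem swapColumns_eq {n : ℕ} (p j i c : Fin n) :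
    swapColumns n p j (c + n * i) = Equiv.swap j p c + n * i := by
  have hn : 0 < n := p.pos
  rw [swapColumns, Nat.add_mul_mod_self_left, Nat.mod_eq_of_lt c.2,
    Nat.add_mul_div_left _ _ hn, Nat.div_eq_of_lt c.2, Equiv.swap_apply_def]
  simp only [Fin.ext_iff]
  split_ifs <;> ring

theorem matrix_index_lt {n : ℕ} (i c : Fin n) : (c : ℕ) + n * i < n * n :=
  (finProdFinEquiv (i, c)).2

theorem stage_matrix_index {n r : ℕ} (x : ℕ → ℤ) (i c : Fin n) :
    stage (n * n) n r x (c + n * i) =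
      if (i : ℕ) < r then x (c + n * i) else if i = c then 1 else 0 := by
  have hn : 0 < n := c.pos
  rw [stage, if_pos (matrix_index_lt i c), Nat.add_mul_mod_self_left, Nat.mod_eq_of_lt c.2,
    Nat.add_mul_div_left _ _ hn, Nat.div_eq_of_lt c.2, zero_add, Nat.mod_eq_of_lt i.2]
  simp only [Fin.ext_iff]

theorem permFamily_value_stage_zero (n : ℕ) (x : ℕ → ℤ) :
    permFamily.value n (fun i => stage (n * n) n 0 x i) = 1 := by
  rw [permFamily_value]
  simp only [stage_matrix_index]
  refine Eq.trans (congrArg _ ?_) (Matrix.permanent_one (n := Fin n) (R := ℤ))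
  ext i j
  simp [Matrix.one_apply]

/-- The expansion of the permanent along the last general row, at points of stage `p + 1`. -/
theorem permFamily_value_stage_succ {n p : ℕ} (hp : p < n) (x : ℕ → ℤ) :
    permFamily.value n (fun i => stage (n * n) n (p + 1) x i) =
      ∑ j ∈ Finset.range (p + 1), stage (n * n) n (p + 1) x (n * p + j) *
        permFamily.value n fun i =>
          stage (n * n) n p (fun q => stage (n * n) n (p + 1) x (swapColumns n p j q)) i := by
  set y := stage (n * n) n (p + 1) x with hy
  rw [permFamily_value, Matrix.permanent_eq_sum_paddedMinor _ ⟨p, hp⟩]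
  · have hsub : ∀ h : ℕ → ℤ, ∑ j ∈ Finset.range (p + 1), h j =
        ∑ j ∈ Finset.range n, if j < p + 1 then h j else 0 := by
      intro h
      rw [← Finset.sum_filter]
      refine Finset.sum_congr ?_ fun _ _ => rfl
      ext j
      simp only [Finset.mem_range, Finset.mem_filter]
      omega
    rw [hsub, ← Fin.sum_univ_eq_sum_range fun j => if j < p + 1 then y (n * p + j) *
      permFamily.value n fun i => stage (n * n) n p (fun q => y (swapColumns n p j q)) i else 0]
    refine Finset.sum_congr rfl fun j _ => ?_
    have hjp : j ≤ ⟨p, hp⟩ ↔ (j : ℕ) < p + 1 := by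
      rw [Fin.le_def, Nat.lt_succ_iff]
    simp only [hjp]
    congr 1
    rw [Matrix.of_apply, permFamily_value, add_comm]
    congr 2
    ext i c
    rw [Matrix.of_apply, stage_matrix_index, swapColumns_eq ⟨p, hp⟩ j]
    rfl
  · intro i hi c
    have hi' : ¬ (i : ℕ) < p + 1 := by
      have := Fin.lt_def.1 hi
      simp only at this
      omega
    rw [Matrix.of_apply, hy, stage_matrix_index, if_neg hi']

open Instr in
/-- The test for the permanent at stage `r`: the expansion along row `r - 1`. -/
def permTest (n r : ℕ) : List Instr :=
  subProg (callProg (n * n) fun q => [.inp q])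
    (sumProg r fun j => mulProg [.inp (n * (r - 1) + j)]
      (if r = 1 then [.one] else callProg (n * n) fun q =>
        stageProg n (r - 1) q [.inp (swapColumns n (r - 1) j q)]))

theorem yields_permTest (n p : ℕ) (F : permFamily.Point n → ℤ) (y : ℕ → ℤ) :
    Instr.Yields F y (permTest n (p + 1)) (F (fun i => y i) -
      ∑ j ∈ Finset.range (p + 1), y (n * p + j) * if p + 1 = 1 then 1 else
        F fun i => stage (n * n) n p (fun q => y (swapColumns n p j q)) i) := by
  refine (Instr.yields_call fun q _ => Instr.yields_inp q).sub
    (Instr.yields_sum fun j _ => (Instr.yields_inp _).mul ?_)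
  split_ifs
  · exact Instr.yields_one
  · exact Instr.yields_call fun q hq => Instr.yields_stage hq (Instr.yields_inp _)

theorem yields_permTest_of_agreesAt {n p : ℕ} (hp : p < n) {F : permFamily.Point n → ℤ}
    (hF : 1 < p + 1 → AgreesAt permFamily n p F) (x : ℕ → ℤ) :
    Instr.Yields F (stage (n * n) n (p + 1) x) (permTest n (p + 1))
      (F (fun i => stage (n * n) n (p + 1) x i) -
        permFamily.value n fun i => stage (n * n) n (p + 1) x i) := by
  have h := yields_permTest n p F (stage (n * n) n (p + 1) x)
  rw [permFamily_value_stage_succ hp]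
  convert h using 4 with j _
  split_ifs with h1
  · obtain rfl : p = 0 := by omega
    exact permFamily_value_stage_zero n _
  · exact (hF (by omega) _).symm

theorem Feasible.permTest : Feasible (α := ℕ × ℕ) (fun a => .node (.ofNat a.1) (.ofNat a.2))
    fun a => .ofList Instr.toData (permTest a.1 a.2) := by
  have hn : Feasible (α := ℕ × ℕ) (fun a => .node (.ofNat a.1) (.ofNat a.2))
    fun a => .ofNat a.1 := self.fst
  have hr : Feasible (α := ℕ × ℕ) (fun a => .node (.ofNat a.1) (.ofNat a.2))
    fun a => .ofNat a.2 := self.snd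
  refine subProg (callProg (hn.mul hn) (inpProg index)) (sumProg hr (mulProg
    (inpProg ((hn.mul hr.pred).below.add index)) (iteProg (hr.eq (nat 1)).below (const _)
      (callProg (hn.mul hn).below (stageProg hn.below.below hr.pred.below.below index
        (inpProg ?_))))))
  refine (hn.below.below.mul (index.div hn.below.below)).add ((ite
    ((index.mod hn.below.below).eq index.below) hr.pred.below.below
    (ite ((index.mod hn.below.below).eq hr.pred.below.below) index.below
      (index.mod hn.below.below))).congr fun a => ?_)
  split_ifs <;> simp_all

/-- The permanent has a downward self-reduction. -/
def permSelfTest : SelfTest permFamily where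
  test := permTest
  vars_pos n hn := Nat.mul_pos hn hn
  vars_feasible := Feasible.self.mul Feasible.self
  test_feasible := Feasible.permTest
  sound := by
    intro n r hr0 hrn F hF x hx
    obtain ⟨p, rfl⟩ : ∃ p, r = p + 1 := ⟨r - 1, by omega⟩
    exact (yields_permTest_of_agreesAt hrn hF x).result_eq.trans (sub_eq_zero.2 hx)
  complete := by
    intro n r hr0 hrn P hP h x
    obtain ⟨p, rfl⟩ : ∃ p, r = p + 1 := ⟨r - 1, by omega⟩
    exact sub_eq_zero.1 ((yields_permTest_of_agreesAt hrn hP x).result_eq.symm.trans (h x))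

/-! ### Downward self-reduction of `E(X)` -/

section Update

variable {ι J M : Type} [Fintype ι] [DecidableEq ι] [Fintype J] [CommMonoid M]

/-- Every function arises `|J|` times as `Function.update σ p j`, since
`(j, σ) ↦ (σ p, Function.update σ p j)` is an involution. -/
theorem prod_prod_update (p : ι) (h : (ι → J) → M) :
    ∏ j : J, ∏ σ : ι → J, h (Function.update σ p j) = (∏ σ, h σ) ^ Fintype.card J := by
  have hinv : Function.Involutive fun a : J × (ι → J) => (a.2 p, Function.update a.2 p a.1) := by
    rintro ⟨j, σ⟩
    simp
  rw [← Fintype.prod_prod_type' (f := fun j σ => h (Function.update σ p j)),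
    ← Equiv.prod_comp hinv.toPerm]
  simp only [Function.Involutive.coe_toPerm, Function.update_idem, Function.update_eq_self]
  rw [Fintype.prod_prod_type' (f := fun _ σ => h σ), Finset.prod_const, Finset.card_univ]

theorem prod_apply_eq_pow (p : ι) (a : J → M) :
    ∏ σ : ι → J, a (σ p) = (∏ j, a j) ^ Fintype.card J ^ (Fintype.card ι - 1) := by
  rw [← Equiv.prod_comp (Equiv.funSplitAt p J).symm]
  have : ∀ x : J × ({i // i ≠ p} → J), (Equiv.funSplitAt p J).symm x p = x.1 := by
    rintro ⟨j, σ⟩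
    simp [Equiv.funSplitAt]
  simp only [this]
  rw [Fintype.prod_prod_type' (f := fun j _ => a j)]
  simp [Finset.prod_pow, Fintype.card_subtype_compl]

end Update

namespace Matrix

variable {n : ℕ} {R : Type} [CommRing R]

/-- The vector `v`, which stands for column `p` of `M`, is used to clear row `p` in the earlier
columns; column `p` and all later columns are replaced by unit vectors. -/
def clearRow (p : Fin n) (v : Fin n → R) (M : Matrix (Fin n) (Fin n) R) :
    Matrix (Fin n) (Fin n) R :=
  of fun c i => if i < p then v p * M c i - M p i * v c else if i = c then 1 else 0

/-- The column operations scale `p` columns by `M p p`. Afterwards row `p` is `M p p` times a unit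
vector, so that the replacement of column `p` by a unit vector divides the determinant by
`M p p`. -/
theorem det_clearRow (p : Fin n) (M : Matrix (Fin n) (Fin n) R)
    (hM : ∀ i, p < i → ∀ c, M c i = if i = c then 1 else 0) :
    M p p * (clearRow p (fun c => M c p) M).det = M p p ^ (p : ℕ) * M.det := by
  set W := clearRow p (fun c => M c p) M with hW
  -- the column operations, without the replacement of column `p`
  set U : Matrix (Fin n) (Fin n) R := of fun c i =>
    if i < p then (if c = i then M p p else if c = p then -M p i else 0)
      else if c = i then 1 else 0 with hU
  have hUdet : U.det = M p p ^ (p : ℕ) := by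
    rw [det_of_isLowerTriangular]
    · have : ∀ i, U i i = if i < p then M p p else 1 := fun i => by simp [hU]
      simp only [this]
      rw [Finset.prod_ite, Finset.prod_const_one, mul_one, Finset.prod_const]
      congr 1
      have : (Finset.univ.filter fun i : Fin n => i < p) = Finset.Iio p := by ext; simp
      rw [this, Fin.card_Iio]
    · intro c i hci
      have hci' : c < i := hci
      simp only [hU, of_apply]
      split_ifs with h1 h2 h3 h4
      · exact absurd h2 hci'.ne
      · exact absurd (h3 ▸ hci') (not_lt.2 h1.le)
      · rfl
      · exact absurd h4 hci'.ne
      · rfl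
  have hMU : ∀ c i, (M * U) c i =
      if i < p then M p p * M c i - M p i * M c p else M c i := by
    intro c i
    rw [mul_apply]
    split_ifs with hi
    · have : ∀ l, M c l * U l i =
          (if l = i then M p p * M c i else 0) - if l = p then M p i * M c p else 0 := by
        intro l
        simp only [hU, of_apply, if_pos hi]
        split_ifs with h1 h2 h2
        · exact absurd (h1.symm.trans h2) hi.ne
        · rw [h1]; ring
        · rw [h2]; ring
        · ring
      simp only [this, Finset.sum_sub_distrib, Finset.sum_ite_eq', Finset.mem_univ, if_true]
    · simp [hU, if_neg hi]
  have hrow : ∀ i, i ≠ p → (M * U) p i = 0 ∧ W p i = 0 := by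
    intro i hip
    rw [hMU]
    rcases lt_or_ge i p with h | h
    · simp only [hW, clearRow, of_apply, if_pos h]
      constructor <;> ring
    · have hpi : p < i := lt_of_le_of_ne h (Ne.symm hip)
      simp [hW, clearRow, not_lt.2 h, hM i hpi, hip]
  rw [mul_comm (M p p ^ _), ← hUdet, ← det_mul, det_apply, det_apply, Finset.mul_sum]
  refine Finset.sum_congr rfl fun τ _ => ?_
  rw [mul_smul_comm]
  congr 1
  by_cases hτ : τ p = p
  · rw [← Finset.mul_prod_erase _ _ (Finset.mem_univ p),
      ← Finset.mul_prod_erase _ (fun i => (M * U) (τ i) i) (Finset.mem_univ p), hτ]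
    have h1 : W p p = 1 := by simp [hW, clearRow]
    have h2 : (M * U) p p = M p p := by simp [hMU]
    rw [h1, h2, one_mul]
    congr 1
    refine Finset.prod_congr rfl fun i hi => ?_
    have hip := Finset.ne_of_mem_erase hi
    rw [hMU]
    rcases lt_or_ge i p with h | h
    · simp only [hW, clearRow, of_apply, if_pos h]
    · have hpi : p < i := lt_of_le_of_ne h (Ne.symm hip)
      simp only [hW, clearRow, of_apply, if_neg (not_lt.2 h), hM i hpi]
  · have hi : τ.symm p ≠ p := fun h => hτ (by rw [← h, Equiv.apply_symm_apply, h])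
    rw [Finset.prod_eq_zero (Finset.mem_univ (τ.symm p)) (by
      rw [Equiv.apply_symm_apply]; exact (hrow _ hi).2),
      Finset.prod_eq_zero (Finset.mem_univ (τ.symm p)) (by
      rw [Equiv.apply_symm_apply]; exact (hrow _ hi).1), mul_zero]

end Matrix

section ProdDet

variable {n k : ℕ} {R : Type} [CommRing R]

/-- The value of `E(X)` at vectors `v j i`. -/
def prodDet (v : Fin k → Fin n → Fin n → R) : R :=
  ∏ σ : Fin n → Fin k, (Matrix.of fun c i => v (σ i) i c).det

/-- The vectors obtained from `v` by clearing coordinate `p` with the vector `v j p`. -/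
def clearCoord (p : Fin n) (j : Fin k) (v : Fin k → Fin n → Fin n → R) :
    Fin k → Fin n → Fin n → R :=
  fun b i c => if i < p then v j p p * v b i c - v b i p * v j p c else if i = c then 1 else 0

/-- The factor of `E` for `σ`: clearing with the vector `v (σ p) p`, which is column `p` of its
matrix. -/
theorem prodDet_mul_det {p : Fin n} {v : Fin k → Fin n → Fin n → R}
    (hv : ∀ j i, p < i → ∀ c, v j i c = if i = c then 1 else 0) (σ : Fin n → Fin k) :
    v (σ p) p p * (Matrix.of fun c i => clearCoord p (σ p) v (σ i) i c).det =
      v (σ p) p p ^ (p : ℕ) * (Matrix.of fun c i => v (σ i) i c).det :=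
  Matrix.det_clearRow p (Matrix.of fun c i => v (σ i) i c) fun i hi c => hv _ i hi c

/-- The relation between the value of `E` at `v` and its values at the vectors obtained by clearing
coordinate `p`. After clearing with `v j p`, the factor for `σ` does not depend on `σ p`, and for
`σ p = j` it is a known multiple of the factor of `E` at `v`; the exponent `k` counts the values of
`σ p`. -/
theorem prodDet_relation {p : Fin n} {v : Fin k → Fin n → Fin n → R}
    (hv : ∀ j i, p < i → ∀ c, v j i c = if i = c then 1 else 0) :
    (∏ j, v j p p) ^ k ^ n * ∏ j, prodDet (clearCoord p j v) =
      prodDet v ^ k * ((∏ j, v j p p) ^ (p : ℕ)) ^ k ^ n := by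
  have h1 : ∀ a : Fin k → R, (∏ σ : Fin n → Fin k, a (σ p)) ^ k = (∏ j, a j) ^ k ^ n := by
    intro a
    have := prod_prod_update p fun σ : Fin n → Fin k => a (σ p)
    rw [Fintype.card_fin] at this
    rw [← this]
    simp [Finset.prod_pow]
  have h2 : (∏ σ : Fin n → Fin k, (Matrix.of fun c i => clearCoord p (σ p) v (σ i) i c).det) ^ k =
      ∏ j, prodDet (clearCoord p j v) := by
    have := prod_prod_update p fun σ : Fin n → Fin k =>
      (Matrix.of fun c i => clearCoord p (σ p) v (σ i) i c).det
    rw [Fintype.card_fin] at this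
    rw [← this]
    refine Finset.prod_congr rfl fun j _ => Finset.prod_congr rfl fun σ _ => congrArg _ ?_
    ext c i
    simp only [Matrix.of_apply, Function.update_self]
    by_cases hi : i = p
    · simp [hi, clearCoord]
    · rw [Function.update_of_ne hi]
  rw [← h1, ← h2, ← mul_pow, ← Finset.prod_mul_distrib,
    Finset.prod_congr rfl fun σ _ => prodDet_mul_det hv σ, Finset.prod_mul_distrib, mul_pow,
    h1 fun j => v j p p ^ (p : ℕ), Finset.prod_pow, mul_comm]
  rfl

theorem prodDet_of_first {p : Fin n} (hp : (p : ℕ) = 0) {v : Fin k → Fin n → Fin n → R}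
    (hv : ∀ j i, p < i → ∀ c, v j i c = if i = c then 1 else 0) :
    prodDet v = (∏ j, v j p p) ^ k ^ (n - 1) := by
  have h := prod_apply_eq_pow p fun j => v j p p
  rw [Fintype.card_fin, Fintype.card_fin] at h
  rw [← h]
  refine Finset.prod_congr rfl fun σ _ => ?_
  have h1 := prodDet_mul_det hv σ
  rw [hp, pow_zero, one_mul] at h1
  rw [← h1]
  have h2 : (Matrix.of fun c i => clearCoord p (σ p) v (σ i) i c) = 1 := by
    ext c i
    have : ¬ i < p := by rw [Fin.lt_def]; omega
    simp [clearCoord, this, Matrix.one_apply, eq_comm]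
  rw [h2, Matrix.det_one, mul_one]

theorem prodDet_unit :
    prodDet (fun (_ : Fin k) (i c : Fin n) => if i = c then (1 : R) else 0) = 1 := by
  refine Finset.prod_eq_one fun σ _ => ?_
  rw [← Matrix.det_one (n := Fin n) (R := R)]
  congr 1
  ext c i
  simp [Matrix.one_apply, eq_comm]

end ProdDet

/-- The position in `E(X)` of coordinate `c` of the vector with indices `j`, `i`. -/
def vecIndex (n j i c : ℕ) : ℕ := c + n * (i + n * j)

section VecIndex

variable {k n : ℕ}

theorem vecIndex_lt (j : Fin k) (i c : Fin n) : vecIndex n j i c < k * n * n :=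
  (finProdFinEquiv (finProdFinEquiv (j, i), c)).2

theorem vecIndex_div (j i : ℕ) (c : Fin n) : vecIndex n j i c / n = i + n * j := by
  rw [vecIndex, Nat.add_mul_div_left _ _ c.pos, Nat.div_eq_of_lt c.2, zero_add]

theorem vecIndex_mod (j i : ℕ) (c : Fin n) : vecIndex n j i c % n = c := by
  rw [vecIndex, Nat.add_mul_mod_self_left, Nat.mod_eq_of_lt c.2]

theorem stage_vecIndex {R : Type} [CommRing R] {r : ℕ} (x : ℕ → R) (j : Fin k) (i c : Fin n) :
    stage (k * n * n) n r x (vecIndex n j i c) =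
      if (i : ℕ) < r then x (vecIndex n j i c) else if i = c then 1 else 0 := by
  rw [stage, if_pos (vecIndex_lt j i c), vecIndex_div, vecIndex_mod, Nat.add_mul_mod_self_left,
    Nat.mod_eq_of_lt i.2]
  simp only [Fin.ext_iff]

end VecIndex

/-- The vectors that make up the input `y` of `E(X)`. -/
def vectors {R : Type} (k n : ℕ) (y : ℕ → R) (j : Fin k) (i c : Fin n) : R := y (vecIndex n j i c)

theorem eFamily_value (k n : ℕ) (y : ℕ → ℤ) :
    (eFamily k).value n (fun i => y i) = prodDet (vectors k n y) := by
  change MvPolynomial.eval (fun i : Fin (k * n * n) => y i) (∏ σ : Fin n → Fin k, Matrix.det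
    (Matrix.of fun r i : Fin n =>
      MvPolynomial.X (finProdFinEquiv (finProdFinEquiv (σ i, i), r)))) = _
  rw [map_prod]
  refine Finset.prod_congr rfl fun σ _ => ?_
  rw [RingHom.map_det]
  congr 1
  ext c i
  simp [vectors, vecIndex]

theorem vectors_stage_succ {k n p : ℕ} (hp : p < n) (x : ℕ → ℤ) (j : Fin k) (i : Fin n)
    (hi : (⟨p, hp⟩ : Fin n) < i) (c : Fin n) :
    vectors k n (stage (k * n * n) n (p + 1) x) j i c = if i = c then 1 else 0 := by
  have := Fin.lt_def.1 hi
  simp only at this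
  rw [vectors, stage_vecIndex, if_neg (by omega)]

/-- The entries of the general point whose restriction to stage `p` consists of the vectors that are
obtained from `y` by clearing coordinate `p` with vector `j`. -/
def clearEntries (n p j : ℕ) (y : ℕ → ℤ) (q : ℕ) : ℤ :=
  y (vecIndex n j p p) * y q - y (p + n * (q / n)) * y (vecIndex n j p (q % n))

theorem vectors_clearEntries {k n p : ℕ} (hp : p < n) (j : Fin k) (y : ℕ → ℤ) :
    vectors k n (stage (k * n * n) n p (clearEntries n p j y)) =
      clearCoord ⟨p, hp⟩ j (vectors k n y) := by
  funext b i c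
  rw [vectors, stage_vecIndex, clearEntries, vecIndex_div, vecIndex_mod]
  rfl

theorem eFamily_value_stage_zero (k n : ℕ) (x : ℕ → ℤ) :
    (eFamily k).value n (fun i => stage (k * n * n) n 0 x i) = 1 := by
  rw [eFamily_value, ← prodDet_unit (n := n) (k := k)]
  congr 1
  funext j i c
  simp [vectors, stage_vecIndex]

/-- The product of the coordinates number `p` of the vectors `j`, `p`. -/
def pivot (k n p : ℕ) (y : ℕ → ℤ) : ℤ := ∏ j ∈ Finset.range k, y (vecIndex n j p p)

theorem pivot_eq {k n p : ℕ} (hp : p < n) (y : ℕ → ℤ) :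
    pivot k n p y = ∏ j, vectors k n y j ⟨p, hp⟩ ⟨p, hp⟩ :=
  (Fin.prod_univ_eq_prod_range (fun j => y (vecIndex n j p p)) k).symm

/-- At stage `1` the value is a power of the pivot, since all determinants are triangular. -/
theorem eFamily_value_stage_one {k n : ℕ} (hn : 0 < n) (x : ℕ → ℤ) :
    (eFamily k).value n (fun i => stage (k * n * n) n (0 + 1) x i) =
      pivot k n 0 (stage (k * n * n) n (0 + 1) x) ^ k ^ (n - 1) := by
  rw [eFamily_value, pivot_eq hn]
  exact prodDet_of_first rfl (vectors_stage_succ hn x)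

/-- The downward self-reduction of `E(X)`: at a point `y` of stage `p + 1` the `k`-th power of the
value is determined, if the pivot is not zero, by `k` values at points of stage `p`. -/
theorem eFamily_value_relation {k n p : ℕ} (hp : p < n) (x : ℕ → ℤ) :
    let y := stage (k * n * n) n (p + 1) x
    pivot k n p y ^ k ^ n * ∏ j ∈ Finset.range k,
        (eFamily k).value n (fun i => stage (k * n * n) n p (clearEntries n p j y) i) =
      (eFamily k).value n (fun i => y i) ^ k * (pivot k n p y ^ p) ^ k ^ n := by
  intro y
  rw [eFamily_value, pivot_eq hp, ← Fin.prod_univ_eq_prod_range (fun j => (eFamily k).value n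
    (fun i => stage (k * n * n) n p (clearEntries n p j y) i)),
    ← prodDet_relation (p := ⟨p, hp⟩) (vectors_stage_succ hp x)]
  congr 1
  refine Finset.prod_congr rfl fun j _ => ?_
  rw [eFamily_value, vectors_clearEntries hp]

section Test

open Instr

/-- Pushes the pivot. -/
def pivotProg (k n p : ℕ) : List Instr := prodProg k fun j => [.inp (vecIndex n j p p)]

/-- Pushes the value of the map that is called at the given point. -/
def callInputs (N : ℕ) : List Instr := callProg N fun q => [.inp q]

/-- Pushes an entry of the vectors with coordinate `p` cleared. -/
def clearProg (n p j q : ℕ) : List Instr :=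
  subProg (mulProg [.inp (vecIndex n j p p)] [.inp q])
    (mulProg [.inp (p + n * (q / n))] [.inp (vecIndex n j p (q % n))])

/-- The test for `E(X)` at stage `r`: the value at stage `1`, and the relation between the values
at stages `r` and `r - 1`. The exponents `k ^ n` are reached by iterated `k`-th powers, so that the
test has polynomial length. -/
def eTest (k n r : ℕ) : List Instr :=
  if r = 1 then subProg (callInputs (k * n * n)) (powPowProg k (n - 1) (pivotProg k n (r - 1)))
  else subProg (mulProg (prodProg k fun _ => callInputs (k * n * n))
      (powPowProg k n (prodProg (r - 1) fun _ => pivotProg k n (r - 1))))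
    (mulProg (powPowProg k n (pivotProg k n (r - 1))) (prodProg k fun j =>
      callProg (k * n * n) fun q => stageProg n (r - 1) q (clearProg n (r - 1) j q)))

variable {k n : ℕ}

theorem yields_pivotProg (p : ℕ) {F : (eFamily k).Point n → ℤ} {y : ℕ → ℤ} :
    Yields F y (pivotProg k n p) (pivot k n p y) :=
  yields_prod fun _ _ => yields_inp _

theorem yields_callInputs {F : (eFamily k).Point n → ℤ} {y : ℕ → ℤ} :
    Yields F y (callInputs (k * n * n)) (F fun i => y i) :=
  yields_call (n := (eFamily k).vars n) (v := y) fun _ _ => yields_inp _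

theorem yields_eTest_one (hk : 0 < k) (hn : 0 < n) (F : (eFamily k).Point n → ℤ) (x : ℕ → ℤ) :
    Yields F (stage (k * n * n) n (0 + 1) x) (eTest k n (0 + 1))
      (F (fun i => stage (k * n * n) n (0 + 1) x i) -
        (eFamily k).value n fun i => stage (k * n * n) n (0 + 1) x i) := by
  rw [eFamily_value_stage_one hn]
  exact yields_callInputs.sub ((yields_pivotProg 0).powPow hk _)

theorem yields_eTest_of_agreesAt (hk : 0 < k) {p : ℕ} (hp0 : 0 < p) (hp : p < n)
    {F : (eFamily k).Point n → ℤ} (hF : AgreesAt (eFamily k) n p F) (x : ℕ → ℤ) :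
    let y := stage (k * n * n) n (p + 1) x
    Yields F y (eTest k n (p + 1))
      (F (fun i => y i) ^ k * (pivot k n p y ^ p) ^ k ^ n -
        (eFamily k).value n (fun i => y i) ^ k * (pivot k n p y ^ p) ^ k ^ n) := by
  intro y
  rw [← eFamily_value_relation hp]
  rw [eTest, if_neg (by omega), Nat.add_sub_cancel]
  refine ((yields_callInputs.pow k).mul (((yields_pivotProg p).pow p).powPow hk n)).sub
    (((yields_pivotProg p).powPow hk n).mul (yields_prod fun j _ => ?_))
  have hj := hF (clearEntries n p j y)
  refine Eq.subst (motive := Yields F y _) hj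
    (yields_call (n := (eFamily k).vars n) fun q hq => yields_stage hq ?_)
  exact ((yields_inp _).mul (yields_inp _)).sub ((yields_inp _).mul (yields_inp _))

theorem feasible_eTest (k : ℕ) :
    Feasible (α := ℕ × ℕ) (fun a => .node (.ofNat a.1) (.ofNat a.2))
      fun a => .ofList Instr.toData (eTest k a.1 a.2) := by
  have hn : Feasible (α := ℕ × ℕ) (fun a => .node (.ofNat a.1) (.ofNat a.2))
    fun a => .ofNat a.1 := Feasible.self.fst
  have hr : Feasible (α := ℕ × ℕ) (fun a => .node (.ofNat a.1) (.ofNat a.2))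
    fun a => .ofNat a.2 := Feasible.self.snd
  have hp := hr.pred
  have hN := ((Feasible.nat k).mul hn).mul hn
  have hvec : ∀ {α : Type} {inp : α → Data} {n j i c : α → ℕ},
      Feasible inp (fun a => .ofNat (n a)) → Feasible inp (fun a => .ofNat (j a)) →
      Feasible inp (fun a => .ofNat (i a)) → Feasible inp (fun a => .ofNat (c a)) →
      Feasible inp fun a => .ofNat (vecIndex (n a) (j a) (i a) (c a)) :=
    fun hn hj hi hc => hc.add (hn.mul (hi.add (hn.mul hj)))
  have hpivot := Feasible.prodProg
    (g := fun (a : ℕ × ℕ) j => [.inp (vecIndex a.1 j (a.2 - 1) (a.2 - 1))])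
    (Feasible.nat k)
    (Feasible.inpProg (hvec hn.below Feasible.index hp.below hp.below))
  have hcall := Feasible.callProg (g := fun _ q => [.inp q]) hN (Feasible.inpProg Feasible.index)
  refine Feasible.iteProg (hr.eq (Feasible.nat 1))
    (hcall.subProg (Feasible.powPowProg k hn.pred hpivot))
    (((Feasible.prodProg (Feasible.nat k) hcall.below).mulProg
      (Feasible.powPowProg k hn (Feasible.prodProg hp hpivot.below))).subProg
    ((Feasible.powPowProg k hn hpivot).mulProg (Feasible.prodProg (Feasible.nat k)
      (Feasible.callProg hN.below (Feasible.stageProg hn.below.below hp.below.below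
        Feasible.index ?_)))))
  have hn' := hn.below (k := fun _ => k) |>.below (k := fun q => k * q.1.1.1 * q.1.1.1)
  have hp' := hp.below (k := fun _ => k) |>.below (k := fun q => k * q.1.1.1 * q.1.1.1)
  have hj := (Feasible.index (inp := fun a : ℕ × ℕ => .node (.ofNat a.1) (.ofNat a.2))
    (k := fun _ => k)).below (k := fun q => k * q.1.1.1 * q.1.1.1)
  exact ((Feasible.inpProg (hvec hn' hj hp' hp')).mulProg (Feasible.inpProg Feasible.index)).subProg
    ((Feasible.inpProg (hp'.add (hn'.mul (Feasible.index.div hn')))).mulProg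
      (Feasible.inpProg (hvec hn' hj hp' (Feasible.index.mod hn'))))

end Test

/-- The restriction of a polynomial to stage `r`. -/
noncomputable def MvPolynomial.restrictStage {N : ℕ} (n r : ℕ) (P : MvPolynomial (Fin N) ℤ) :
    MvPolynomial (Fin N) ℤ :=
  MvPolynomial.bind₁
    (fun i : Fin N => stage N n r (fun q => if h : q < N then MvPolynomial.X ⟨q, h⟩ else 0) i) P

theorem MvPolynomial.eval_restrictStage {N : ℕ} (n r : ℕ) (P : MvPolynomial (Fin N) ℤ)
    (x : ℕ → ℤ) :
    MvPolynomial.eval (fun i : Fin N => x i) (P.restrictStage n r) =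
      MvPolynomial.eval (fun i : Fin N => stage N n r x i) P := by
  change MvPolynomial.eval₂Hom _ _ _ = _
  rw [restrictStage, MvPolynomial.eval₂Hom_bind₁]
  change MvPolynomial.eval _ P = _
  congr 2
  funext i
  change MvPolynomial.eval _ _ = _
  rw [stage_map]
  refine congrFun (stage_congr fun q hq => ?_) _
  simp [hq]

theorem exists_pad_eq {N : ℕ} (X : Fin N → ℤ) : ∃ x : ℕ → ℤ, X = fun i : Fin N => x i :=
  ⟨pad X, funext fun i => (pad_val X i).symm⟩

/-- The relation between stages `p` and `p + 1` determines a polynomial at stage `p + 1`: the pivot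
is a nonzero polynomial and cancels, the `k`-th powers of `P` and `E` then agree, so that `P = ±E`
at stage `p + 1`, and the sign is read off a point of stage `p` where `E` is not zero. -/
theorem agreesAt_succ_of_pow_eq {k n p : ℕ} (hk : 0 < k) (hp : p < n)
    {P : MvPolynomial (Fin (k * n * n)) ℤ}
    (hP : AgreesAt (eFamily k) n p fun X => MvPolynomial.eval X P)
    (h : ∀ x : ℕ → ℤ, let y := stage (k * n * n) n (p + 1) x
      MvPolynomial.eval (fun i : Fin (k * n * n) => y i) P ^ k * (pivot k n p y ^ p) ^ k ^ n -
        (eFamily k).value n (fun i => y i) ^ k * (pivot k n p y ^ p) ^ k ^ n = 0) :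
    AgreesAt (eFamily k) n (p + 1) fun X => MvPolynomial.eval X P := by
  set A : MvPolynomial (Fin (k * n * n)) ℤ := P.restrictStage n (p + 1)
  set B : MvPolynomial (Fin (k * n * n)) ℤ :=
    MvPolynomial.restrictStage n (p + 1) ((eFamily k).poly n)
  set V : MvPolynomial (Fin (k * n * n)) ℤ :=
    ∏ j : Fin k, MvPolynomial.X ⟨vecIndex n j p p, vecIndex_lt j ⟨p, hp⟩ ⟨p, hp⟩⟩ with hV
  have hV0 : V ≠ 0 := Finset.prod_ne_zero_iff.2 fun j _ => MvPolynomial.X_ne_zero _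
  have hAx : ∀ x : ℕ → ℤ, MvPolynomial.eval (fun i : Fin (k * n * n) => x i) A =
      MvPolynomial.eval (fun i : Fin (k * n * n) => stage (k * n * n) n (p + 1) x i) P :=
    MvPolynomial.eval_restrictStage n (p + 1) P
  have hBx : ∀ x : ℕ → ℤ, MvPolynomial.eval (fun i : Fin (k * n * n) => x i) B =
      (eFamily k).value n (fun i => stage (k * n * n) n (p + 1) x i) :=
    MvPolynomial.eval_restrictStage n (p + 1) _
  have hVx : ∀ x : ℕ → ℤ, MvPolynomial.eval (fun i : Fin (k * n * n) => x i) V =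
      pivot k n p (stage (k * n * n) n (p + 1) x) := by
    intro x
    rw [pivot_eq hp, hV, map_prod]
    refine Finset.prod_congr rfl fun j _ => ?_
    rw [MvPolynomial.eval_X]
    change _ = stage (k * n * n) n (p + 1) x (vecIndex n j (⟨p, hp⟩ : Fin n) (⟨p, hp⟩ : Fin n))
    rw [stage_vecIndex, if_pos (Nat.lt_succ_self p)]
  have hpow : A ^ k * (V ^ p) ^ k ^ n = B ^ k * (V ^ p) ^ k ^ n := by
    refine MvPolynomial.funext fun X => ?_
    obtain ⟨x, rfl⟩ := exists_pad_eq X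
    simp only [map_mul, map_pow, hAx, hBx, hVx]
    exact sub_eq_zero.1 (h x)
  have hpow' : A ^ k = B ^ k :=
    mul_right_cancel₀ (pow_ne_zero _ (pow_ne_zero _ hV0)) hpow
  have hprod : (A - B) * (A + B) = 0 := by
    refine MvPolynomial.funext fun X => ?_
    have hX := congrArg (MvPolynomial.eval X) hpow'
    simp only [map_pow] at hX
    simp only [map_mul, map_sub, map_add, map_zero]
    rcases (pow_eq_pow_iff_of_ne_zero hk.ne').1 hX with h1 | ⟨h1, _⟩ <;> rw [h1] <;> ring
  rcases mul_eq_zero.1 hprod with h1 | h1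
  · intro x
    have := congrArg (MvPolynomial.eval fun i : Fin (k * n * n) => x i) (sub_eq_zero.1 h1)
    rwa [hAx, hBx] at this
  · -- at the point of stage `0`, which belongs to all later stages too, `P = E = 1`
    exfalso
    have h2 := congrArg (MvPolynomial.eval fun i : Fin (k * n * n) =>
      stage (k * n * n) n 0 (fun _ => 0) i) h1
    have h3 : MvPolynomial.eval (fun i : Fin (k * n * n) =>
        stage (k * n * n) n p (stage (k * n * n) n 0 fun _ => 0) i) P = (eFamily k).value n fun i =>
          stage (k * n * n) n p (stage (k * n * n) n 0 fun _ => 0) i :=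
      hP (stage (k * n * n) n 0 fun _ => 0)
    have h4 : (eFamily k).value n (fun i => stage (k * n * n) n 0 (fun _ => 0) i) = 1 :=
      eFamily_value_stage_zero k n _
    rw [stage_stage (Nat.zero_le _), h4] at h3
    rw [map_add, hAx, hBx, stage_stage (Nat.zero_le _), h4, map_zero] at h2
    omega

/-- `E(X)` has a downward self-reduction. -/
noncomputable def eSelfTest (k : ℕ) (hk : 0 < k) : SelfTest (eFamily k) where
  test := eTest k
  vars_pos n hn := Nat.mul_pos (Nat.mul_pos hk hn) hn
  vars_feasible := ((Feasible.nat k).mul Feasible.self).mul Feasible.self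
  test_feasible := feasible_eTest k
  sound := by
    intro n r hr0 hrn F hF x hx
    obtain ⟨p, rfl⟩ : ∃ p, r = p + 1 := ⟨r - 1, by omega⟩
    rcases Nat.eq_zero_or_pos p with rfl | hp
    · exact (yields_eTest_one hk hrn F x).result_eq.trans (sub_eq_zero.2 hx)
    · refine (yields_eTest_of_agreesAt hk hp hrn (hF (by omega)) x).result_eq.trans ?_
      exact sub_eq_zero.2 (congrArg (fun z => z ^ k * _) hx)
  complete := by
    intro n r hr0 hrn P hP h
    obtain ⟨p, rfl⟩ : ∃ p, r = p + 1 := ⟨r - 1, by omega⟩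
    rcases Nat.eq_zero_or_pos p with rfl | hp
    · intro x
      exact sub_eq_zero.1 ((yields_eTest_one hk hrn _ x).result_eq.symm.trans (h x))
    · have hP' := hP (by omega)
      exact agreesAt_succ_of_pow_eq hk hrn hP' fun x =>
        (yields_eTest_of_agreesAt hk hp hrn hP' x).result_eq.symm.trans (h x)

theorem theorem4p5 (κ : Sense) (hPIT : BlackBoxPITDerandomized) :
    (UniformlyHard κ permFamily →
      HasExplicitProof κ permFamily ∧ EfficientDiagonalization κ permFamily) ∧
    (∀ k : ℕ, 3 ≤ k → UniformlyHard κ (eFamily k) →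
      HasExplicitProof κ (eFamily k) ∧ EfficientDiagonalization κ (eFamily k)) :=
  ⟨permSelfTest.hasExplicitProof_and_efficientDiagonalization hPIT,
    fun k hk => (eSelfTest k (by omega)).hasExplicitProof_and_efficientDiagonalization hPIT⟩
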